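/- Let $d\ge 2$. On a probability space let $(S^x_j)_{j\ge 0}$, $x\in\mathbb Z^d$, be independent simple random walks on $\mathbb Z^d$ with $S^x_0=x$. For $x,y\in\mathbb Z^d$ put $t(x,y)=\inf\{j\ge 0: S^x_j=y\}$ (with $\inf\emptyset=\infty$) and $$T(x,y)=\inf\Big\{\sum_{i=1}^k t(x_{i-1},x_i)\;:\;k\ge 0,\ x_0,\dots,x_k\in\mathbb Z^d,\ x_0=x,\ x_k=y\Big\}.$$ An optimal path from $x$ to $y$ is a finite sequence $\gamma=(x_0,\dots,x_k)$ of distinct points of $\mathbb Z^d$ with $x_0=x$, $x_k=y$ and $\sum_{i=1}^k t(x_{i-1},x_i)=T(x,y)$; its length is its number of vertices, $l(\gamma)=k+1$. Let $\mathbb O(x)$ be the set of optimal paths from $0$ to $x$, and $|x|_1=|x_1|+\dots+|x_d|$. Then there exist constants $\varepsilon,c,C>0$, depending only on $d$, such that for every $x\in\mathbb Z^d$ $$\mathbb P\Big(\mathbb O(x)\neq\emptyset\ \text{ and }\ c|x|_1\le l(\gamma)\le C|x|_1\ \text{ for every }\gamma\in\mathbb O(x)\Big)\ \ge\ 1-e^{-|x|_1^{\varepsilon}}.$$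 -/

import Mathlib

open MeasureTheory ProbabilityTheory
open scoped ENNReal

namespace Frog

/-- The integer lattice `ℤ^d`. -/
abbrev Lattice (d : ℕ) : Type := Fin d → ℤ

/-- The `ℓ¹`-norm `|x|₁ = |x_1| + ... + |x_d|` of a lattice point. -/
def norm1 {d : ℕ} (x : Lattice d) : ℕ := ∑ i, (x i).natAbs

/-- `X` is a simple random walk on `ℤ^d` started at `x`: its steps are independent, and each step
is uniformly distributed on the `2d` lattice vectors of `ℓ¹`-norm one. -/
structure IsSimpleRandomWalk {d : ℕ} {Ω : Type*} [MeasurableSpace Ω] (μ : Measure Ω)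
    (x : Lattice d) (X : ℕ → Ω → Lattice d) : Prop where
  measurable : ∀ n, Measurable (X n)
  start : ∀ ω, X 0 ω = x
  indep_steps : iIndepFun (fun n ω => X (n + 1) ω - X n ω) μ
  step_law : ∀ n (e : Lattice d), norm1 e = 1 →
    μ {ω | X (n + 1) ω - X n ω = e} = (2 * (d : ℝ≥0∞))⁻¹

/-- `S x` (for `x ∈ ℤ^d`) are independent simple random walks, the walk `S x` starting at `x`.
Independence is that of the whole trajectories `(S x n)_n`. -/
structure IsFrogFamily {d : ℕ} {Ω : Type*} [MeasurableSpace Ω] (μ : Measure Ω)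
    (S : Lattice d → ℕ → Ω → Lattice d) : Prop where
  walk : ∀ x, IsSimpleRandomWalk μ x (S x)
  indep : iIndepFun (fun x ω => (fun n => S x n ω : ℕ → Lattice d)) μ

/-- For a realization `w` of the walks, `t(x,y) = inf {j ≥ 0 : w x j = y}`, which is `∞` if the
walk from `x` never visits `y`. -/
noncomputable def hitTime {d : ℕ} (w : Lattice d → ℕ → Lattice d) (x y : Lattice d) : ℕ∞ :=
  ⨅ (j : ℕ) (_ : w x j = y), (j : ℕ∞)

/-- The sum `t(γ_0,γ_1) + ... + t(γ_{k-1},γ_k)` along a finite sequence of lattice points. -/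
noncomputable def pathTime {d : ℕ} (w : Lattice d → ℕ → Lattice d) {k : ℕ}
    (γ : Fin (k + 1) → Lattice d) : ℕ∞ :=
  ∑ i : Fin k, hitTime w (γ i.castSucc) (γ i.succ)

/-- The first passage time `T(x,y)`: the infimum of the sums of hitting times along all finite
sequences of lattice points from `x` to `y`. -/
noncomputable def passageTime {d : ℕ} (w : Lattice d → ℕ → Lattice d) (x y : Lattice d) : ℕ∞ :=
  ⨅ (k : ℕ) (γ : Fin (k + 1) → Lattice d) (_ : γ 0 = x) (_ : γ (Fin.last k) = y), pathTime w γ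

/-- `γ` is an optimal path from `x` to `y`: a sequence of `k + 1` distinct vertices from `x` to `y`
whose total time is the first passage time. -/
structure IsOptimalPath {d : ℕ} (w : Lattice d → ℕ → Lattice d) (x y : Lattice d) {k : ℕ}
    (γ : Fin (k + 1) → Lattice d) : Prop where
  distinct : Function.Injective γ
  first : γ 0 = x
  last : γ (Fin.last k) = y
  optimal : pathTime w γ = passageTime w x y

/-- The set of lengths (numbers of vertices) of the optimal paths from `x` to `y`. -/
def optimalLengths {d : ℕ} (w : Lattice d → ℕ → Lattice d) (x y : Lattice d) : Set ℕ :=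
  {l | ∃ (k : ℕ) (γ : Fin (k + 1) → Lattice d), IsOptimalPath w x y γ ∧ l = k + 1}

end Frog

namespace Frog

universe u

variable {d : ℕ}

/-! A path with `k` steps through distinct vertices takes time at least `k`, because each hitting
time between distinct points is at least one (`le_pathTime_of_injective`). Hence existence of
optimal paths and the upper bound on their length both follow from T(0,x) ≤ C|x|₁ off a small event.
The lower bound says that few steps cannot cover the distance |x|₁ within time C|x|₁.

Linear growth rests on a tail estimate (`exists_passageTime_tail`): for |y|₁ ≤ L, T(0,y) ≤ L^g off
an event of probability at most exp(-L), even if only walks started within distance L^g move. The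
walk from 0 first visits a power of L many sites. These activate sites in a box of side R = L^a,
those activate sites in the next box, and so on; the boxes are disjoint, so each generation uses
fresh walks. A walk hits a given point at distance at most LR, during a suitable time window, with
probability at least L³/R^d (`IsSimpleRandomWalk.measureReal_window_ge`): a heat kernel lower bound
divided by the expected number of returns. An exponential weight in the number of covered sites
(`IsFrogFamily.integral_coverWeight_le`) shows that each generation is L times larger than the one
before. After a number of generations depending only on d there are R^d/L active sites, enough to
hit y.

Along a geodesic from 0 to x, the passage times between neighbours, computed in balls of radius L^g
and truncated at L^g, have bounded means and are independent when the balls are disjoint. Chernoff's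
bound in each residue class of indices gives `exists_passageTime_linear`.

Short fast paths are excluded by a first moment computation
(`IsFrogFamily.measure_exists_pathTime_le`). Distinct vertices use independent walks, so the
discounted expectation of a path is a product of Green functions of its increments. After an
exponential tilt in the direction of x, the sum over all paths is at most the k-th power of a
geometric series, while the tilt gains a factor exponential in |x|₁; for k ≤ c|x|₁ the gain wins
(`exists_measureReal_short_path_le`).

Taking L to be a small power of |x|₁ makes all errors stretched exponential; bounded |x|₁ are
covered by the tail estimate at one fixed scale. -/

/-! ### Geometry of the `ℓ¹`-norm -/

theorem norm1_zero : norm1 (0 : Lattice d) = 0 := by simp [norm1]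

theorem norm1_eq_zero {x : Lattice d} : norm1 x = 0 ↔ x = 0 := by
  simp [norm1, funext_iff]

theorem norm1_neg (x : Lattice d) : norm1 (-x) = norm1 x := by simp [norm1]

theorem norm1_add_le (x y : Lattice d) : norm1 (x + y) ≤ norm1 x + norm1 y := by
  simp only [norm1, ← Finset.sum_add_distrib]
  exact Finset.sum_le_sum fun i _ => Int.natAbs_add_le _ _

theorem norm1_sub_comm (x y : Lattice d) : norm1 (x - y) = norm1 (y - x) := by
  rw [← norm1_neg, neg_sub]

theorem norm1_sub_le (x y z : Lattice d) : norm1 (x - z) ≤ norm1 (x - y) + norm1 (y - z) := by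
  simpa using norm1_add_le (x - y) (y - z)

theorem natAbs_le_norm1 (x : Lattice d) (i : Fin d) : (x i).natAbs ≤ norm1 x :=
  Finset.single_le_sum (f := fun i => (x i).natAbs) (fun _ _ => Nat.zero_le _) (Finset.mem_univ i)

theorem norm1_single (i : Fin d) (a : ℤ) : norm1 (Pi.single i a : Lattice d) = a.natAbs := by
  classical
  unfold norm1
  rw [Finset.sum_eq_single i]
  · simp
  · intro j _ hj
    simp [Pi.single_eq_of_ne hj]
  · simp

theorem exists_of_norm1_eq_one {e : Lattice d} (he : norm1 e = 1) :
    ∃ i, e = Pi.single i 1 ∨ e = -Pi.single i 1 := by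
  classical
  have hne : e ≠ 0 := fun h => by simp [h, norm1_zero] at he
  obtain ⟨i, hi⟩ := Function.ne_iff.1 hne
  have hsplit : (e i).natAbs + ∑ j ∈ Finset.univ.erase i, (e j).natAbs = 1 := by
    rw [Finset.add_sum_erase _ (fun j => (e j).natAbs) (Finset.mem_univ i)]; exact he
  have hi' : 1 ≤ (e i).natAbs := Int.natAbs_pos.2 hi
  have hz : ∑ j ∈ Finset.univ.erase i, (e j).natAbs = 0 := by omega
  have hzero : ∀ j, j ≠ i → e j = 0 := fun j hj => by
    have := Finset.sum_eq_zero_iff.1 hz j (by simp [hj])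
    simpa using this
  have habs : (e i).natAbs = 1 := by omega
  refine ⟨i, (Int.natAbs_eq (e i)).imp (fun h => ?_) (fun h => ?_)⟩ <;>
  · funext j
    by_cases hj : j = i
    · subst hj
      rw [h, habs]; simp
    · simp [hzero j hj, Pi.single_eq_of_ne hj]

theorem exists_norm1_sub_eq {x : Lattice d} {n : ℕ} (hx : norm1 x = n + 1) :
    ∃ y, norm1 y = n ∧ norm1 (x - y) = 1 := by
  classical
  have hne : x ≠ 0 := fun h => by simp [h, norm1_zero] at hx
  obtain ⟨i, hi⟩ := Function.ne_iff.1 hne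
  have hi : x i ≠ 0 := hi
  have key : ∀ s : ℤ, s.natAbs = 1 → (x i - s).natAbs + 1 = (x i).natAbs →
      ∃ y, norm1 y = n ∧ norm1 (x - y) = 1 := by
    intro s hs hxs
    refine ⟨x - Pi.single i s, ?_, by simp [norm1_single, hs]⟩
    unfold norm1 at hx ⊢
    rw [← Finset.add_sum_erase _ _ (Finset.mem_univ i)] at hx ⊢
    have : ∑ j ∈ Finset.univ.erase i, ((x - Pi.single i s : Lattice d) j).natAbs
        = ∑ j ∈ Finset.univ.erase i, (x j).natAbs := by
      refine Finset.sum_congr rfl fun j hj => ?_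
      simp [Pi.single_eq_of_ne (Finset.ne_of_mem_erase hj)]
    rw [this]
    simp only [Pi.sub_apply, Pi.single_eq_same]
    omega
  rcases lt_or_gt_of_ne hi with h | h
  · exact key (-1) (by simp) (by omega)
  · exact key 1 (by simp) (by omega)

/-- Every lattice point is joined to the origin by a nearest neighbour path of minimal length. -/
theorem exists_unit_path {n : ℕ} (x : Lattice d) (hx : norm1 x = n) :
    ∃ y : ℕ → Lattice d, y 0 = 0 ∧ y n = x ∧ ∀ i < n, norm1 (y (i + 1) - y i) = 1 := by
  induction n generalizing x with
  | zero => exact ⟨fun _ => 0, rfl, (norm1_eq_zero.1 hx).symm, by simp⟩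
  | succ n ih =>
    obtain ⟨z, hz, hxz⟩ := exists_norm1_sub_eq hx
    obtain ⟨y, h0, hn, hs⟩ := ih z hz
    refine ⟨fun i => if i ≤ n then y i else x, by simp [h0], by simp, fun i hi => ?_⟩
    rcases Nat.lt_succ_iff_lt_or_eq.1 hi with h | rfl
    · have h1 : i + 1 ≤ n := h
      simp [h1, h.le, hs i h]
    · simp [hn, hxz]

theorem norm1_sub_le_of_unit_path {n : ℕ} {y : ℕ → Lattice d}
    (hs : ∀ i < n, norm1 (y (i + 1) - y i) = 1) {i j : ℕ} (hij : i ≤ j) (hj : j ≤ n) :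
    norm1 (y j - y i) ≤ j - i := by
  induction j, hij using Nat.le_induction with
  | base => simp [norm1_zero]
  | succ j hij ih =>
    have := norm1_sub_le (y (j + 1)) (y j) (y i)
    have h1 := hs j (by omega)
    have h2 := ih (by omega)
    omega

/-- A path of `n` unit steps ending at distance `n` leaves no slack in the triangle inequality, so
it is a geodesic. This makes balls around points with distant indices disjoint. -/
theorem le_norm1_sub_of_unit_path {n : ℕ} {y : ℕ → Lattice d} (h0 : y 0 = 0)
    (hn : norm1 (y n) = n) (hs : ∀ i < n, norm1 (y (i + 1) - y i) = 1) {i j : ℕ} (hij : i ≤ j)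
    (hj : j ≤ n) : j - i ≤ norm1 (y j - y i) := by
  have h1 := norm1_sub_le_of_unit_path hs (Nat.zero_le i) (hij.trans hj)
  have h2 := norm1_sub_le_of_unit_path hs hj le_rfl
  rw [h0, sub_zero] at h1
  have h3 := norm1_add_le (y n - y j) (y j)
  have h4 := norm1_add_le (y j - y i) (y i)
  simp only [sub_add_cancel] at h3 h4
  omega

/-- The `ℓ¹`-ball as a finite set. -/
noncomputable def ball (y : Lattice d) (t : ℕ) : Finset (Lattice d) :=
  (Fintype.piFinset fun i => Finset.Icc (y i - t) (y i + t)).filter fun z => norm1 (z - y) ≤ t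

theorem mem_ball {y z : Lattice d} {t : ℕ} : z ∈ ball y t ↔ norm1 (z - y) ≤ t := by
  simp only [ball, Finset.mem_filter, Fintype.mem_piFinset, Finset.mem_Icc, and_iff_right_iff_imp]
  intro h i
  have := (natAbs_le_norm1 (z - y) i).trans h
  simp only [Pi.sub_apply] at this
  omega

/-! ### Passage times, chains of activations and optimal paths -/

/-- `reach w x k y s`: there is a sequence of `k` activations leading from `x` to `y` with
total time `s`. -/
def reach (w : Lattice d → ℕ → Lattice d) (x : Lattice d) : ℕ → Lattice d → ℕ → Prop
  | 0, y, s => y = x ∧ s = 0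
  | k + 1, y, s => ∃ z s' j, reach w x k z s' ∧ w z j = y ∧ s = s' + j

theorem hitTime_le_of_eq {w : Lattice d → ℕ → Lattice d} {x y : Lattice d} {j : ℕ}
    (h : w x j = y) : hitTime w x y ≤ j := iInf₂_le j h

theorem exists_of_hitTime_ne_top {w : Lattice d → ℕ → Lattice d} {x y : Lattice d}
    (h : hitTime w x y ≠ ⊤) : ∃ j : ℕ, w x j = y ∧ hitTime w x y = j := by
  classical
  have hex : ∃ j, w x j = y := by
    by_contra hne
    push Not at hne
    exact h (by simp [hitTime, hne])
  refine ⟨Nat.find hex, Nat.find_spec hex, le_antisymm (hitTime_le_of_eq (Nat.find_spec hex)) ?_⟩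
  exact le_iInf₂ fun j hj => by exact_mod_cast Nat.find_min' hex hj

theorem pathTime_snoc {w : Lattice d → ℕ → Lattice d} {k : ℕ} (γ : Fin (k + 1) → Lattice d)
    (y : Lattice d) :
    pathTime w (Fin.snoc γ y : Fin (k + 2) → Lattice d)
      = pathTime w γ + hitTime w (γ (Fin.last k)) y := by
  unfold pathTime
  rw [Fin.sum_univ_castSucc]
  congr 1
  · refine Finset.sum_congr rfl fun i _ => ?_
    have h : (i.castSucc.succ : Fin (k + 2)) = i.succ.castSucc := rfl
    rw [h, Fin.snoc_castSucc, Fin.snoc_castSucc]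
  · rw [Fin.snoc_castSucc, Fin.succ_last, Fin.snoc_last]

theorem exists_reach_of_pathTime {w : Lattice d → ℕ → Lattice d} {k : ℕ}
    (γ : Fin (k + 1) → Lattice d) (h : pathTime w γ ≠ ⊤) :
    ∃ s : ℕ, reach w (γ 0) k (γ (Fin.last k)) s ∧ pathTime w γ = s := by
  induction k with
  | zero => exact ⟨0, ⟨rfl, rfl⟩, by simp [pathTime]⟩
  | succ k ih =>
    have hγ : γ = (Fin.snoc (Fin.init γ : Fin (k + 1) → Lattice d) (γ (Fin.last (k + 1))) :
      Fin (k + 2) → Lattice d) := (Fin.snoc_init_self γ).symm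
    rw [hγ, pathTime_snoc] at h ⊢
    rw [← hγ]
    rw [Ne, ENat.add_eq_top, not_or] at h
    obtain ⟨s, hs, hps⟩ := ih _ h.1
    obtain ⟨j, hj, hjt⟩ := exists_of_hitTime_ne_top h.2
    exact ⟨s + j, ⟨_, s, j, hs, hj, rfl⟩, by rw [hps, hjt]; push_cast; rfl⟩

/-- Loop erasure: a chain of activations may be taken with distinct vertices. -/
theorem exists_injective_of_reach {w : Lattice d → ℕ → Lattice d} {x : Lattice d} {k : ℕ}
    {y : Lattice d} {s : ℕ} (h : reach w x k y s) :
    ∃ (m : ℕ) (γ : Fin (m + 1) → Lattice d), Function.Injective γ ∧ γ 0 = x ∧ γ (Fin.last m) = y ∧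
      pathTime w γ ≤ s := by
  induction k generalizing y s with
  | zero =>
    obtain ⟨rfl, rfl⟩ := h
    exact ⟨0, fun _ => y, fun _ _ _ => Subsingleton.elim (α := Fin 1) _ _, rfl, rfl,
      by simp [pathTime]⟩
  | succ k ih =>
    obtain ⟨z, s', j, hz, hj, rfl⟩ := h
    obtain ⟨m, γ, hinj, h0, hl, hp⟩ := ih hz
    by_cases hy : ∃ i, γ i = y
    · obtain ⟨i, hi⟩ := hy
      have hle : (i : ℕ) + 1 ≤ m + 1 := i.isLt
      refine ⟨i, fun l => γ (Fin.castLE hle l), fun a b hab => ?_, ?_, ?_, ?_⟩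
      · exact Fin.castLE_injective hle (hinj hab)
      · exact h0
      · rw [← hi]; congr 1
      · refine le_trans ?_ (hp.trans (by exact_mod_cast Nat.le_add_right _ _))
        unfold pathTime
        have him : (i : ℕ) ≤ m := by omega
        have : ∑ l : Fin (i : ℕ), hitTime w (γ (Fin.castLE hle l.castSucc))
              (γ (Fin.castLE hle l.succ))
            = ∑ l ∈ Finset.univ.map (Fin.castLEEmb him), hitTime w (γ l.castSucc) (γ l.succ) := by
          rw [Finset.sum_map]; rfl
        rw [this]
        exact Finset.sum_le_sum_of_subset (Finset.subset_univ _)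
    · push Not at hy
      refine ⟨m + 1, (Fin.snoc γ y : Fin (m + 2) → Lattice d), ?_, ?_, ?_, ?_⟩
      · rw [Fin.snoc_injective_iff]
        exact ⟨hinj, fun ⟨i, hi⟩ => hy i hi⟩
      · have : (0 : Fin (m + 2)) = Fin.castSucc 0 := rfl
        rw [this, Fin.snoc_castSucc, h0]
      · rw [Fin.snoc_last]
      · rw [pathTime_snoc, hl]
        push_cast
        exact add_le_add hp (hitTime_le_of_eq hj)

theorem passageTime_le_pathTime (w : Lattice d → ℕ → Lattice d) {k : ℕ}
    (γ : Fin (k + 1) → Lattice d) :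
    passageTime w (γ 0) (γ (Fin.last k)) ≤ pathTime w γ :=
  iInf_le_of_le k (iInf_le_of_le γ (iInf_le_of_le rfl (iInf_le_of_le rfl le_rfl)))

theorem passageTime_le_of_reach {w : Lattice d → ℕ → Lattice d} {x y : Lattice d} {k s : ℕ}
    (h : reach w x k y s) : passageTime w x y ≤ s := by
  obtain ⟨m, γ, -, rfl, rfl, hp⟩ := exists_injective_of_reach h
  exact (passageTime_le_pathTime w γ).trans hp

theorem exists_reach_of_passageTime_le {w : Lattice d → ℕ → Lattice d} {x y : Lattice d} {s : ℕ}
    (h : passageTime w x y ≤ s) : ∃ k s', s' ≤ s ∧ reach w x k y s' := by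
  by_contra hne
  push Not at hne
  have : ((s + 1 : ℕ) : ℕ∞) ≤ passageTime w x y := by
    refine le_iInf fun k => le_iInf fun γ => le_iInf₂ fun h0 hl => ?_
    by_cases ht : pathTime w γ = ⊤
    · simp [ht]
    · obtain ⟨s', hs', hp⟩ := exists_reach_of_pathTime γ ht
      rw [h0, hl] at hs'
      rw [hp]
      by_contra hlt
      push Not at hlt
      exact hne k s' (by have : s' < s + 1 := by exact_mod_cast hlt
                         omega) hs'
  have := this.trans h
  have : s + 1 ≤ s := by exact_mod_cast this
  omega

/-- Times are natural numbers, so a finite infimum is attained. The right-hand side is a countable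
existential, suited to concatenation and to measurability; a chain may use any visit and not only
the first, which can only cost time. -/
theorem passageTime_le_iff {w : Lattice d → ℕ → Lattice d} {x y : Lattice d} {s : ℕ} :
    passageTime w x y ≤ s ↔ ∃ k s', s' ≤ s ∧ reach w x k y s' :=
  ⟨exists_reach_of_passageTime_le, fun ⟨_, _, hs, h⟩ =>
    (passageTime_le_of_reach h).trans (by exact_mod_cast hs)⟩

theorem reach_trans {w : Lattice d → ℕ → Lattice d} {x y : Lattice d} {k s : ℕ}
    (h : reach w x k y s) {k' s' : ℕ} {z : Lattice d} (h' : reach w y k' z s') :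
    reach w x (k + k') z (s + s') := by
  induction k' generalizing z s' with
  | zero => obtain ⟨rfl, rfl⟩ := h'; exact h
  | succ k' ih =>
    obtain ⟨u, s'', j, hu, hj, rfl⟩ := h'
    exact ⟨u, s + s'', j, ih hu, hj, by ring⟩

theorem passageTime_self (w : Lattice d → ℕ → Lattice d) (x : Lattice d) :
    passageTime w x x ≤ (0 : ℕ) := passageTime_le_of_reach (k := 0) ⟨rfl, rfl⟩

theorem passageTime_le_add {w : Lattice d → ℕ → Lattice d} {x y z : Lattice d} {s s' : ℕ}
    (h : passageTime w x y ≤ s) (h' : passageTime w y z ≤ s') :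
    passageTime w x z ≤ (s + s' : ℕ) := by
  obtain ⟨k, a, ha, hr⟩ := passageTime_le_iff.1 h
  obtain ⟨k', a', ha', hr'⟩ := passageTime_le_iff.1 h'
  exact passageTime_le_iff.2 ⟨_, _, by omega, reach_trans hr hr'⟩

theorem passageTime_le_add_step {w : Lattice d → ℕ → Lattice d} {x y z : Lattice d} {s j : ℕ}
    (h : passageTime w x y ≤ s) (h' : w y j = z) : passageTime w x z ≤ (s + j : ℕ) := by
  obtain ⟨k, a, ha, hr⟩ := passageTime_le_iff.1 h
  exact passageTime_le_iff.2 ⟨k + 1, a + j, by omega, y, a, j, hr, h', rfl⟩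

/-- The realization in which only the walks started in `A` move. -/
def mask (A : Set (Lattice d)) [DecidablePred (· ∈ A)] (w : Lattice d → ℕ → Lattice d) :
    Lattice d → ℕ → Lattice d :=
  fun x j => if x ∈ A then w x j else x

/-- A frozen walk stays at its site, so a step made by it is mere waiting and can be deleted. -/
theorem reach_mask {A : Set (Lattice d)} [DecidablePred (· ∈ A)] {w : Lattice d → ℕ → Lattice d}
    {x y : Lattice d} {k s : ℕ} (h : reach (mask A w) x k y s) :
    ∃ k' s', s' ≤ s ∧ reach w x k' y s' := by
  induction k generalizing y s with
  | zero => exact ⟨0, s, le_rfl, h⟩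
  | succ k ih =>
    obtain ⟨z, s', j, hz, hj, rfl⟩ := h
    obtain ⟨k', s'', hs, hr⟩ := ih hz
    by_cases hA : z ∈ A
    · rw [mask, if_pos hA] at hj
      exact ⟨k' + 1, s'' + j, by omega, z, s'', j, hr, hj, rfl⟩
    · rw [mask, if_neg hA] at hj
      exact ⟨k', s'', by omega, hj ▸ hr⟩

theorem passageTime_le_mask (A : Set (Lattice d)) [DecidablePred (· ∈ A)]
    {w : Lattice d → ℕ → Lattice d} {x y : Lattice d} {s : ℕ}
    (h : passageTime (mask A w) x y ≤ s) : passageTime w x y ≤ s := by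
  obtain ⟨k, a, ha, hr⟩ := passageTime_le_iff.1 h
  obtain ⟨k', s', hs, hr'⟩ := reach_mask hr
  exact passageTime_le_iff.2 ⟨k', s', hs.trans ha, hr'⟩

theorem reach_translate {w : Lattice d → ℕ → Lattice d} (v : Lattice d) {x y : Lattice d} {k s : ℕ}
    (h : reach (fun z j => w (z + v) j - v) x k y s) : reach w (x + v) k (y + v) s := by
  induction k generalizing y s with
  | zero => obtain ⟨rfl, rfl⟩ := h; exact ⟨rfl, rfl⟩
  | succ k ih =>
    obtain ⟨z, s', j, hz, rfl, rfl⟩ := h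
    exact ⟨z + v, s', j, ih hz, by simp, rfl⟩

theorem passageTime_translate {w : Lattice d → ℕ → Lattice d} (v : Lattice d) {x y : Lattice d}
    {s : ℕ} (h : passageTime (fun z j => w (z + v) j - v) x y ≤ s) :
    passageTime w (x + v) (y + v) ≤ s := by
  obtain ⟨k, a, ha, hr⟩ := passageTime_le_iff.1 h
  exact passageTime_le_iff.2 ⟨k, a, ha, reach_translate v hr⟩

/-- The finite infimum is attained by a chain, and erasing its loops does not increase the time. -/
theorem exists_isOptimalPath {w : Lattice d → ℕ → Lattice d} {x y : Lattice d} {s : ℕ}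
    (h : passageTime w x y ≤ s) :
    ∃ (k : ℕ) (γ : Fin (k + 1) → Lattice d), IsOptimalPath w x y γ := by
  obtain ⟨t, ht⟩ := ENat.ne_top_iff_exists.1 (ne_top_of_le_ne_top (ENat.natCast_ne_top s) h)
  obtain ⟨k, a, ha, hr⟩ := passageTime_le_iff.1 ht.symm.le
  obtain ⟨m, γ, hinj, h0, hl, hp⟩ := exists_injective_of_reach hr
  refine ⟨m, γ, hinj, h0, hl, le_antisymm (hp.trans ?_) ?_⟩
  · rw [← ht]; exact_mod_cast ha
  · rw [← h0, ← hl]; exact passageTime_le_pathTime w γ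

theorem one_le_hitTime {w : Lattice d → ℕ → Lattice d} {x y : Lattice d} (hw : w x 0 = x)
    (hxy : x ≠ y) : 1 ≤ hitTime w x y := by
  refine le_iInf₂ fun j hj => ?_
  have : j ≠ 0 := by rintro rfl; exact hxy (hw ▸ hj)
  exact_mod_cast Nat.one_le_iff_ne_zero.2 this

/-- Turns a bound on the passage time into a bound on the length of every optimal path. -/
theorem le_pathTime_of_injective {w : Lattice d → ℕ → Lattice d} (hw : ∀ x, w x 0 = x) {k : ℕ}
    {γ : Fin (k + 1) → Lattice d} (hγ : Function.Injective γ) : (k : ℕ∞) ≤ pathTime w γ := by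
  calc (k : ℕ∞) = ∑ _i : Fin k, (1 : ℕ∞) := by simp
    _ ≤ pathTime w γ := Finset.sum_le_sum fun i _ =>
        one_le_hitTime (hw _) fun h => (Fin.castSucc_lt_succ (i := i)).ne (hγ h)

theorem measurableSet_reach (x : Lattice d) (k : ℕ) (y : Lattice d) (s : ℕ) :
    MeasurableSet {w : Lattice d → ℕ → Lattice d | reach w x k y s} := by
  induction k generalizing y s with
  | zero => exact MeasurableSet.const _
  | succ k ih =>
    simp only [reach, Set.ofPred_exists]
    refine MeasurableSet.iUnion fun z => MeasurableSet.iUnion fun s' => MeasurableSet.iUnion fun j => ?_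
    refine (ih z s').inter (MeasurableSet.inter ?_ (MeasurableSet.const _))
    have hm : Measurable fun w : Lattice d → ℕ → Lattice d => w z j :=
      (measurable_pi_apply j).comp (measurable_pi_apply z)
    exact hm (measurableSet_singleton y)

theorem measurableSet_passageTime_le (x y : Lattice d) (s : ℕ) :
    MeasurableSet {w : Lattice d → ℕ → Lattice d | passageTime w x y ≤ s} := by
  simp only [passageTime_le_iff, Set.ofPred_exists]
  exact MeasurableSet.iUnion fun k => MeasurableSet.iUnion fun s' =>
    (MeasurableSet.const _).inter (measurableSet_reach x k y s')

/-! ### The heat kernel of simple random walk -/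

/-- The transition operator of simple random walk. -/
noncomputable def avg (f : Lattice d → ℝ) (x : Lattice d) : ℝ :=
  (∑ i, (f (x + Pi.single i 1) + f (x - Pi.single i 1))) / (2 * d)

theorem avg_mono {f g : Lattice d → ℝ} (x : Lattice d) (h : ∀ y, f y ≤ g y) :
    avg f x ≤ avg g x := by
  unfold avg
  gcongr <;> exact h _

theorem avg_nonneg {f : Lattice d → ℝ} (h : ∀ y, 0 ≤ f y) (x : Lattice d) : 0 ≤ avg f x := by
  unfold avg
  exact div_nonneg (Finset.sum_nonneg fun i _ => add_nonneg (h _) (h _)) (by positivity)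

theorem avg_sum {ι : Type*} (s : Finset ι) (f : ι → Lattice d → ℝ) (x : Lattice d) :
    avg (fun y => ∑ j ∈ s, f j y) x = ∑ j ∈ s, avg (f j) x := by
  unfold avg
  rw [← Finset.sum_div, Finset.sum_comm]
  simp only [Finset.sum_add_distrib]

theorem avg_const (hd : d ≠ 0) (c : ℝ) (x : Lattice d) : avg (fun _ => c) x = c := by
  have : (d : ℝ) ≠ 0 := by exact_mod_cast hd
  unfold avg
  simp only [Finset.sum_const, Finset.card_univ, Fintype.card_fin, nsmul_eq_mul]
  field_simp
  ring

theorem avg_add_right (f : Lattice d → ℝ) (x v : Lattice d) :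
    avg (fun y => f (y + v)) x = avg f (x + v) := by
  unfold avg
  simp only [add_right_comm x _ v, sub_add_eq_add_sub]

/-- The heat kernel: `heat n x` is the probability that simple random walk goes from `0` to `x`
in `n` steps. -/
noncomputable def heat : ℕ → Lattice d → ℝ
  | 0 => fun x => if x = 0 then 1 else 0
  | n + 1 => avg (heat n)

theorem heat_succ (n : ℕ) (x : Lattice d) : heat (n + 1) x = avg (heat n) x := rfl

theorem heat_nonneg (n : ℕ) (x : Lattice d) : 0 ≤ heat n x := by
  induction n generalizing x with
  | zero => unfold heat; split_ifs <;> norm_num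
  | succ n ih => exact avg_nonneg ih x

theorem heat_neg (n : ℕ) (x : Lattice d) : heat n (-x) = heat n x := by
  induction n generalizing x with
  | zero => simp [heat]
  | succ n ih =>
    simp only [heat, avg]
    congr 1
    refine Finset.sum_congr rfl fun i _ => ?_
    rw [← ih (x + _), ← ih (x - _), add_comm]
    congr 2 <;> abel

/-- The finite range makes every sum against `heat n` finite, so summability is never an issue. -/
theorem heat_eq_zero {n : ℕ} {x : Lattice d} (h : n < norm1 x) : heat n x = 0 := by
  induction n generalizing x with
  | zero =>
    have : x ≠ 0 := fun h0 => by simp [h0, norm1_zero] at h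
    simp [heat, this]
  | succ n ih =>
    have h1 : ∀ i : Fin d, norm1 (Pi.single i 1 : Lattice d) = 1 := fun i => by
      simp [norm1_single]
    have h2 : ∀ i : Fin d, heat n (x + Pi.single i 1) = 0 := fun i => ih (by
      have := norm1_add_le (x + Pi.single i 1) (-Pi.single i 1)
      rw [norm1_neg, h1, add_neg_cancel_right] at this
      omega)
    have h3 : ∀ i : Fin d, heat n (x - Pi.single i 1) = 0 := fun i => ih (by
      have := norm1_add_le (x - Pi.single i 1) (Pi.single i 1)
      rw [h1, sub_add_cancel] at this
      omega)
    simp [heat, avg, h2, h3]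

theorem summable_heat_mul (n : ℕ) (f : Lattice d → ℝ) : Summable fun y => heat n y * f y := by
  refine summable_of_ne_finset_zero (s := ball 0 n) fun y hy => ?_
  rw [mem_ball, sub_zero, not_le] at hy
  rw [heat_eq_zero hy, zero_mul]

theorem tsum_heat_mul_eq_sum {n m : ℕ} (h : n ≤ m) (f : Lattice d → ℝ) :
    ∑' y, heat n y * f y = ∑ y ∈ ball (0 : Lattice d) m, heat n y * f y := by
  refine tsum_eq_sum fun y hy => ?_
  rw [mem_ball, sub_zero, not_le] at hy
  rw [heat_eq_zero (h.trans_lt hy), zero_mul]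

theorem tsum_heat_avg (n : ℕ) (f : Lattice d → ℝ) (g : Lattice d → Lattice d) :
    ∑' y, heat n y * avg f (g y) = avg (fun z => ∑' y, heat n y * f (g y + z)) 0 := by
  have h : ∀ y, heat n y * avg f (g y) = (∑ i, (heat n y * f (g y + (0 + Pi.single i 1))
      + heat n y * f (g y + (0 - Pi.single i 1)))) / (2 * d) := fun y => by
    rw [avg, ← mul_div_assoc, Finset.mul_sum]
    simp only [mul_add, sub_eq_add_neg, zero_add]
  simp only [h]
  rw [tsum_div_const,
    Summable.tsum_finsetSum fun i _ => (summable_heat_mul n _).add (summable_heat_mul n _)]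
  unfold avg
  congr 1
  exact Finset.sum_congr rfl fun i _ => (summable_heat_mul n _).tsum_add (summable_heat_mul n _)

/-- The Chapman-Kolmogorov equation. -/
theorem heat_add (n m : ℕ) (x : Lattice d) :
    heat (n + m) x = ∑' y, heat n y * heat m (x - y) := by
  induction m generalizing x with
  | zero =>
    rw [tsum_eq_single x]
    · simp [heat]
    · intro y hy
      simp [heat, sub_ne_zero.2 hy.symm]
  | succ m ih =>
    rw [← add_assoc, heat_succ]
    simp only [heat_succ m]
    rw [tsum_heat_avg n (heat m) (fun y => x - y)]
    have h := avg_add_right (heat (n + m)) 0 x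
    rw [zero_add] at h
    rw [← h]
    congr 1
    funext z
    rw [ih]
    refine tsum_congr fun y => ?_
    congr 2; abel

/-- The one step recursion for expectations. -/
theorem tsum_heat_succ (n : ℕ) (f : Lattice d → ℝ) :
    ∑' y, heat (n + 1) y * f y = ∑' y, heat n y * avg f y := by
  have hsh : ∀ v : Lattice d, Summable fun y => heat n (y + v) * f y := fun v => by
    have := (Equiv.addRight v).summable_iff.2 (summable_heat_mul n fun y => f (y - v))
    refine this.congr fun y => ?_
    simp
  have hts : ∀ v : Lattice d, ∑' y, heat n (y + v) * f y = ∑' y, heat n y * f (y - v) := fun v => by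
    rw [← (Equiv.addRight v).tsum_eq fun y => heat n y * f (y - v)]
    refine tsum_congr fun y => ?_
    simp
  have hL : ∀ y : Lattice d, heat (n + 1) y * f y
      = (∑ i, (heat n (y + Pi.single i 1) * f y + heat n (y + -Pi.single i 1) * f y)) / (2 * d) := by
    intro y
    rw [heat_succ, avg, div_mul_eq_mul_div, Finset.sum_mul]
    simp only [add_mul, sub_eq_add_neg]
  have hR : ∀ y : Lattice d, heat n y * avg f y
      = (∑ i, (heat n y * f (y - Pi.single i 1) + heat n y * f (y - -Pi.single i 1))) / (2 * d) := by
    intro y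
    rw [avg, ← mul_div_assoc, Finset.mul_sum]
    congr 1
    refine Finset.sum_congr rfl fun i _ => ?_
    rw [sub_neg_eq_add]; ring
  simp only [hL, hR, tsum_div_const]
  rw [Summable.tsum_finsetSum fun i _ => (hsh _).add (hsh _),
    Summable.tsum_finsetSum fun i _ => (summable_heat_mul n _).add (summable_heat_mul n _)]
  congr 1
  refine Finset.sum_congr rfl fun i _ => ?_
  rw [(hsh _).tsum_add (hsh _), (summable_heat_mul n _).tsum_add (summable_heat_mul n _), hts, hts]

theorem tsum_heat (hd : d ≠ 0) (n : ℕ) : ∑' y : Lattice d, heat n y = 1 := by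
  have h : ∀ n, ∑' y : Lattice d, heat n y * (1 : ℝ) = 1 := by
    intro n
    induction n with
    | zero =>
      rw [tsum_eq_single 0]
      · simp [heat]
      · intro y hy; simp [heat, hy]
    | succ n ih =>
      rw [tsum_heat_succ]
      simpa only [avg_const hd] using ih
  simpa using h n

/-- The square of the Euclidean norm. -/
def normSq (y : Lattice d) : ℝ := ∑ i, (y i : ℝ) ^ 2

theorem avg_coord (hd : d ≠ 0) (j : Fin d) (φ : ℤ → ℝ) (x : Lattice d) :
    avg (fun y => φ (y j)) x
      = φ (x j) + (φ (x j + 1) + φ (x j - 1) - 2 * φ (x j)) / (2 * d) := by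
  have hd' : (d : ℝ) ≠ 0 := by exact_mod_cast hd
  unfold avg
  have : ∀ i : Fin d, φ ((x + Pi.single i 1 : Lattice d) j) + φ ((x - Pi.single i 1 : Lattice d) j)
      = 2 * φ (x j) + if i = j then (φ (x j + 1) + φ (x j - 1) - 2 * φ (x j)) else 0 := by
    intro i
    by_cases h : i = j
    · subst h; simp
    · simp [h]; ring
  simp only [this, Finset.sum_add_distrib, Finset.sum_ite_eq', Finset.mem_univ, if_true,
    Finset.sum_const, Finset.card_univ, Fintype.card_fin, nsmul_eq_mul]
  field_simp

/-- The squared norm minus time is a martingale; hence the second moment at time `n` is `n`. -/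
theorem avg_normSq (hd : d ≠ 0) (x : Lattice d) : avg normSq x = normSq x + 1 := by
  have hd' : (d : ℝ) ≠ 0 := by exact_mod_cast hd
  have h : (normSq : Lattice d → ℝ) = fun y => ∑ j ∈ Finset.univ, (y j : ℝ) ^ 2 := rfl
  rw [h, avg_sum]
  have : ∀ j : Fin d, avg (fun y : Lattice d => (y j : ℝ) ^ 2) x = (x j : ℝ) ^ 2 + 1 / d := by
    intro j
    rw [avg_coord hd j (fun t => (t : ℝ) ^ 2)]
    push_cast
    field_simp
    ring
  simp only [this, Finset.sum_add_distrib, Finset.sum_const, Finset.card_univ, Fintype.card_fin,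
    nsmul_eq_mul]
  field_simp

theorem tsum_heat_normSq (hd : d ≠ 0) (n : ℕ) :
    ∑' y : Lattice d, heat n y * normSq y = n := by
  induction n with
  | zero =>
    rw [tsum_eq_single 0]
    · simp [heat, normSq]
    · intro y hy; simp [heat, hy]
  | succ n ih =>
    rw [tsum_heat_succ]
    simp only [avg_normSq hd, mul_add, mul_one]
    have hs : Summable fun y : Lattice d => heat n y := by
      simpa using summable_heat_mul n fun _ : Lattice d => (1 : ℝ)
    rw [(summable_heat_mul n _).tsum_add hs, ih, tsum_heat hd]
    push_cast; ring

/-! ### Heat kernel bounds on and near the diagonal -/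

theorem heat_two_mul_zero (n : ℕ) : heat (2 * n) (0 : Lattice d) = ∑' y : Lattice d, heat n y ^ 2 := by
  rw [two_mul, heat_add]
  refine tsum_congr fun y => ?_
  rw [zero_sub, heat_neg, sq]

theorem natAbs_le_sqrt_of_normSq_le {y : Lattice d} {m : ℕ} (h : normSq y ≤ m) (i : Fin d) :
    (y i).natAbs ≤ Nat.sqrt m := by
  rw [Nat.le_sqrt']
  have h1 : (y i : ℝ) ^ 2 ≤ normSq y :=
    Finset.single_le_sum (f := fun i => (y i : ℝ) ^ 2) (fun _ _ => sq_nonneg _) (Finset.mem_univ i)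
  have h2 : (((y i).natAbs ^ 2 : ℕ) : ℝ) = (y i : ℝ) ^ 2 := by
    rw [Nat.cast_pow, Nat.cast_natAbs, Int.cast_abs, sq_abs]
  exact_mod_cast h2.le.trans (h1.trans h)

/-- On-diagonal lower bound. -/
theorem heat_two_mul_zero_ge (hd : d ≠ 0) {n : ℕ} (hn : 1 ≤ n) :
    1 / (4 * (2 * Nat.sqrt (2 * n) + 1 : ℝ) ^ d) ≤ heat (2 * n) (0 : Lattice d) := by
  classical
  set s := Nat.sqrt (2 * n)
  set B : Finset (Lattice d) := Fintype.piFinset fun _ => Finset.Icc (-(s : ℤ)) s with hB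
  have hcard : (B.card : ℝ) = (2 * s + 1 : ℝ) ^ d := by
    rw [hB, Fintype.card_piFinset]
    simp only [Int.card_Icc, Finset.prod_const, Finset.card_univ, Fintype.card_fin]
    have : ((s : ℤ) + 1 - -(s : ℤ)).toNat = 2 * s + 1 := by omega
    rw [this]; push_cast; rfl
  have hs1 : Summable fun y : Lattice d => heat n y := by
    simpa using summable_heat_mul n fun _ : Lattice d => (1 : ℝ)
  have hmem : ∀ y : Lattice d, y ∉ B → (2 * n : ℝ) ≤ normSq y := by
    intro y hy
    by_contra hlt
    push Not at hlt
    refine hy ?_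
    rw [hB, Fintype.mem_piFinset]
    intro i
    have := natAbs_le_sqrt_of_normSq_le (y := y) (m := 2 * n) (by push_cast; exact hlt.le) i
    rw [Finset.mem_Icc]
    omega
  -- Chebyshev: the squared norm has mean `n` and is at least `2n` outside the box.
  have hmass : 1 / 2 ≤ ∑ y ∈ B, heat n y := by
    have h1 : ∑' y : Lattice d, heat n y * (1 - normSq y / (2 * n)) = 1 / 2 := by
      have : ∀ y : Lattice d, heat n y * (1 - normSq y / (2 * n))
          = heat n y - heat n y * normSq y / (2 * n) := fun y => by ring
      simp only [this]
      rw [hs1.tsum_sub ((summable_heat_mul n _).div_const _), tsum_div_const, tsum_heat hd,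
        tsum_heat_normSq hd]
      have : (n : ℝ) ≠ 0 := by positivity
      field_simp
      norm_num
    rw [← h1]
    have h2 : ∑ y ∈ B, heat n y = ∑' y, heat n y * (if y ∈ B then 1 else 0) := by
      rw [tsum_eq_sum (s := B) fun y hy => by simp [hy]]
      exact Finset.sum_congr rfl fun y hy => by simp [hy]
    rw [h2]
    refine (summable_heat_mul n _).tsum_le_tsum (fun y => ?_) (summable_heat_mul n _)
    refine mul_le_mul_of_nonneg_left ?_ (heat_nonneg n y)
    have hn' : (0 : ℝ) < 2 * n := by positivity
    split_ifs with hy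
    · have : 0 ≤ normSq y / (2 * n) := div_nonneg (Finset.sum_nonneg fun _ _ => sq_nonneg _) hn'.le
      linarith
    · have := (one_le_div hn').2 (hmem y hy)
      linarith
  -- Mass one half on the box forces a large sum of squares, and the sum of all squares is the
  -- return probability.
  have hCS := sq_sum_le_card_mul_sum_sq (s := B) (f := heat n)
  have hsq : ∑ y ∈ B, heat n y ^ 2 ≤ heat (2 * n) (0 : Lattice d) := by
    rw [heat_two_mul_zero]
    refine Summable.sum_le_tsum B (fun _ _ => sq_nonneg _) ?_
    simpa [sq] using summable_heat_mul n (heat n)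
  have hpos : (0 : ℝ) < (2 * s + 1 : ℝ) ^ d := by positivity
  rw [div_le_iff₀ (by positivity)]
  rw [hcard] at hCS
  have h4 : (1 / 4 : ℝ) ≤ (∑ y ∈ B, heat n y) ^ 2 := by nlinarith
  nlinarith [mul_le_mul_of_nonneg_left hsq hpos.le]

theorem heat_two_mul_zero_pos (hd : d ≠ 0) (n : ℕ) : 0 < heat (2 * n) (0 : Lattice d) := by
  rcases Nat.eq_zero_or_pos n with rfl | hn
  · simp [heat]
  · exact lt_of_lt_of_le (by positivity) (heat_two_mul_zero_ge hd hn)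

/-- By symmetry the three return probabilities are the inner products of `heat n` and `heat (n +
2)`, so this is Cauchy-Schwarz. -/
theorem heat_logConvex (n : ℕ) :
    heat (2 * (n + 1)) (0 : Lattice d) ^ 2
      ≤ heat (2 * n) (0 : Lattice d) * heat (2 * (n + 2)) (0 : Lattice d) := by
  have h1 : heat (2 * (n + 1)) (0 : Lattice d)
      = ∑ y ∈ ball (0 : Lattice d) (n + 2), heat n y * heat (n + 2) y := by
    rw [show 2 * (n + 1) = n + (n + 2) by ring, heat_add, ← tsum_heat_mul_eq_sum (by omega)]
    exact tsum_congr fun y => by rw [zero_sub, heat_neg]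
  have h2 : ∀ m ≤ n + 2, heat (2 * m) (0 : Lattice d)
      = ∑ y ∈ ball (0 : Lattice d) (n + 2), heat m y ^ 2 := fun m hm => by
    rw [heat_two_mul_zero]
    simp only [sq]
    rw [tsum_heat_mul_eq_sum hm]
  rw [h1, h2 n (by omega), h2 (n + 2) le_rfl]
  exact Finset.sum_mul_sq_le_sq_mul_sq _ _ _

theorem heat_ratio_mono (hd : d ≠ 0) {i n : ℕ} (h : i ≤ n) :
    heat (2 * (i + 1)) (0 : Lattice d) * heat (2 * n) (0 : Lattice d)
      ≤ heat (2 * (n + 1)) (0 : Lattice d) * heat (2 * i) (0 : Lattice d) := by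
  induction n, h using Nat.le_induction with
  | base => rfl
  | succ n hn ih =>
    have hp := heat_two_mul_zero_pos hd n
    have hp1 := heat_two_mul_zero_pos hd (n + 1)
    have hpi := heat_two_mul_zero_pos hd i
    have hlc := heat_logConvex (d := d) n
    refine le_of_mul_le_mul_right ?_ hp
    calc _ = heat (2 * (i + 1)) (0 : Lattice d) * heat (2 * n) (0 : Lattice d)
          * heat (2 * (n + 1)) (0 : Lattice d) := by ring
      _ ≤ heat (2 * (n + 1)) (0 : Lattice d) * heat (2 * i) (0 : Lattice d)
          * heat (2 * (n + 1)) (0 : Lattice d) := by gcongr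
      _ = heat (2 * (n + 1)) (0 : Lattice d) ^ 2 * heat (2 * i) (0 : Lattice d) := by ring
      _ ≤ heat (2 * n) (0 : Lattice d) * heat (2 * (n + 2)) (0 : Lattice d)
          * heat (2 * i) (0 : Lattice d) := by gcongr
      _ = _ := by ring

theorem heat_le_ratio_pow (hd : d ≠ 0) {i n : ℕ} (h : i ≤ n) :
    heat (2 * i) (0 : Lattice d)
      ≤ (heat (2 * (n + 1)) (0 : Lattice d) / heat (2 * n) (0 : Lattice d)) ^ i := by
  have hp := heat_two_mul_zero_pos hd n
  have hp1 := heat_two_mul_zero_pos hd (n + 1)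
  induction i with
  | zero => simp [heat]
  | succ i ih =>
    have h1 := heat_ratio_mono hd (show i ≤ n by omega)
    rw [pow_succ]
    calc heat (2 * (i + 1)) (0 : Lattice d)
        ≤ heat (2 * i) (0 : Lattice d)
          * (heat (2 * (n + 1)) (0 : Lattice d) / heat (2 * n) (0 : Lattice d)) := by
          rw [mul_div_assoc', le_div_iff₀ hp]; linarith
      _ ≤ _ := by gcongr; exact ih (by omega)

/-- By log-convexity the ratios of successive even return probabilities increase, so the `n`-th
power of the ratio at `n` dominates `heat (2 * n) 0`. A relative drop larger than `L / n` would push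
that power below `exp (-L)`. -/
theorem heat_sub_succ_le (hd : d ≠ 0) {n : ℕ} (hn : 1 ≤ n) {L : ℝ} 
    (hL : Real.exp (-L) < heat (2 * n) (0 : Lattice d)) :
    heat (2 * n) (0 : Lattice d) - heat (2 * (n + 1)) (0 : Lattice d)
      ≤ heat (2 * n) (0 : Lattice d) * (L / n) := by
  have hp := heat_two_mul_zero_pos hd n
  have hp1 := heat_two_mul_zero_pos hd (n + 1)
  by_contra hlt
  push Not at hlt
  have hr : heat (2 * (n + 1)) (0 : Lattice d) / heat (2 * n) (0 : Lattice d)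
      ≤ Real.exp (-(L / n)) := by
    rw [div_le_iff₀ hp]
    have := Real.add_one_le_exp (-(L / n))
    nlinarith
  have h1 := (heat_le_ratio_pow hd (le_refl n)).trans (pow_le_pow_left₀ (by positivity) hr n)
  rw [← Real.exp_nat_mul] at h1
  have hn0 : (n : ℝ) ≠ 0 := by positivity
  have : (n : ℝ) * -(L / n) = -L := by field_simp
  rw [this] at h1
  linarith

theorem tsum_sq_sub_heat (n : ℕ) (x : Lattice d) :
    ∑' y : Lattice d, (heat n y - heat n (y - x)) ^ 2
      = 2 * (heat (2 * n) (0 : Lattice d) - heat (2 * n) x) := by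
  have h1 : Summable fun y : Lattice d => heat n y ^ 2 := by
    simpa [sq] using summable_heat_mul n (heat n)
  have h2 : Summable fun y : Lattice d => heat n (y - x) ^ 2 :=
    ((Equiv.subRight x).summable_iff (f := fun y => heat n y ^ 2)).2 h1
  have h3 := summable_heat_mul n fun y : Lattice d => heat n (y - x)
  have h4 : ∑' y : Lattice d, heat n (y - x) ^ 2 = ∑' y : Lattice d, heat n y ^ 2 :=
    (Equiv.subRight x).tsum_eq fun y => heat n y ^ 2
  have h5 : ∑' y : Lattice d, heat n y * heat n (y - x) = heat (2 * n) x := by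
    rw [two_mul, heat_add]
    exact tsum_congr fun y => by rw [← heat_neg n (y - x), neg_sub]
  have h6 : ∀ y : Lattice d, (heat n y - heat n (y - x)) ^ 2
      = heat n y ^ 2 + heat n (y - x) ^ 2 - 2 * (heat n y * heat n (y - x)) := fun y => by ring
  simp only [h6]
  rw [(h1.add h2).tsum_sub (h3.mul_left 2), h1.tsum_add h2, tsum_mul_left, h4, h5,
    ← heat_two_mul_zero]
  ring

theorem summable_sq_sub_heat (n : ℕ) (u v : Lattice d) :
    Summable fun y : Lattice d => (heat n (y - u) - heat n (y - v)) ^ 2 := by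
  have h1 : Summable fun y : Lattice d => heat n y ^ 2 := by
    simpa [sq] using summable_heat_mul n (heat n)
  have h2 : ∀ x, Summable fun y : Lattice d => heat n (y - x) ^ 2 := fun x =>
    ((Equiv.subRight x).summable_iff (f := fun y => heat n y ^ 2)).2 h1
  refine Summable.of_nonneg_of_le (fun _ => sq_nonneg _) (fun y => ?_)
    (((h2 u).add (h2 v)).mul_left 2)
  nlinarith [sq_nonneg (heat n (y - u) + heat n (y - v))]

theorem heat_le_zero (n : ℕ) (x : Lattice d) : heat (2 * n) x ≤ heat (2 * n) (0 : Lattice d) := by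
  have := tsum_sq_sub_heat n x
  have h : 0 ≤ ∑' y : Lattice d, (heat n y - heat n (y - x)) ^ 2 :=
    tsum_nonneg fun y => sq_nonneg _
  linarith

theorem le_sum_unit {f : Lattice d → ℝ} (hf : ∀ x, 0 ≤ f x) {u : Lattice d} (hu : norm1 u = 1)
    (z : Lattice d) : f (z + u) ≤ ∑ i, (f (z + Pi.single i 1) + f (z - Pi.single i 1)) := by
  obtain ⟨i, hi⟩ := exists_of_norm1_eq_one hu
  have h1 : f (z + Pi.single i 1) + f (z - Pi.single i 1)
      ≤ ∑ i, (f (z + Pi.single i 1) + f (z - Pi.single i 1)) :=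
    Finset.single_le_sum (f := fun i => f (z + Pi.single i 1) + f (z - Pi.single i 1))
      (fun _ _ => add_nonneg (hf _) (hf _)) (Finset.mem_univ i)
  have h2 := hf (z - Pi.single i 1)
  have h3 := hf (z + Pi.single i 1)
  rcases hi with hi | hi
  · rw [hi]; linarith
  · rw [hi, ← sub_eq_add_neg]; linarith

theorem le_avg_unit (hd : d ≠ 0) {f : Lattice d → ℝ} (hf : ∀ x, 0 ≤ f x) {u : Lattice d}
    (hu : norm1 u = 1) (z : Lattice d) : f (z + u) ≤ 2 * d * avg f z := by
  have hd' : (d : ℝ) ≠ 0 := by exact_mod_cast hd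
  rw [avg, mul_div_cancel₀ _ (by positivity)]
  exact le_sum_unit hf hu z

/-- The function `f = heat (2 * n) 0 - heat (2 * n)` is nonnegative, and its two-step average at the
origin is exactly the drop in return probability. The point `u + v` has weight at least `(2d)⁻²` in
that average. -/
theorem heat_sub_two_steps_le (hd : d ≠ 0) (n : ℕ) {u v : Lattice d} (hu : norm1 u = 1)
    (hv : norm1 v = 1) :
    heat (2 * n) (0 : Lattice d) - heat (2 * n) (u + v)
      ≤ (2 * d) ^ 2 * (heat (2 * n) (0 : Lattice d) - heat (2 * (n + 1)) (0 : Lattice d)) := by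
  set f : Lattice d → ℝ := fun x => heat (2 * n) 0 - heat (2 * n) x with hf
  have hf0 : ∀ x, 0 ≤ f x := fun x => sub_nonneg.2 (heat_le_zero n x)
  have hav : ∀ g : Lattice d → ℝ, ∀ c x, avg (fun y => c - g y) x = c - avg g x := by
    intro g c x
    have hd' : (d : ℝ) ≠ 0 := by exact_mod_cast hd
    unfold avg
    have : ∀ i : Fin d, c - g (x + Pi.single i 1) + (c - g (x - Pi.single i 1))
      = 2 * c - (g (x + Pi.single i 1) + g (x - Pi.single i 1)) := fun i => by ring
    simp only [this, Finset.sum_sub_distrib, Finset.sum_const, Finset.card_univ, Fintype.card_fin,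
      nsmul_eq_mul]
    field_simp
  have h1 : f (u + v) ≤ 2 * d * avg f u := le_avg_unit hd hf0 hv u
  have h2 : avg f u ≤ 2 * d * avg (avg f) 0 := by
    simpa using le_avg_unit hd (avg_nonneg hf0) hu 0
  have h3 : avg (avg f) 0
      = heat (2 * n) (0 : Lattice d) - heat (2 * (n + 1)) (0 : Lattice d) := by
    have : avg f = fun x => heat (2 * n) (0 : Lattice d) - heat (2 * n + 1) x := by
      funext x; rw [hf, hav]; rfl
    rw [this, hav]; rfl
  rw [h3] at h2
  calc f (u + v) ≤ 2 * d * avg f u := h1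
    _ ≤ 2 * d * (2 * d * (heat (2 * n) (0 : Lattice d) - heat (2 * (n + 1)) (0 : Lattice d))) := by
      gcongr
    _ = _ := by ring

/-- The left side is half the squared `ℓ²`-distance between `heat n` and its translate by `x`. It is
telescoped along a geodesic in `s` double steps, which respect parity; Cauchy-Schwarz and summation
produce the factor `s ^ 2`. -/
theorem heat_sub_le (hd : d ≠ 0) (n : ℕ) {x : Lattice d} {s : ℕ} (hx : norm1 x = 2 * s) :
    heat (2 * n) (0 : Lattice d) - heat (2 * n) x
      ≤ (2 * d * s) ^ 2 * (heat (2 * n) (0 : Lattice d) - heat (2 * (n + 1)) (0 : Lattice d)) := by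
  obtain ⟨p, h0, hl, hs⟩ := exists_unit_path x hx
  set δ := heat (2 * n) (0 : Lattice d) - heat (2 * (n + 1)) (0 : Lattice d) with hδ
  have hstep : ∀ i ∈ Finset.range s,
      ∑' y : Lattice d, (heat n (y - p (2 * i)) - heat n (y - p (2 * (i + 1)))) ^ 2
        ≤ 2 * ((2 * d) ^ 2 * δ) := by
    intro i hi
    rw [Finset.mem_range] at hi
    rw [← (Equiv.addRight (p (2 * i))).tsum_eq fun y =>
      (heat n (y - p (2 * i)) - heat n (y - p (2 * (i + 1)))) ^ 2]
    have hrw : ∀ y : Lattice d, (Equiv.addRight (p (2 * i)) y - p (2 * (i + 1)))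
        = y - ((p (2 * i + 1) - p (2 * i)) + (p (2 * i + 1 + 1) - p (2 * i + 1))) := fun y => by
      rw [show 2 * (i + 1) = 2 * i + 1 + 1 by ring]
      simp only [Equiv.coe_addRight]
      abel
    have hrw' : ∀ y : Lattice d, (Equiv.addRight (p (2 * i)) y - p (2 * i)) = y := fun y => by simp
    simp only [hrw, hrw']
    rw [tsum_sq_sub_heat]
    have := heat_sub_two_steps_le hd n (hs (2 * i) (by omega)) (hs (2 * i + 1) (by omega))
    linarith
  have htel : ∀ y : Lattice d, (heat n y - heat n (y - x)) ^ 2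
      ≤ s * ∑ i ∈ Finset.range s, (heat n (y - p (2 * i)) - heat n (y - p (2 * (i + 1)))) ^ 2 := by
    intro y
    have h := sq_sum_le_card_mul_sum_sq (s := Finset.range s)
      (f := fun i => heat n (y - p (2 * i)) - heat n (y - p (2 * (i + 1))))
    rw [Finset.sum_range_sub' (fun i => heat n (y - p (2 * i))), Finset.card_range] at h
    simpa [h0, hl] using h
  have hsum := Summable.tsum_le_tsum htel
    (by simpa using summable_sq_sub_heat n (0 : Lattice d) x)
    ((summable_sum fun i _ => summable_sq_sub_heat n (p (2 * i)) (p (2 * (i + 1)))).mul_left _)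
  rw [tsum_sq_sub_heat, tsum_mul_left,
    Summable.tsum_finsetSum fun i _ => summable_sq_sub_heat n _ _] at hsum
  have hle := Finset.sum_le_sum hstep
  rw [Finset.sum_const, Finset.card_range, nsmul_eq_mul] at hle
  have := mul_le_mul_of_nonneg_left hle (Nat.cast_nonneg (α := ℝ) s)
  nlinarith

/-- Near-diagonal lower bound, up to a factor `L` which only has to beat a logarithm. -/
theorem half_heat_zero_le (hd : d ≠ 0) {n : ℕ} (hn : 1 ≤ n) {L : ℝ} 
    (hL : Real.exp (-L) < heat (2 * n) (0 : Lattice d)) {x : Lattice d} (hx : Even (norm1 x))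
    (hxn : (d * norm1 x : ℝ) ^ 2 * L ≤ n / 2) :
    heat (2 * n) (0 : Lattice d) / 2 ≤ heat (2 * n) x := by
  obtain ⟨s, hs⟩ := hx
  have h1 := heat_sub_le hd n (show norm1 x = 2 * s by omega)
  have h2 := heat_sub_succ_le hd hn hL
  have hn' : (0 : ℝ) < n := by positivity
  have hp := heat_two_mul_zero_pos hd n
  have hc : (norm1 x : ℝ) = 2 * s := by rw [hs]; push_cast; ring
  rw [hc] at hxn
  have h3 : (2 * d * s : ℝ) ^ 2 * (L / n) ≤ 1 / 2 := by
    rw [mul_div_assoc', div_le_iff₀ hn']; nlinarith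
  have h4 := mul_le_mul_of_nonneg_left h2 (sq_nonneg (2 * d * s : ℝ))
  have h5 := mul_le_mul_of_nonneg_left h3 hp.le
  nlinarith

/-- The expected number of returns, by the discrete Tanaka formula for one coordinate. -/
theorem sum_heat_zero_le (hd : d ≠ 0) (n : ℕ) :
    ∑ j ∈ Finset.range n, heat j (0 : Lattice d) ≤ d * Real.sqrt n := by
  have hd' : (0 : ℝ) < d := by positivity
  obtain ⟨i⟩ : Nonempty (Fin d) := ⟨⟨0, Nat.pos_of_ne_zero hd⟩⟩
  -- One step raises the mean of `|y i|` by `1 / d` on the hyperplane `y i = 0`, in particular at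
  -- the origin.
  have hA : ∀ n, (∑ j ∈ Finset.range n, heat j (0 : Lattice d)) / d
      ≤ ∑' y : Lattice d, heat n y * |(y i : ℝ)| := by
    intro n
    induction n with
    | zero =>
      simp only [Finset.range_zero, Finset.sum_empty, zero_div]
      exact tsum_nonneg fun y => mul_nonneg (heat_nonneg _ _) (abs_nonneg _)
    | succ n ih =>
      rw [tsum_heat_succ, Finset.sum_range_succ, add_div]
      have h1 : ∀ y : Lattice d, heat n y * |(y i : ℝ)| + heat n y * ((if y = 0 then 1 else 0) / d)
          ≤ heat n y * avg (fun y : Lattice d => |(y i : ℝ)|) y := by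
        intro y
        rw [← mul_add]
        refine mul_le_mul_of_nonneg_left ?_ (heat_nonneg n y)
        rw [avg_coord hd i (fun t => |(t : ℝ)|)]
        refine add_le_add le_rfl ?_
        rw [div_le_div_iff₀ hd' (by positivity)]
        push_cast
        split_ifs with hy
        · simp [hy]
          linarith
        · have := abs_add_le ((y i : ℝ) + 1) ((y i : ℝ) - 1)
          rw [show (y i : ℝ) + 1 + (y i - 1) = 2 * y i by ring, abs_mul, abs_two] at this
          nlinarith
      have h2 : ∑' y : Lattice d, heat n y * ((if y = 0 then 1 else 0) / d)
          = heat n (0 : Lattice d) / d := by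
        rw [tsum_eq_single 0]
        · simp [div_eq_mul_inv]
        · intro y hy; simp [hy]
      calc _ ≤ ∑' y : Lattice d, heat n y * |(y i : ℝ)| + heat n (0 : Lattice d) / d :=
            add_le_add ih le_rfl
        _ = ∑' y : Lattice d, (heat n y * |(y i : ℝ)| + heat n y * ((if y = 0 then 1 else 0) / d)) := by
          rw [(summable_heat_mul n _).tsum_add (summable_heat_mul n _), h2]
        _ ≤ _ := Summable.tsum_le_tsum h1 ((summable_heat_mul n _).add (summable_heat_mul n _))
          (summable_heat_mul n _)
  -- The arithmetic-geometric mean inequality at scale `r = √n` reduces this to the second moment.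
  have hB : ∑' y : Lattice d, heat n y * |(y i : ℝ)| ≤ Real.sqrt n := by
    rcases Nat.eq_zero_or_pos n with rfl | hn
    · rw [tsum_eq_single 0]
      · simp
      · intro y hy; simp [heat, hy]
    set r := Real.sqrt n with hr
    have hr0 : 0 < r := Real.sqrt_pos.2 (by positivity)
    have hrr : r * r = n := Real.mul_self_sqrt (by positivity)
    have h1 : ∀ y : Lattice d, heat n y * |(y i : ℝ)|
        ≤ heat n y * ((r + normSq y / r) / 2) := by
      intro y
      refine mul_le_mul_of_nonneg_left ?_ (heat_nonneg n y)
      have h2 : (y i : ℝ) ^ 2 ≤ normSq y :=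
        Finset.single_le_sum (f := fun i => (y i : ℝ) ^ 2) (fun _ _ => sq_nonneg _)
          (Finset.mem_univ i)
      have h3 : r + normSq y / r = (r * r + normSq y) / r := by field_simp
      rw [h3, div_div, le_div_iff₀ (by positivity)]
      nlinarith [sq_nonneg (|(y i : ℝ)| - r), sq_abs (y i : ℝ)]
    refine (Summable.tsum_le_tsum h1 (summable_heat_mul n _) (summable_heat_mul n _)).trans ?_
    have h4 : ∀ y : Lattice d, heat n y * ((r + normSq y / r) / 2)
        = heat n y * (r / 2) + heat n y * normSq y / (2 * r) := fun y => by field_simp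
    simp only [h4]
    rw [(summable_heat_mul n _).tsum_add ((summable_heat_mul n _).div_const _), tsum_mul_right,
      tsum_div_const, tsum_heat hd, tsum_heat_normSq hd, ← hrr]
    field_simp
    norm_num
  have := (hA n).trans hB
  rw [div_le_iff₀ hd'] at this
  linarith

/-! ### The Markov property and estimates for a single walk -/

/-- The unit vectors, indexed by coordinate and sign. -/
def unitVec (p : Fin d × Bool) : Lattice d := if p.2 then Pi.single p.1 1 else -Pi.single p.1 1

theorem norm1_unitVec (p : Fin d × Bool) : norm1 (unitVec p) = 1 := by
  unfold unitVec
  split_ifs <;> simp [norm1_neg, norm1_single]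

theorem unitVec_injective : Function.Injective (unitVec : Fin d × Bool → Lattice d) := by
  rintro ⟨i, a⟩ ⟨j, b⟩ h
  have hi := congrFun h i
  by_cases hij : i = j
  · subst hij
    cases a <;> cases b <;> simp [unitVec] at hi ⊢
  · cases a <;> cases b <;> simp [unitVec, hij] at hi

theorem avg_eq_sum_unitVec (f : Lattice d → ℝ) (x : Lattice d) :
    avg f x = ∑ p : Fin d × Bool, f (x + unitVec p) * (2 * d : ℝ)⁻¹ := by
  rw [avg, Fintype.sum_prod_type, div_eq_mul_inv, Finset.sum_mul]
  refine Finset.sum_congr rfl fun i _ => ?_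
  simp [unitVec, sub_eq_add_neg, add_mul]

section Walk

variable {Ω : Type*} [MeasurableSpace Ω] {μ : Measure Ω}
  {x : Lattice d} {X : ℕ → Ω → Lattice d}

theorem IsSimpleRandomWalk.measurable_step (h : IsSimpleRandomWalk μ x X) (n : ℕ) :
    Measurable fun ω => X (n + 1) ω - X n ω := (h.measurable _).sub (h.measurable _)

theorem IsSimpleRandomWalk.measurable_past (h : IsSimpleRandomWalk μ x X) (n : ℕ) :
    Measurable fun ω (i : Fin (n + 1)) => X i ω := measurable_pi_lambda _ fun i => h.measurable i

/-- Since the start is deterministic, the positions up to time `n` are a function of the first `n`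
steps. -/
theorem IsSimpleRandomWalk.indepFun_past (h : IsSimpleRandomWalk μ x X) (n : ℕ) :
    IndepFun (fun ω (i : Fin (n + 1)) => X i ω) (fun ω => X (n + 1) ω - X n ω) μ := by
  have h1 := h.indep_steps.indepFun_finset (Finset.range n) {n} (by simp) h.measurable_step
  have hsum : ∀ (i : ℕ) ω, X i ω = x + ∑ j ∈ Finset.range i, (X (j + 1) ω - X j ω) := fun i ω => by
    rw [Finset.sum_range_sub (fun j => X j ω), h.start]; abel
  have h2 := h1.comp (φ := fun (v : Finset.range n → Lattice d) (i : Fin (n + 1)) =>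
      x + ∑ j : Finset.range n, if (j : ℕ) < i then v j else 0)
    (ψ := fun v : ({n} : Finset ℕ) → Lattice d => v ⟨n, by simp⟩) .of_discrete .of_discrete
  refine h2.congr (Filter.Eventually.of_forall fun ω => ?_) (Filter.Eventually.of_forall fun ω => rfl)
  funext i
  simp only [Function.comp_apply]
  symm
  rw [hsum i ω, Finset.univ_eq_attach,
    Finset.sum_attach (Finset.range n) fun j => if j < (i : ℕ) then X (j + 1) ω - X j ω else 0,
    ← Finset.sum_filter]
  congr 1
  refine Finset.sum_congr ?_ fun _ _ => rfl
  ext j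
  have := i.isLt
  simp only [Finset.mem_range, Finset.mem_filter]
  omega

variable [IsProbabilityMeasure μ]

theorem IsSimpleRandomWalk.ae_step (hd : d ≠ 0) (h : IsSimpleRandomWalk μ x X) (n : ℕ) :
    ∀ᵐ ω ∂μ, ∃ p, X (n + 1) ω - X n ω = unitVec p := by
  have hm : ∀ p : Fin d × Bool, MeasurableSet {ω | X (n + 1) ω - X n ω = unitVec p} := fun p =>
    h.measurable_step n (measurableSet_singleton _)
  have h1 : μ (⋃ p ∈ (Finset.univ : Finset (Fin d × Bool)), {ω | X (n + 1) ω - X n ω = unitVec p})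
      = 1 := by
    rw [measure_biUnion_finset]
    · simp only [h.step_law n _ (norm1_unitVec _), Finset.sum_const, Finset.card_univ,
        Fintype.card_prod, Fintype.card_fin, Fintype.card_bool, nsmul_eq_mul]
      push_cast
      rw [mul_comm (d : ℝ≥0∞) 2]
      refine ENNReal.mul_inv_cancel (by simp [hd]) (ENNReal.mul_ne_top (by simp) (by simp))
    · intro p _ q _ hpq
      refine Set.disjoint_left.2 fun ω h1 h2 => hpq (unitVec_injective (?_ : _ = _))
      exact h1.symm.trans h2
    · exact fun p _ => hm p
  have h2 := (prob_compl_eq_zero_iff (Finset.measurableSet_biUnion _ fun p _ => hm p)).2 h1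
  rw [ae_iff]
  refine measure_mono_null (fun ω hω => ?_) h2
  simpa using hω

theorem integrable_of_bounded {f : Ω → ℝ} (hf : Measurable f) {C : ℝ} (hC : ∀ ω, |f ω| ≤ C) :
    Integrable f μ :=
  Integrable.of_bound hf.aestronglyMeasurable C (Filter.Eventually.of_forall fun ω => hC ω)

/-- The one step Markov property. -/
theorem IsSimpleRandomWalk.markov_step (hd : d ≠ 0) (h : IsSimpleRandomWalk μ x X) (n : ℕ)
    (φ : (Fin (n + 1) → Lattice d) → ℝ) (g : Lattice d → ℝ) {B C : ℝ} (hB : ∀ v, |φ v| ≤ B)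
    (hC : ∀ y, |g y| ≤ C) :
    ∫ ω, φ (fun i => X i ω) * g (X (n + 1) ω) ∂μ = ∫ ω, φ (fun i => X i ω) * avg g (X n ω) ∂μ := by
  have hB0 : 0 ≤ B := (abs_nonneg _).trans (hB 0)
  have hVm := h.measurable_past n
  have hXm := h.measurable n
  have hlaw : ∀ p : Fin d × Bool, ∫ ω, (if X (n + 1) ω - X n ω = unitVec p then 1 else 0) ∂μ
      = (2 * d : ℝ)⁻¹ := by
    intro p
    have hm : MeasurableSet {ω | X (n + 1) ω - X n ω = unitVec p} :=
      h.measurable_step n (measurableSet_singleton _)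
    have : (fun ω => if X (n + 1) ω - X n ω = unitVec p then (1 : ℝ) else 0)
        = Set.indicator {ω | X (n + 1) ω - X n ω = unitVec p} 1 := by
      funext ω; simp [Set.indicator_apply]
    rw [this, integral_indicator_one hm, measureReal_def, h.step_law n _ (norm1_unitVec p)]
    simp
  have hint : ∀ p : Fin d × Bool, Integrable (fun ω => φ (fun i => X i ω) * g (X n ω + unitVec p)
      * (if X (n + 1) ω - X n ω = unitVec p then 1 else 0)) μ := by
    intro p
    refine integrable_of_bounded (C := B * C) ?_ fun ω => ?_
    · refine Measurable.mul (Measurable.mul ((Measurable.of_discrete (f := φ)).comp hVm)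
        ((Measurable.of_discrete (f := fun y => g (y + unitVec p))).comp hXm)) ?_
      exact (Measurable.of_discrete (f := fun e : Lattice d => if e = unitVec p then (1 : ℝ) else 0)).comp
        (h.measurable_step n)
    · have h1 : |φ (fun i => X i ω) * g (X n ω + unitVec p)| ≤ B * C := by
        rw [abs_mul]; exact mul_le_mul (hB _) (hC _) (abs_nonneg _) hB0
      split_ifs
      · simpa using h1
      · simpa using (abs_nonneg _).trans h1
  have hint' : ∀ p : Fin d × Bool, Integrable (fun ω => φ (fun i => X i ω) * g (X n ω + unitVec p)
      * (2 * d : ℝ)⁻¹) μ := by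
    intro p
    refine Integrable.mul_const (integrable_of_bounded (C := B * C) ?_ fun ω => ?_) _
    · exact Measurable.mul ((Measurable.of_discrete (f := φ)).comp hVm)
        ((Measurable.of_discrete (f := fun y => g (y + unitVec p))).comp hXm)
    · rw [abs_mul]; exact mul_le_mul (hB _) (hC _) (abs_nonneg _) hB0
  -- Splitting over the direction of the last step gives terms in which a function of the past
  -- multiplies an indicator of the step, so independence applies.
  have hstep : ∫ ω, φ (fun i => X i ω) * g (X (n + 1) ω) ∂μ
      = ∫ ω, ∑ p, φ (fun i => X i ω) * g (X n ω + unitVec p)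
        * (if X (n + 1) ω - X n ω = unitVec p then 1 else 0) ∂μ := by
    refine integral_congr_ae ?_
    filter_upwards [h.ae_step hd n] with ω ⟨p, hp⟩
    rw [Finset.sum_eq_single p]
    · rw [if_pos hp, mul_one, ← hp, add_sub_cancel]
    · intro q _ hq
      rw [if_neg fun hq' => hq (unitVec_injective (hq'.symm.trans hp)), mul_zero]
    · simp
  rw [hstep, integral_finsetSum _ fun p _ => hint p]
  have hrhs : ∀ ω, φ (fun i => X i ω) * avg g (X n ω)
      = ∑ p, φ (fun i => X i ω) * g (X n ω + unitVec p) * (2 * d : ℝ)⁻¹ := fun ω => by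
    rw [avg_eq_sum_unitVec, Finset.mul_sum]
    simp only [mul_assoc]
  simp only [hrhs]
  rw [integral_finsetSum _ fun p _ => hint' p]
  refine Finset.sum_congr rfl fun p _ => ?_
  have := (h.indepFun_past n).integral_fun_comp_mul_comp
    (f := fun v => φ v * g (v (Fin.last n) + unitVec p))
    (g := fun e => if e = unitVec p then (1 : ℝ) else 0) hVm.aemeasurable
    (h.measurable_step n).aemeasurable Measurable.of_discrete.aestronglyMeasurable
    Measurable.of_discrete.aestronglyMeasurable
  simp only [Fin.val_last] at this
  rw [this, hlaw p, integral_mul_const]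

theorem abs_avg_le (hd : d ≠ 0) {g : Lattice d → ℝ} {C : ℝ} (hC : ∀ y, |g y| ≤ C) (y : Lattice d) :
    |avg g y| ≤ C := by
  rw [abs_le]
  constructor
  · rw [← avg_const hd (-C) y]; exact avg_mono y fun z => (abs_le.1 (hC z)).1
  · rw [← avg_const hd C y]; exact avg_mono y fun z => (abs_le.1 (hC z)).2

theorem IsSimpleRandomWalk.markov (hd : d ≠ 0) (h : IsSimpleRandomWalk μ x X) (n m : ℕ)
    (φ : (Fin (n + 1) → Lattice d) → ℝ) (g : Lattice d → ℝ) {B C : ℝ} (hB : ∀ v, |φ v| ≤ B)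
    (hC : ∀ y, |g y| ≤ C) :
    ∫ ω, φ (fun i => X i ω) * g (X (n + m) ω) ∂μ
      = ∫ ω, φ (fun i => X i ω) * (avg^[m] g) (X n ω) ∂μ := by
  induction m generalizing g with
  | zero => rfl
  | succ m ih =>
    rw [Function.iterate_succ_apply, ← ih (avg g) (abs_avg_le hd hC)]
    have hle : n + 1 ≤ n + m + 1 := by omega
    exact h.markov_step hd (n + m) (fun v => φ fun i => v (Fin.castLE hle i)) g (fun _ => hB _) hC

theorem iterate_avg_indicator (m : ℕ) (z y : Lattice d) :
    (avg^[m] fun u => if u = z then 1 else 0) y = heat m (z - y) := by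
  induction m generalizing y with
  | zero => simp [heat, sub_eq_zero, eq_comm]
  | succ m ih =>
    rw [Function.iterate_succ_apply']
    have : (avg^[m] fun u : Lattice d => if u = z then (1 : ℝ) else 0)
        = fun y => heat m (y + -z) := by
      funext u; rw [ih, ← heat_neg]; congr 1; abel
    rw [this, avg_add_right, ← heat_neg (m + 1), heat_succ]
    congr 1; abel

theorem IsSimpleRandomWalk.measureReal_inter_eq (hd : d ≠ 0) (h : IsSimpleRandomWalk μ x X)
    (n m : ℕ) (A : Set (Fin (n + 1) → Lattice d)) (z : Lattice d) :
    μ.real ({ω | (fun i : Fin (n + 1) => X i ω) ∈ A} ∩ {ω | X (n + m) ω = z})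
      = ∫ ω in {ω | (fun i : Fin (n + 1) => X i ω) ∈ A}, heat m (z - X n ω) ∂μ := by
  classical
  have hA : MeasurableSet {ω | (fun i : Fin (n + 1) => X i ω) ∈ A} :=
    h.measurable_past n (.of_discrete)
  have hz : MeasurableSet {ω | X (n + m) ω = z} := h.measurable _ (measurableSet_singleton _)
  have := h.markov hd n m (A.indicator 1) (fun u => if u = z then 1 else 0) (B := 1) (C := 1)
    (fun v => by by_cases hv : v ∈ A <;> simp [hv])
    (fun y => by split_ifs <;> simp)
  rw [← integral_indicator hA, ← integral_indicator_one (hA.inter hz)]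
  simp only [iterate_avg_indicator] at this
  refine Eq.trans (integral_congr_ae (.of_forall fun ω => ?_))
    (this.trans (integral_congr_ae (.of_forall fun ω => ?_)))
  · by_cases h1 : (fun i : Fin (n + 1) => X i ω) ∈ A <;> by_cases h2 : X (n + m) ω = z <;>
      simp [h1, h2]
  · by_cases h1 : (fun i : Fin (n + 1) => X i ω) ∈ A <;> simp [h1]

theorem IsSimpleRandomWalk.measureReal_eq (hd : d ≠ 0) (h : IsSimpleRandomWalk μ x X)
    (m : ℕ) (z : Lattice d) : μ.real {ω | X m ω = z} = heat m (z - x) := by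
  have := h.measureReal_inter_eq hd 0 m Set.univ z
  simpa [h.start] using this

/-- The probability that a point is visited during a time window. -/
theorem IsSimpleRandomWalk.sum_heat_le (hd : d ≠ 0) (h : IsSimpleRandomWalk μ x X)
    (n M : ℕ) (z : Lattice d) :
    ∑ j ∈ Finset.range M, heat (n + j) (z - x)
      ≤ μ.real {ω | ∃ j < M, X (n + j) ω = z} * ∑ j ∈ Finset.range M, heat j (0 : Lattice d) := by
  classical
  -- `A i` says that `n + i` is the first visit to `z` within the window.
  set A : (i : ℕ) → Set (Fin (n + i + 1) → Lattice d) := fun i =>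
    {v | v (Fin.last _) = z ∧ ∀ j : Fin (n + i + 1), n ≤ j → (j : ℕ) < n + i → v j ≠ z} with hA
  set E : ℕ → Set Ω := fun i => {ω | (fun l : Fin (n + i + 1) => X l ω) ∈ A i} with hE
  have hEm : ∀ i, MeasurableSet (E i) := fun i => h.measurable_past (n + i) .of_discrete
  have hEiff : ∀ i ω, ω ∈ E i ↔ X (n + i) ω = z ∧ ∀ j < i, X (n + j) ω ≠ z := by
    intro i ω
    simp only [hE, hA, Set.mem_ofPred_eq, Fin.val_last]
    refine and_congr_right fun _ => ⟨fun H j hj => H ⟨n + j, by omega⟩ (by simp) (by simp [hj]),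
      fun H j hj hji => ?_⟩
    have := H (j - n) (by omega)
    rwa [Nat.add_sub_cancel' hj] at this
  have hdisj : ∀ s : Finset ℕ, (s : Set ℕ).PairwiseDisjoint E := by
    intro s i _ j _ hij
    refine Set.disjoint_left.2 fun ω h1 h2 => ?_
    rw [hEiff] at h1 h2
    rcases lt_or_gt_of_ne hij with hlt | hlt
    · exact h2.2 i hlt h1.1
    · exact h1.2 j hlt h2.1
  have hcover : ∀ M, (⋃ i ∈ Finset.range M, E i) = {ω | ∃ j < M, X (n + j) ω = z} := by
    intro M
    ext ω
    simp only [Set.mem_iUnion, Finset.mem_range, Set.mem_ofPred_eq, exists_prop]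
    constructor
    · rintro ⟨i, hi, hω⟩; exact ⟨i, hi, ((hEiff i ω).1 hω).1⟩
    · rintro ⟨j, hj, hω⟩
      have hex : ∃ j, X (n + j) ω = z := ⟨j, hω⟩
      exact ⟨Nat.find hex, (Nat.find_min' hex hω).trans_lt hj,
        (hEiff _ ω).2 ⟨Nat.find_spec hex, fun i hi => Nat.find_min hex hi⟩⟩
  have hinter : ∀ i l, μ.real (E i ∩ {ω | X (n + (i + l)) ω = z}) = μ.real (E i) * heat l (0 : Lattice d) := by
    intro i l
    rw [← add_assoc, h.measureReal_inter_eq hd (n + i) l (A i) z,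
      setIntegral_congr_fun (g := fun _ => heat l (0 : Lattice d)) (hEm i)]
    · simp [hE]
    · intro ω hω
      simp only [((hEiff i ω).1 hω).1, sub_self]
  have hdecomp : ∀ j, heat (n + j) (z - x)
      = ∑ i ∈ Finset.range (j + 1), μ.real (E i) * heat (j - i) (0 : Lattice d) := by
    intro j
    rw [← h.measureReal_eq hd]
    have h1 : {ω | X (n + j) ω = z}
        = ⋃ i ∈ Finset.range (j + 1), (E i ∩ {ω | X (n + j) ω = z}) := by
      rw [← Set.iUnion₂_inter, hcover]
      ext ω
      simp only [Set.mem_ofPred_eq, Set.mem_inter_iff, iff_and_self]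
      exact fun hω => ⟨j, by omega, hω⟩
    rw [h1, measureReal_biUnion_finset]
    · refine Finset.sum_congr rfl fun i hi => ?_
      rw [Finset.mem_range] at hi
      have := hinter i (j - i)
      rwa [Nat.add_sub_cancel' (by omega)] at this
    · intro a ha b hb hab
      exact (hdisj _ ha hb hab).mono Set.inter_subset_left Set.inter_subset_left
    · exact fun i _ => (hEm i).inter (h.measurable _ (measurableSet_singleton _))
  rw [← hcover, measureReal_biUnion_finset (hdisj _) fun i _ => hEm i]
  simp only [hdecomp]
  -- Grouped by the first visit, the later visits are returns to `z`; letting them run over the full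
  -- range `M` decouples the two factors.
  rw [Finset.sum_range_diag_flip M fun i l => μ.real (E i) * heat l (0 : Lattice d), Finset.sum_mul]
  refine Finset.sum_le_sum fun i _ => ?_
  rw [← Finset.mul_sum]
  refine mul_le_mul_of_nonneg_left ?_ measureReal_nonneg
  exact Finset.sum_le_sum_of_subset_of_nonneg (Finset.range_mono (Nat.sub_le _ _))
    fun _ _ _ => heat_nonneg _ _

/-- The walk rarely stays in a narrow slab. -/
theorem IsSimpleRandomWalk.measureReal_slab_le (hd : d ≠ 0) (h : IsSimpleRandomWalk μ x X)
    (i : Fin d) (K n : ℕ) :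
    μ.real {ω | ∀ j ≤ n, (X j ω i).natAbs ≤ K}
      ≤ (K + 1 : ℝ) ^ 2 * (1 - 1 / (d * (K + 1 : ℝ) ^ 2)) ^ n := by
  classical
  set B : ℝ := K + 1 with hBdef
  have hB1 : 1 ≤ B := by rw [hBdef]; linarith [Nat.cast_nonneg (α := ℝ) K]
  have hd1 : (1 : ℝ) ≤ d := by exact_mod_cast Nat.one_le_iff_ne_zero.2 hd
  set ρ : ℝ := 1 - 1 / (d * B ^ 2) with hρ
  have hB2 : 1 ≤ B ^ 2 := one_le_pow₀ hB1
  have hρ0 : 0 ≤ ρ := by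
    have : 1 / (d * B ^ 2) ≤ 1 := by
      rw [div_le_one (by positivity)]; nlinarith
    linarith
  -- The parabola loses `1 / d` per step inside the slab, hence at least the fraction `1 / (d * B ^
  -- 2)` of its value. With `B = K + 1` the truncation is inactive at all neighbours of the slab,
  -- and `q ≥ 1` on the slab.
  set q : ℤ → ℝ := fun t => max (B ^ 2 - (t : ℝ) ^ 2) 0 with hq
  have hq0 : ∀ t, 0 ≤ q t := fun t => le_max_right _ _
  have hqB : ∀ t, q t ≤ B ^ 2 := fun t => max_le (by nlinarith [sq_nonneg (t : ℝ)]) (by positivity)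
  have hqabs : ∀ y : Lattice d, |q (y i)| ≤ B ^ 2 := fun y => by
    rw [abs_of_nonneg (hq0 _)]; exact hqB _
  have hqin : ∀ t : ℤ, t.natAbs ≤ K + 1 → q t = B ^ 2 - (t : ℝ) ^ 2 := fun t ht => by
    refine max_eq_left (sub_nonneg.2 (sq_le_sq' ?_ ?_))
    · have : -((K : ℤ) + 1) ≤ t := by omega
      rw [hBdef]; exact_mod_cast this
    · have : t ≤ (K : ℤ) + 1 := by omega
      rw [hBdef]; exact_mod_cast this
  have havg : ∀ y : Lattice d, (y i).natAbs ≤ K → avg (fun y => q (y i)) y ≤ ρ * q (y i) := by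
    intro y hy
    rw [avg_coord hd i q, hqin (y i + 1) (by omega), hqin (y i - 1) (by omega)]
    have h1 : q (y i) = B ^ 2 - (y i : ℝ) ^ 2 := hqin _ (by omega)
    have h2 : (B ^ 2 - ((y i + 1 : ℤ) : ℝ) ^ 2 + (B ^ 2 - ((y i - 1 : ℤ) : ℝ) ^ 2) - 2 * q (y i)) / (2 * d)
        = -(1 / d) := by
      rw [h1]; push_cast; field_simp; ring
    have h3 : 1 / ((d : ℝ) * B ^ 2) * q (y i) ≤ 1 / (d : ℝ) := by
      calc 1 / ((d : ℝ) * B ^ 2) * q (y i) ≤ 1 / ((d : ℝ) * B ^ 2) * B ^ 2 := by gcongr; exact hqB _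
        _ = 1 / (d : ℝ) := by field_simp
    rw [h2, hρ]; linarith
  set φ : (n : ℕ) → (Fin (n + 1) → Lattice d) → ℝ := fun n v =>
    if ∀ j, (v j i).natAbs ≤ K then 1 else 0 with hφ
  have hφ0 : ∀ n v, 0 ≤ φ n v := fun n v => by simp only [hφ]; split_ifs <;> norm_num
  have hφ1 : ∀ n v, φ n v ≤ 1 := fun n v => by simp only [hφ]; split_ifs <;> norm_num
  have hφabs : ∀ n v, |φ n v| ≤ 1 := fun n v => by rw [abs_of_nonneg (hφ0 n v)]; exact hφ1 n v
  have hint : ∀ n (g : Lattice d → ℝ) m, (∀ y, |g y| ≤ B ^ 2) →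
      Integrable (fun ω => φ n (fun j => X j ω) * g (X m ω)) μ := fun n g m hg => by
    refine integrable_of_bounded (C := B ^ 2) (((Measurable.of_discrete (f := φ n)).comp
      (h.measurable_past n)).mul ((Measurable.of_discrete (f := g)).comp (h.measurable m))) fun ω => ?_
    rw [abs_mul]
    calc _ ≤ 1 * B ^ 2 := mul_le_mul (hφabs _ _) (hg _) (abs_nonneg _) zero_le_one
      _ = B ^ 2 := one_mul _
  have hM : ∀ n, ∫ ω, φ n (fun j => X j ω) * q (X n ω i) ∂μ ≤ B ^ 2 * ρ ^ n := by
    intro n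
    induction n with
    | zero =>
      rw [pow_zero, mul_one]
      refine (integral_mono (hint 0 (fun y => q (y i)) 0 hqabs) (integrable_const (B ^ 2))
        fun ω => ?_).trans (by simp)
      calc _ ≤ 1 * B ^ 2 := mul_le_mul (hφ1 _ _) (hqB _) (hq0 _) zero_le_one
        _ = B ^ 2 := one_mul _
    | succ n ih =>
      calc ∫ ω, φ (n + 1) (fun j => X j ω) * q (X (n + 1) ω i) ∂μ
          ≤ ∫ ω, φ n (fun j => X j ω) * q (X (n + 1) ω i) ∂μ := by
            refine integral_mono (hint (n + 1) (fun y => q (y i)) (n + 1) hqabs)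
              (hint n (fun y => q (y i)) (n + 1) hqabs) fun ω => ?_
            refine mul_le_mul_of_nonneg_right ?_ (hq0 _)
            by_cases hs : ∀ j : Fin (n + 1 + 1), (X j ω i).natAbs ≤ K
            · have hs' : ∀ j : Fin (n + 1), (X j ω i).natAbs ≤ K := fun j => hs j.castSucc
              simp only [hφ, if_pos hs, if_pos hs', le_refl]
            · simp only [hφ, if_neg hs]; split_ifs <;> norm_num
        _ = ∫ ω, φ n (fun j => X j ω) * avg (fun y => q (y i)) (X n ω) ∂μ :=
            h.markov_step hd n (φ n) (fun y => q (y i)) (hφabs n) hqabs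
        _ ≤ ∫ ω, ρ * (φ n (fun j => X j ω) * q (X n ω i)) ∂μ := by
            refine integral_mono (hint n (avg fun y => q (y i)) n (abs_avg_le hd hqabs))
              ((hint n (fun y => q (y i)) n hqabs).const_mul ρ) fun ω => ?_
            by_cases hs : ∀ j : Fin (n + 1), (X j ω i).natAbs ≤ K
            · simp only [hφ, if_pos hs, one_mul]
              exact havg _ (hs (Fin.last n))
            · simp only [hφ, if_neg hs, zero_mul, mul_zero, le_refl]
        _ = ρ * ∫ ω, φ n (fun j => X j ω) * q (X n ω i) ∂μ := integral_const_mul _ _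
        _ ≤ ρ * (B ^ 2 * ρ ^ n) := mul_le_mul_of_nonneg_left ih hρ0
        _ = B ^ 2 * ρ ^ (n + 1) := by ring
  refine le_trans ?_ (hM n)
  have hset : MeasurableSet {ω | ∀ j ≤ n, (X j ω i).natAbs ≤ K} := by
    have : {ω | ∀ j ≤ n, (X j ω i).natAbs ≤ K} = ⋂ j, ⋂ (_ : j ≤ n), {ω | (X j ω i).natAbs ≤ K} := by
      ext ω; simp
    rw [this]
    exact MeasurableSet.iInter fun j => MeasurableSet.iInter fun _ =>
      h.measurable j (MeasurableSet.of_discrete (s := {y : Lattice d | (y i).natAbs ≤ K}))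
  rw [← integral_indicator_one hset]
  refine integral_mono ((integrable_const (1 : ℝ)).indicator hset)
    (hint n (fun y => q (y i)) n hqabs) fun ω => ?_
  by_cases hs : ∀ j ≤ n, (X j ω i).natAbs ≤ K
  · have hs' : ∀ j : Fin (n + 1), (X j ω i).natAbs ≤ K := fun j => hs j (by omega)
    have hx : (X n ω i).natAbs ≤ K := hs n le_rfl
    rw [Set.indicator_of_mem (show ω ∈ {ω | ∀ j ≤ n, (X j ω i).natAbs ≤ K} from hs)]
    simp only [hφ, if_pos hs', one_mul, Pi.one_apply]
    rw [hqin _ (by omega)]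
    have h1 : ((X n ω i : ℤ) : ℝ) ^ 2 ≤ (K : ℝ) ^ 2 := by
      refine sq_le_sq' ?_ ?_
      · have : -(K : ℤ) ≤ X n ω i := by omega
        exact_mod_cast this
      · have : X n ω i ≤ (K : ℤ) := by omega
        exact_mod_cast this
    rw [hBdef]; nlinarith [Nat.cast_nonneg (α := ℝ) K]
  · rw [Set.indicator_of_notMem (show ω ∉ {ω | ∀ j ≤ n, (X j ω i).natAbs ≤ K} from hs)]
    exact mul_nonneg (hφ0 _ _) (hq0 _)

end Walk

/-! ### Independence of disjoint groups of walks -/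

section Family

variable {Ω : Type*} [MeasurableSpace Ω] {μ : Measure Ω} {S : Lattice d → ℕ → Ω → Lattice d}

/-- The realization of all the walks at a sample point. -/
def config (S : Lattice d → ℕ → Ω → Lattice d) (ω : Ω) : Lattice d → ℕ → Lattice d :=
  fun x n => S x n ω

theorem IsFrogFamily.measurable_config (h : IsFrogFamily μ S) : Measurable (config S) :=
  measurable_pi_lambda _ fun x => measurable_pi_lambda _ fun n => (h.walk x).measurable n

/-- Filling in the missing walks by zero factors `f` and `g` through the trajectories started in `A`
and in `B`. -/
theorem IsFrogFamily.indepFun_of_dependsOn (h : IsFrogFamily μ S) {β γ : Type*}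
    [MeasurableSpace β] [MeasurableSpace γ] {A B : Finset (Lattice d)} (hAB : Disjoint A B)
    {f : (Lattice d → ℕ → Lattice d) → β} {g : (Lattice d → ℕ → Lattice d) → γ}
    (hf : Measurable f) (hg : Measurable g) (hfA : DependsOn f (A : Set (Lattice d)))
    (hgB : DependsOn g (B : Set (Lattice d))) :
    IndepFun (fun ω => f (config S ω)) (fun ω => g (config S ω)) μ := by
  classical
  have h1 := h.indep.indepFun_finset A B hAB fun x =>
    measurable_pi_lambda _ fun n => (h.walk x).measurable n
  let ext : (C : Finset (Lattice d)) → (C → ℕ → Lattice d) → Lattice d → ℕ → Lattice d :=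
    fun C v x => if hx : x ∈ C then v ⟨x, hx⟩ else 0
  have hext : ∀ C, Measurable (ext C) := fun C => measurable_pi_lambda _ fun x => by
    by_cases hx : x ∈ C
    · simp only [ext, dif_pos hx]; exact measurable_pi_apply _
    · simp only [ext, dif_neg hx]; exact measurable_const
  have h2 := h1.comp (hf.comp (hext A)) (hg.comp (hext B))
  refine h2.congr (.of_forall fun ω => ?_) (.of_forall fun ω => ?_)
  · refine hfA fun x hx => ?_
    simp only [ext, dif_pos (Finset.mem_coe.1 hx)]; rfl
  · refine hgB fun x hx => ?_
    simp only [ext, dif_pos (Finset.mem_coe.1 hx)]; rfl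

end Family

/-! ### Sites visited in a time window, and how many sites a group of walks covers -/

open Classical in
/-- The points of `D` visited by the walk from `a` during the time window `[n, n + M)`. -/
noncomputable def visits (n M : ℕ) (D : Finset (Lattice d)) (w : Lattice d → ℕ → Lattice d)
    (a : Lattice d) : Finset (Lattice d) :=
  D.filter fun z => ∃ j < M, w a (n + j) = z

theorem mem_visits {n M : ℕ} {D : Finset (Lattice d)} {w : Lattice d → ℕ → Lattice d}
    {a z : Lattice d} : z ∈ visits n M D w a ↔ z ∈ D ∧ ∃ j < M, w a (n + j) = z := by
  simp [visits]

theorem visits_subset (n M : ℕ) (D : Finset (Lattice d)) (w : Lattice d → ℕ → Lattice d)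
    (a : Lattice d) : visits n M D w a ⊆ D := fun _ hz => (mem_visits.1 hz).1

theorem card_visits_le (n M : ℕ) (D : Finset (Lattice d)) (w : Lattice d → ℕ → Lattice d)
    (a : Lattice d) : (visits n M D w a).card ≤ M := by
  classical
  have : visits n M D w a ⊆ (Finset.range M).image fun j => w a (n + j) := fun z hz => by
    obtain ⟨-, j, hj, hz⟩ := mem_visits.1 hz
    exact Finset.mem_image.2 ⟨j, Finset.mem_range.2 hj, hz⟩
  exact (Finset.card_le_card this).trans (Finset.card_image_le.trans (by simp))

theorem dependsOn_visits (n M : ℕ) (D : Finset (Lattice d)) (a : Lattice d) :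
    DependsOn (fun w => visits n M D w a) {a} := by
  intro w w' hw
  have : w a = w' a := hw a rfl
  simp only [visits, this]

/-- The discrete measurable structure on finite sets. -/
@[reducible] def finsetMeasurableSpace (α : Type*) : MeasurableSpace (Finset α) := ⊤

attribute [local instance] finsetMeasurableSpace

theorem measurableSet_mem_visits (n M : ℕ) (D : Finset (Lattice d)) (a z : Lattice d) :
    MeasurableSet {w : Lattice d → ℕ → Lattice d | z ∈ visits n M D w a} := by
  simp only [mem_visits]
  refine MeasurableSet.inter (s₂ := {w : Lattice d → ℕ → Lattice d | ∃ j < M, w a (n + j) = z}) (MeasurableSet.const _) ?_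
  have : {w : Lattice d → ℕ → Lattice d | ∃ j < M, w a (n + j) = z}
      = ⋃ j, ⋃ (_ : j < M), {w | w a (n + j) = z} := by ext; simp
  rw [this]
  refine MeasurableSet.iUnion fun j => MeasurableSet.iUnion fun _ => ?_
  have hm : Measurable fun w : Lattice d → ℕ → Lattice d => w a (n + j) :=
    (measurable_pi_apply (n + j)).comp (measurable_pi_apply a)
  exact hm (measurableSet_singleton z)

theorem measurable_finset_of_mem {α β : Type*} [MeasurableSpace α] [Countable β]
    {f : α → Finset β} (hf : ∀ z, MeasurableSet {x | z ∈ f x}) : Measurable f := by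
  refine measurable_to_countable' fun s => ?_
  have : f ⁻¹' {s} = ⋂ z, {x | z ∈ f x ↔ z ∈ s} := by
    ext x
    simp [Finset.ext_iff]
  rw [this]
  refine MeasurableSet.iInter fun z => ?_
  by_cases hz : z ∈ s
  · simpa [hz] using hf z
  · simp only [hz, iff_false]; exact (hf z).compl

theorem measurable_visits (n M : ℕ) (D : Finset (Lattice d)) (a : Lattice d) :
    Measurable fun w : Lattice d → ℕ → Lattice d => visits n M D w a :=
  measurable_finset_of_mem fun z => measurableSet_mem_visits n M D a z

theorem measurable_biUnion_visits (n M : ℕ) (D A : Finset (Lattice d)) :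
    Measurable fun w : Lattice d → ℕ → Lattice d => A.biUnion (visits n M D w) := by
  refine measurable_finset_of_mem fun z => ?_
  simp only [Finset.mem_biUnion]
  have : {w : Lattice d → ℕ → Lattice d | ∃ a ∈ A, z ∈ visits n M D w a}
      = ⋃ a ∈ A, {w | z ∈ visits n M D w a} := by ext; simp
  rw [this]
  exact Finset.measurableSet_biUnion _ fun a _ => measurableSet_mem_visits n M D a z

theorem dependsOn_biUnion_visits (n M : ℕ) (D A : Finset (Lattice d)) :
    DependsOn (fun w => A.biUnion (visits n M D w)) (A : Set (Lattice d)) := by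
  intro w w' hw
  refine Finset.biUnion_congr rfl fun a ha => ?_
  exact dependsOn_visits n M D a fun x hx => by rw [Set.mem_singleton_iff.1 hx]; exact hw a ha

section Coverage

variable {Ω : Type*} [MeasurableSpace Ω] {μ : Measure Ω} [IsProbabilityMeasure μ]
  {S : Lattice d → ℕ → Ω → Lattice d}

theorem exp_neg_le_one_sub_half {t : ℝ} (h0 : 0 ≤ t) (h1 : t ≤ 1) : Real.exp (-t) ≤ 1 - t / 2 := by
  rw [Real.exp_neg, inv_le_iff_one_le_mul₀ (Real.exp_pos t)]
  nlinarith [Real.add_one_le_exp t]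

/-- The weight used in the exponential estimate for the number of covered points. -/
noncomputable def coverWeight (D : Finset (Lattice d)) (b : ℕ) (u : Finset (Lattice d)) : ℝ :=
  if 2 * u.card ≤ D.card then Real.exp (-(u.card / b : ℝ)) else 0

theorem coverWeight_nonneg (D : Finset (Lattice d)) (b : ℕ) (u : Finset (Lattice d)) :
    0 ≤ coverWeight D b u := by
  unfold coverWeight; split_ifs <;> positivity

theorem coverWeight_le_one (D : Finset (Lattice d)) (b : ℕ) (u : Finset (Lattice d)) :
    coverWeight D b u ≤ 1 := by
  unfold coverWeight; split_ifs
  · exact Real.exp_le_one_iff.2 (neg_nonpos.2 (by positivity))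
  · norm_num

theorem coverWeight_union_le (D : Finset (Lattice d)) (b : ℕ) (u v : Finset (Lattice d)) :
    coverWeight D b (u ∪ v) ≤ coverWeight D b u * Real.exp (-((v \ u).card / b : ℝ)) := by
  have hc : (u ∪ v).card = u.card + (v \ u).card := by
    rw [← Finset.union_sdiff_self_eq_union, Finset.card_union_of_disjoint Finset.disjoint_sdiff]
  by_cases h : 2 * (u ∪ v).card ≤ D.card
  · rw [coverWeight, if_pos h, coverWeight, if_pos (by omega), ← Real.exp_add, hc]
    apply le_of_eq
    congr 1
    push_cast
    ring
  · rw [coverWeight, if_neg h]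
    exact mul_nonneg (coverWeight_nonneg _ _ _) (Real.exp_nonneg _)

/-- While `u` fills at most half of `D`, the expected number of new sites is at least `q * D.card /
2`. Dividing by the maximal number `b` of sites per walk keeps the exponent in `[0, 1]`, where `exp
(-t) ≤ 1 - t / 2`. -/
theorem IsFrogFamily.integral_exp_visits_le (h : IsFrogFamily μ S) {n M b : ℕ} (hb : 1 ≤ b)
    {D u : Finset (Lattice d)} {q : ℝ} {a : Lattice d}
    (hcard : ∀ w, (visits n M D w a).card ≤ b) (hu : 2 * u.card ≤ D.card) (huD : u ⊆ D)
    (hq0 : 0 ≤ q) (hq : ∀ z ∈ D, q ≤ μ.real {ω | ∃ j < M, S a (n + j) ω = z}) :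
    ∫ ω, Real.exp (-((visits n M D (config S ω) a \ u).card / b : ℝ)) ∂μ
      ≤ 1 - q * D.card / (4 * b) := by
  have hb0 : (0 : ℝ) < b := by exact_mod_cast hb
  have hV := (measurable_visits n M D a).comp h.measurable_config
  have hle : ∀ ω, (visits n M D (config S ω) a \ u).card ≤ b := fun ω =>
    (Finset.card_le_card Finset.sdiff_subset).trans (hcard _)
  have hm : ∀ z, MeasurableSet {ω | z ∈ visits n M D (config S ω) a} := fun z =>
    hV (MeasurableSpace.measurableSet_top (s := {v : Finset (Lattice d) | z ∈ v}))
  have hcardeq : ∀ ω, ((visits n M D (config S ω) a \ u).card : ℝ)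
      = ∑ z ∈ D \ u, Set.indicator {ω | z ∈ visits n M D (config S ω) a} (1 : Ω → ℝ) ω := by
    intro ω
    have : visits n M D (config S ω) a \ u
        = (D \ u).filter fun z => z ∈ visits n M D (config S ω) a := by
      ext z
      have : z ∈ visits n M D (config S ω) a → z ∈ D := fun hz => visits_subset _ _ _ _ _ hz
      simp only [Finset.mem_sdiff, Finset.mem_filter]
      tauto
    rw [this, Finset.card_filter]
    push_cast
    exact Finset.sum_congr rfl fun z _ => by simp [Set.indicator_apply]
  have hind : ∀ z, Integrable
      (Set.indicator {ω | z ∈ visits n M D (config S ω) a} (1 : Ω → ℝ)) μ := fun z =>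
    (integrable_const (1 : ℝ)).indicator (hm z)
  have hint : Integrable (fun ω => ((visits n M D (config S ω) a \ u).card : ℝ)) μ := by
    simp only [hcardeq]
    exact integrable_finsetSum _ fun z _ => hind z
  have hmean : q * D.card / 2 ≤ ∫ ω, ((visits n M D (config S ω) a \ u).card : ℝ) ∂μ := by
    simp only [hcardeq]
    rw [integral_finsetSum _ fun z _ => (hind z)]
    have hz : ∀ z ∈ D \ u, q ≤ ∫ ω, Set.indicator {ω | z ∈ visits n M D (config S ω) a}
        (1 : Ω → ℝ) ω ∂μ := by
      intro z hz
      have hzD := (Finset.mem_sdiff.1 hz).1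
      rw [integral_indicator_one (hm z)]
      convert hq z hzD using 3
      ext ω
      simp [mem_visits, hzD, config]
    have h1 := Finset.card_nsmul_le_sum _ _ _ hz
    rw [nsmul_eq_mul, Finset.card_sdiff_of_subset huD] at h1
    have h2 : (D.card : ℝ) / 2 ≤ ((D.card - u.card : ℕ) : ℝ) := by
      rw [Nat.cast_sub (Finset.card_le_card huD)]
      have : (2 * u.card : ℝ) ≤ D.card := by exact_mod_cast hu
      linarith
    nlinarith
  calc ∫ ω, Real.exp (-((visits n M D (config S ω) a \ u).card / b : ℝ)) ∂μ
      ≤ ∫ ω, (1 - ((visits n M D (config S ω) a \ u).card : ℝ) / (2 * b)) ∂μ := by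
        refine integral_mono ?_ ((integrable_const _).sub (hint.div_const _)) fun ω => ?_
        · refine integrable_of_bounded (C := 1) ?_ fun ω => ?_
          · exact (Measurable.of_discrete (f := fun v : Finset (Lattice d) =>
              Real.exp (-((v \ u).card / b : ℝ)))).comp hV
          · rw [abs_of_nonneg (Real.exp_nonneg _)]
            exact Real.exp_le_one_iff.2 (neg_nonpos.2 (by positivity))
        · refine (exp_neg_le_one_sub_half (by positivity) ?_).trans (le_of_eq (by field_simp))
          rw [div_le_one hb0]; exact_mod_cast hle ω
    _ = 1 - (∫ ω, ((visits n M D (config S ω) a \ u).card : ℝ) ∂μ) / (2 * b) := by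
        rw [integral_sub (integrable_const _) (hint.div_const _), integral_div]; simp
    _ ≤ 1 - q * D.card / (4 * b) := by
        have : q * D.card / (4 * b) = q * D.card / 2 / (2 * b) := by field_simp; norm_num
        rw [this]
        gcongr

/-- Walks are added one at a time. Given the set covered so far, the new walk is independent of it
and multiplies the mean weight by at most `exp (-(q * D.card / (4 * b)))`; once more than half of
`D` is covered the weight is zero and nothing is needed. -/
theorem IsFrogFamily.integral_coverWeight_le (h : IsFrogFamily μ S) {n M b : ℕ} (hb : 1 ≤ b)
    {D : Finset (Lattice d)} {q : ℝ} (A : Finset (Lattice d))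
    (hcard : ∀ w a, (visits n M D w a).card ≤ b)
    (hq0 : 0 ≤ q) (hq : ∀ a ∈ A, ∀ z ∈ D, q ≤ μ.real {ω | ∃ j < M, S a (n + j) ω = z}) :
    ∫ ω, coverWeight D b (A.biUnion (visits n M D (config S ω))) ∂μ
      ≤ Real.exp (-(q * D.card / (4 * b))) ^ A.card := by
  classical
  set θ := Real.exp (-(q * D.card / (4 * b))) with hθ
  induction A using Finset.induction_on with
  | empty => simpa using coverWeight_le_one D b ∅
  | insert a A ha ih =>
    specialize ih fun x hx => hq x (Finset.mem_insert_of_mem hx)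
    set U : Ω → Finset (Lattice d) := fun ω => A.biUnion (visits n M D (config S ω)) with hU
    set V : Ω → Finset (Lattice d) := fun ω => visits n M D (config S ω) a with hV
    have hUm : Measurable U := (measurable_biUnion_visits n M D A).comp h.measurable_config
    have hVm : Measurable V := (measurable_visits n M D a).comp h.measurable_config
    have hUD : ∀ ω, U ω ⊆ D := fun ω => Finset.biUnion_subset.2 fun x _ => visits_subset _ _ _ _ _
    have hind : IndepFun U V μ := by
      refine h.indepFun_of_dependsOn (A := A) (B := {a}) (by simpa using ha)
        (measurable_biUnion_visits n M D A) (measurable_visits n M D a)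
        (dependsOn_biUnion_visits n M D A) ?_
      rw [Finset.coe_singleton]
      exact dependsOn_visits n M D a
    have hUset : ∀ u, MeasurableSet {ω | U ω = u} := fun u =>
      hUm (MeasurableSpace.measurableSet_top (s := {u}))
    set e : Finset (Lattice d) → Finset (Lattice d) → ℝ := fun u v =>
      Real.exp (-((v \ u).card / b : ℝ)) with he
    have he1 : ∀ u v, |e u v| ≤ 1 := fun u v => by
      rw [abs_of_nonneg (Real.exp_nonneg _)]
      exact Real.exp_le_one_iff.2 (neg_nonpos.2 (by positivity))
    have hone : ∀ u v : Finset (Lattice d), |(if v = u then (1 : ℝ) else 0)| ≤ 1 := fun u v => by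
      split_ifs <;> simp
    have hcw : ∀ u, |coverWeight D b u| ≤ 1 := fun u => by
      rw [abs_of_nonneg (coverWeight_nonneg _ _ _)]; exact coverWeight_le_one _ _ _
    have hindm : ∀ u, Measurable fun ω => if U ω = u then (1 : ℝ) else 0 := fun u =>
      (Measurable.of_discrete (f := fun v : Finset (Lattice d) => if v = u then (1 : ℝ) else 0)).comp hUm
    have hint1 : ∀ u, Integrable (fun ω => coverWeight D b u * ((if U ω = u then 1 else 0) * e u (V ω))) μ :=
      fun u => Integrable.const_mul (integrable_of_bounded (C := 1)
        ((hindm u).mul ((Measurable.of_discrete (f := e u)).comp hVm)) fun ω => by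
          rw [Pi.mul_apply, abs_mul]; exact mul_le_one₀ (hone _ _) (abs_nonneg _) (he1 _ _)) _
    -- Conditioning on the covered set is a finite sum, since it is a subset of `D`.
    have hsplit : ∀ (G : Finset (Lattice d) → ℝ) ω,
        coverWeight D b (U ω) * G (U ω)
          = ∑ u ∈ D.powerset, coverWeight D b u * ((if U ω = u then 1 else 0) * G u) := by
      intro G ω
      rw [Finset.sum_eq_single (U ω)]
      · simp
      · intro u _ hu; simp [hu.symm]
      · intro hn; exact absurd (Finset.mem_powerset.2 (hUD ω)) hn
    calc ∫ ω, coverWeight D b ((insert a A).biUnion (visits n M D (config S ω))) ∂μ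
        ≤ ∫ ω, ∑ u ∈ D.powerset, coverWeight D b u * ((if U ω = u then 1 else 0) * e u (V ω)) ∂μ := by
          refine integral_mono (integrable_of_bounded (C := 1) ?_ fun ω => hcw _)
            (integrable_finsetSum _ fun u _ => hint1 u) fun ω => ?_
          · exact (Measurable.of_discrete (f := coverWeight D b)).comp
              ((measurable_biUnion_visits n M D (insert a A)).comp h.measurable_config)
          · simp only
            rw [← hsplit (fun u => e u (V ω)) ω, Finset.biUnion_insert, Finset.union_comm]
            exact coverWeight_union_le D b (U ω) (V ω)
      _ = ∑ u ∈ D.powerset, coverWeight D b u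
            * ((∫ ω, (if U ω = u then 1 else 0) ∂μ) * ∫ ω, e u (V ω) ∂μ) := by
          rw [integral_finsetSum _ fun u _ => hint1 u]
          refine Finset.sum_congr rfl fun u _ => ?_
          rw [integral_const_mul]
          congr 1
          exact hind.integral_fun_comp_mul_comp (f := fun v => if v = u then (1 : ℝ) else 0)
            (g := e u) hUm.aemeasurable hVm.aemeasurable
            Measurable.of_discrete.aestronglyMeasurable Measurable.of_discrete.aestronglyMeasurable
      _ ≤ ∑ u ∈ D.powerset, coverWeight D b u * ((∫ ω, (if U ω = u then 1 else 0) ∂μ) * θ) := by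
          refine Finset.sum_le_sum fun u hu => ?_
          by_cases hu2 : 2 * u.card ≤ D.card
          · have h1 := h.integral_exp_visits_le hb (fun w => hcard w a) hu2
              (Finset.mem_powerset.1 hu) hq0 (hq a (Finset.mem_insert_self _ _))
            have h2 : 1 - q * D.card / (4 * b) ≤ θ := by
              have := Real.add_one_le_exp (-(q * D.card / (4 * b)))
              linarith
            refine mul_le_mul_of_nonneg_left (mul_le_mul_of_nonneg_left (h1.trans h2) ?_)
              (coverWeight_nonneg _ _ _)
            exact integral_nonneg fun ω => by simp only [Pi.zero_apply]; split_ifs <;> norm_num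
          · simp [coverWeight, if_neg hu2]
      _ = (∫ ω, coverWeight D b (U ω) ∂μ) * θ := by
          have : ∀ ω, coverWeight D b (U ω)
              = ∑ u ∈ D.powerset, coverWeight D b u * (if U ω = u then 1 else 0) := fun ω => by
            simpa using hsplit (fun _ => 1) ω
          simp only [this]
          rw [integral_finsetSum, Finset.sum_mul]
          · refine Finset.sum_congr rfl fun u _ => ?_
            rw [integral_const_mul, mul_assoc]
          · exact fun u _ => (integrable_of_bounded (hindm u) fun ω => hone _ _).const_mul _
      _ ≤ θ ^ A.card * θ := by gcongr
      _ = θ ^ (insert a A).card := by rw [Finset.card_insert_of_notMem ha, pow_succ]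

/-- Walks started from many points cover many points of `D`. -/
theorem IsFrogFamily.measureReal_card_biUnion_lt (h : IsFrogFamily μ S) {n M b : ℕ} (hb : 1 ≤ b)
    {D : Finset (Lattice d)} {q : ℝ} (A : Finset (Lattice d))
    (hcard : ∀ w a, (visits n M D w a).card ≤ b)
    (hq0 : 0 ≤ q) (hq : ∀ a ∈ A, ∀ z ∈ D, q ≤ μ.real {ω | ∃ j < M, S a (n + j) ω = z})
    {s : ℝ} (hs : 2 * s ≤ D.card) :
    μ.real {ω | ((A.biUnion (visits n M D (config S ω))).card : ℝ) < s}
      ≤ Real.exp (s / b - A.card * (q * D.card / (4 * b))) := by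
  have hm : Measurable fun ω => A.biUnion (visits n M D (config S ω)) :=
    (measurable_biUnion_visits n M D A).comp h.measurable_config
  have hE : MeasurableSet {ω | ((A.biUnion (visits n M D (config S ω))).card : ℝ) < s} :=
    hm (MeasurableSpace.measurableSet_top (s := {v : Finset (Lattice d) | (v.card : ℝ) < s}))
  have h1 := h.integral_coverWeight_le hb A hcard hq0 hq
  rw [← Real.exp_nat_mul] at h1
  have h2 : μ.real {ω | ((A.biUnion (visits n M D (config S ω))).card : ℝ) < s}
      ≤ ∫ ω, Real.exp (s / b) * coverWeight D b (A.biUnion (visits n M D (config S ω))) ∂μ := by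
    rw [← integral_indicator_one hE]
    refine integral_mono ((integrable_const (1 : ℝ)).indicator hE) (Integrable.const_mul
      (integrable_of_bounded (C := 1) ((Measurable.of_discrete (f := coverWeight D b)).comp hm)
        fun ω => ?_) _) fun ω => ?_
    · rw [Function.comp_apply, abs_of_nonneg (coverWeight_nonneg _ _ _)]
      exact coverWeight_le_one _ _ _
    · refine Set.indicator_le' (f := 1) (g := fun ω => Real.exp (s / b)
        * coverWeight D b (A.biUnion (visits n M D (config S ω)))) (fun ω hω => ?_)
        (fun ω _ => mul_nonneg (Real.exp_nonneg _) (coverWeight_nonneg _ _ _)) ω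
      have hω' : ((A.biUnion (visits n M D (config S ω))).card : ℝ) < s := hω
      -- The choice `2 * s ≤ D.card` keeps the weight alive on the event, where it is at least `exp
      -- (-(s / b))`; the claim is then Markov's inequality.
      have h3 : 2 * (A.biUnion (visits n M D (config S ω))).card ≤ D.card := by
        have : (2 * (A.biUnion (visits n M D (config S ω))).card : ℝ) ≤ D.card := by linarith
        exact_mod_cast this
      rw [coverWeight, if_pos h3, ← Real.exp_add, Pi.one_apply]
      refine Real.one_le_exp ?_
      have : ((A.biUnion (visits n M D (config S ω))).card : ℝ) / b ≤ s / b := by gcongr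
      linarith
  rw [integral_const_mul] at h2
  calc _ ≤ _ := h2
    _ ≤ Real.exp (s / b) * Real.exp (A.card * -(q * D.card / (4 * b))) := by gcongr
    _ = _ := by rw [← Real.exp_add]; congr 1; ring

end Coverage

/-! ### Growth of the generations -/

/-- The successive generations of activated sites: the walk from `0` runs for time `r`, and the
walks started from generation `k` activate the points of `D (k + 1)` which they visit during
the time window `[n, n + M)`. -/
noncomputable def gen (r n M : ℕ) (D : ℕ → Finset (Lattice d)) (w : Lattice d → ℕ → Lattice d) :
    ℕ → Finset (Lattice d)
  | 0 => visits 0 r (D 0) w 0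
  | k + 1 => (gen r n M D w k).biUnion (visits n M (D (k + 1)) w)

/-- The walks which determine the `k`-th generation. -/
def genSupport (D : ℕ → Finset (Lattice d)) (k : ℕ) : Finset (Lattice d) :=
  {0} ∪ (Finset.range k).biUnion D

theorem gen_subset (r n M : ℕ) (D : ℕ → Finset (Lattice d)) (w : Lattice d → ℕ → Lattice d)
    (k : ℕ) : gen r n M D w k ⊆ D k := by
  cases k with
  | zero => exact visits_subset _ _ _ _ _
  | succ k => exact Finset.biUnion_subset.2 fun x _ => visits_subset _ _ _ _ _

theorem dependsOn_gen (r n M : ℕ) (D : ℕ → Finset (Lattice d)) (k : ℕ) :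
    DependsOn (fun w => gen r n M D w k) (genSupport D k : Set (Lattice d)) := by
  induction k with
  | zero =>
    intro w w' hw
    exact dependsOn_visits 0 r (D 0) 0 fun x hx => hw x (by
      rw [Set.mem_singleton_iff.1 hx]; simp [genSupport])
  | succ k ih =>
    intro w w' hw
    have h1 : gen r n M D w k = gen r n M D w' k := ih fun x hx => hw x (by
      simp only [genSupport, Finset.coe_union, Finset.coe_biUnion, Set.mem_union, Set.mem_iUnion,
        Finset.coe_singleton, Finset.coe_range, Set.mem_Iio] at hx ⊢
      exact hx.imp_right fun ⟨i, hi, hx⟩ => ⟨i, by omega, hx⟩)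
    simp only [gen]
    rw [h1]
    refine dependsOn_biUnion_visits n M (D (k + 1)) (gen r n M D w' k) fun x hx => hw x ?_
    have := gen_subset r n M D w' k hx
    simp only [genSupport, Finset.coe_union, Finset.coe_biUnion, Set.mem_union, Set.mem_iUnion]
    exact Or.inr ⟨k, by simp, this⟩

theorem measurable_gen (r n M : ℕ) (D : ℕ → Finset (Lattice d)) (k : ℕ) :
    Measurable fun w : Lattice d → ℕ → Lattice d => gen r n M D w k := by
  induction k with
  | zero => exact measurable_visits 0 r (D 0) 0
  | succ k ih =>
    refine measurable_to_countable' fun s => ?_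
    have : (fun w : Lattice d → ℕ → Lattice d => gen r n M D w (k + 1)) ⁻¹' {s}
        = ⋃ A, ((fun w => gen r n M D w k) ⁻¹' {A})
          ∩ ((fun w => A.biUnion (visits n M (D (k + 1)) w)) ⁻¹' {s}) := by
      ext w
      simp [gen]
    rw [this]
    exact MeasurableSet.iUnion fun A => (ih (MeasurableSpace.measurableSet_top)).inter
      (measurable_biUnion_visits n M (D (k + 1)) A (MeasurableSpace.measurableSet_top))

/-- Each generation adds one step of duration less than `n + M`, and all walks used up to generation
`K` start at `0` or in earlier regions, which lie in `B`. -/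
theorem passageTime_le_of_mem_gen {B : Set (Lattice d)} [DecidablePred (· ∈ B)] {r n M K : ℕ}
    {D : ℕ → Finset (Lattice d)} (h0 : (0 : Lattice d) ∈ B) (hB : ∀ k < K, ∀ z ∈ D k, z ∈ B)
    (w : Lattice d → ℕ → Lattice d) {k : ℕ} (hk : k ≤ K) {a : Lattice d}
    (ha : a ∈ gen r n M D w k) :
    passageTime (mask B w) 0 a ≤ (r + k * (n + M) : ℕ) := by
  induction k generalizing a with
  | zero =>
    obtain ⟨-, j, hj, hja⟩ := mem_visits.1 ha
    have h1 : mask B w 0 (0 + j) = a := by rw [mask, if_pos h0, hja]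
    refine (passageTime_le_add_step (passageTime_self _ _) h1).trans ?_
    exact_mod_cast (by omega : 0 + (0 + j) ≤ r + 0 * (n + M))
  | succ k ih =>
    obtain ⟨b, hb, hba⟩ := Finset.mem_biUnion.1 ha
    obtain ⟨-, j, hj, hja⟩ := mem_visits.1 hba
    have h1 : mask B w b (n + j) = a := by
      rw [mask, if_pos (hB k (by omega) b (gen_subset _ _ _ _ _ _ hb)), hja]
    refine (passageTime_le_add_step (ih (by omega) hb) h1).trans ?_
    have : r + k * (n + M) + (n + j) ≤ r + (k + 1) * (n + M) := by nlinarith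
    exact_mod_cast this

section

variable {Ω : Type*} [MeasurableSpace Ω] {μ : Measure Ω} [IsProbabilityMeasure μ]
  {S : Lattice d → ℕ → Ω → Lattice d}

/-- A large generation is followed by a large generation. -/
theorem IsFrogFamily.measureReal_gen_succ_lt (h : IsFrogFamily μ S) {r n M b : ℕ} (hb : 1 ≤ b)
    {D : ℕ → Finset (Lattice d)} {k : ℕ} {q : ℝ} (hdisj : Disjoint (genSupport D k) (D k))
    (hcard : ∀ w a, (visits n M (D (k + 1)) w a).card ≤ b) (hq0 : 0 ≤ q)
    (hq : ∀ a ∈ D k, ∀ z ∈ D (k + 1), q ≤ μ.real {ω | ∃ j < M, S a (n + j) ω = z})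
    {s s' : ℝ} (hs' : 2 * s' ≤ (D (k + 1)).card) :
    μ.real {ω | s ≤ ((gen r n M D (config S ω) k).card : ℝ)
        ∧ ((gen r n M D (config S ω) (k + 1)).card : ℝ) < s'}
      ≤ Real.exp (s' / b - s * (q * (D (k + 1)).card / (4 * b))) := by
  classical
  set Y : Ω → Finset (Lattice d) := fun ω => gen r n M D (config S ω) k with hY
  set Z : Finset (Lattice d) → Ω → Finset (Lattice d) := fun A ω =>
    A.biUnion (visits n M (D (k + 1)) (config S ω)) with hZ
  have hYm : Measurable Y := (measurable_gen r n M D k).comp h.measurable_config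
  set E := Real.exp (s' / b - s * (q * (D (k + 1)).card / (4 * b))) with hE
  set T := (D k).powerset.filter fun A => s ≤ (A.card : ℝ) with hT
  have hsub : {ω | s ≤ ((Y ω).card : ℝ) ∧ ((gen r n M D (config S ω) (k + 1)).card : ℝ) < s'}
      ⊆ ⋃ A ∈ T, {ω | Y ω = A} ∩ {ω | ((Z A ω).card : ℝ) < s'} := by
    intro ω hω
    refine Set.mem_biUnion (x := Y ω) ?_ ⟨rfl, hω.2⟩
    simp only [hT, Finset.coe_filter, Finset.mem_powerset]
    exact ⟨gen_subset _ _ _ _ _ _, hω.1⟩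
  have hYset : ∀ A, MeasurableSet {ω | Y ω = A} := fun A =>
    hYm (MeasurableSpace.measurableSet_top (s := {A}))
  have hterm : ∀ A ∈ T, μ.real ({ω | Y ω = A} ∩ {ω | ((Z A ω).card : ℝ) < s'})
      ≤ μ.real {ω | Y ω = A} * E := by
    intro A hA
    simp only [hT, Finset.mem_filter, Finset.mem_powerset] at hA
    -- Generation `k` is determined by walks started outside `D k`, whereas `Z A` uses only walks
    -- started in `A ⊆ D k`.
    have hind : IndepFun Y (Z A) μ := by
      refine h.indepFun_of_dependsOn (A := genSupport D k) (B := A)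
        (hdisj.mono_right hA.1) (measurable_gen r n M D k)
        (measurable_biUnion_visits n M (D (k + 1)) A) (dependsOn_gen r n M D k)
        (dependsOn_biUnion_visits n M (D (k + 1)) A)
    have h1 := hind.measure_inter_preimage_eq_mul {A} {v | ((v.card : ℕ) : ℝ) < s'}
      MeasurableSpace.measurableSet_top MeasurableSpace.measurableSet_top
    have h2 : μ.real ({ω | Y ω = A} ∩ {ω | ((Z A ω).card : ℝ) < s'})
        = μ.real {ω | Y ω = A} * μ.real {ω | ((Z A ω).card : ℝ) < s'} := by
      simp only [measureReal_def, ← ENNReal.toReal_mul]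
      exact congrArg ENNReal.toReal h1
    rw [h2]
    refine mul_le_mul_of_nonneg_left ?_ measureReal_nonneg
    refine (h.measureReal_card_biUnion_lt hb A hcard hq0 (fun a ha => hq a (hA.1 ha)) hs').trans ?_
    refine Real.exp_le_exp.2 (sub_le_sub_left ?_ _)
    exact mul_le_mul_of_nonneg_right hA.2 (by positivity)
  calc _ ≤ μ.real (⋃ A ∈ T, {ω | Y ω = A} ∩ {ω | ((Z A ω).card : ℝ) < s'}) :=
        measureReal_mono hsub (measure_ne_top _ _)
    _ ≤ ∑ A ∈ T, μ.real ({ω | Y ω = A} ∩ {ω | ((Z A ω).card : ℝ) < s'}) :=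
        measureReal_biUnion_finset_le _ _
    _ ≤ ∑ A ∈ T, μ.real {ω | Y ω = A} * E := Finset.sum_le_sum hterm
    _ = μ.real (⋃ A ∈ T, {ω | Y ω = A}) * E := by
        rw [← Finset.sum_mul, measureReal_biUnion_finset _ fun A _ => hYset A]
        intro A _ A' _ hAA'
        exact Set.disjoint_left.2 fun ω h1 h2 => hAA' (h1.symm.trans h2)
    _ ≤ 1 * E := mul_le_mul_of_nonneg_right measureReal_le_one (Real.exp_nonneg _)
    _ = E := one_mul _

/-- The first generation is large. -/
theorem IsFrogFamily.measureReal_gen_zero_lt (hd : d ≠ 0) (h : IsFrogFamily μ S) {r n M K : ℕ}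
    {D : ℕ → Finset (Lattice d)} (hD : ∀ z : Lattice d, z ≠ 0 → norm1 z ≤ r → z ∈ D 0) :
    μ.real {ω | (gen (r + 1) n M D (config S ω) 0).card < K}
      ≤ (K + 1 : ℝ) ^ 2 * (1 - 1 / (d * (K + 1 : ℝ) ^ 2)) ^ r := by
  classical
  let i : Fin d := ⟨0, Nat.pos_of_ne_zero hd⟩
  refine le_trans ?_ ((h.walk 0).measureReal_slab_le hd i K r)
  have hae : ∀ᵐ ω ∂μ, ∀ n, norm1 (S 0 (n + 1) ω - S 0 n ω) = 1 := by
    rw [ae_all_iff]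
    intro n
    filter_upwards [(h.walk 0).ae_step hd n] with ω ⟨p, hp⟩
    rw [hp, norm1_unitVec]
  have hle : ∀ᵐ ω ∂μ, ω ∈ {ω | (gen (r + 1) n M D (config S ω) 0).card < K} →
      ω ∈ {ω | ∀ j ≤ r, (S 0 j ω i).natAbs ≤ K} := by
    filter_upwards [hae] with ω hstep
    intro hcard
    by_contra hex
    simp only [not_forall, not_le] at hex
    obtain ⟨j, hj, hjK⟩ := hex
    have hnorm : ∀ m, norm1 (S 0 m ω) ≤ m := by
      intro m
      induction m with
      | zero => simp [(h.walk 0).start, norm1_zero]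
      | succ m ih =>
        have := norm1_add_le (S 0 (m + 1) ω - S 0 m ω) (S 0 m ω)
        rw [sub_add_cancel, hstep m] at this
        omega
    -- Discrete intermediate values: the absolute value of a coordinate changes by at most one per
    -- step, so leaving the slab forces visits to `K` sites with distinct values `1, ..., K`.
    have hinter : ∀ v : ℕ, v ≤ (S 0 j ω i).natAbs → ∃ m ≤ j, (S 0 m ω i).natAbs = v := by
      clear hjK
      clear hj
      induction j with
      | zero =>
        intro v hv
        exact ⟨0, le_rfl, by simp [(h.walk 0).start] at hv ⊢; omega⟩
      | succ j ih =>
        intro v hv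
        by_cases hv' : v ≤ (S 0 j ω i).natAbs
        · obtain ⟨m, hm, hmv⟩ := ih v hv'
          exact ⟨m, by omega, hmv⟩
        · refine ⟨j + 1, le_rfl, ?_⟩
          have := natAbs_le_norm1 (S 0 (j + 1) ω - S 0 j ω) i
          rw [hstep j, Pi.sub_apply] at this
          omega
    have hsub : Finset.Icc 1 K ⊆ (gen (r + 1) n M D (config S ω) 0).image fun z => (z i).natAbs := by
      intro v hv
      rw [Finset.mem_Icc] at hv
      obtain ⟨m, hm, hmv⟩ := hinter v (by omega)
      refine Finset.mem_image.2 ⟨S 0 m ω, mem_visits.2 ⟨hD _ ?_ ((hnorm m).trans (by omega)),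
        m, by omega, by simp [config]⟩, hmv⟩
      intro h0
      rw [h0] at hmv
      simp at hmv
      omega
    have := (Finset.card_le_card hsub).trans Finset.card_image_le
    rw [Nat.card_Icc] at this
    have hcard' : (gen (r + 1) n M D (config S ω) 0).card < K := hcard
    omega
  exact ENNReal.toReal_mono (measure_ne_top _ _) (measure_mono_ae hle)

end

/-! ### Hitting probabilities in a time window -/

/-- Lower bound for the expected number of visits during a time window. -/
theorem sum_heat_window_ge (hd : d ≠ 0) {L R h : ℕ} (hL : 8 * d ^ 2 ≤ L) (hR : 1 ≤ R)
    (hexp : Real.exp (-(L : ℝ)) < 1 / (4 * (5 * L ^ 2 * R : ℝ) ^ d)) (hh : 2 * h ^ 2 ≤ L ^ 4 * R ^ 2)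
    {u : Lattice d} (hu : norm1 u ≤ L * R) :
    (2 * h ^ 2 : ℕ) * (1 / (8 * (5 * L ^ 2 * R : ℝ) ^ d))
      ≤ ∑ k ∈ Finset.range (4 * h ^ 2), heat (2 * (L ^ 4 * R ^ 2) + k) u := by
  have hd1 : 1 ≤ d := Nat.one_le_iff_ne_zero.2 hd
  have hL1 : 1 ≤ L := by nlinarith [Nat.one_le_pow 2 d hd1]
  set n := L ^ 4 * R ^ 2 with hn
  have hn1 : 1 ≤ n := Nat.one_le_iff_ne_zero.2 (by positivity)
  set β : ℝ := 1 / (4 * (5 * L ^ 2 * R : ℝ) ^ d) with hβ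
  have hβ8 : 1 / (8 * (5 * L ^ 2 * R : ℝ) ^ d) = β / 2 := by rw [hβ]; field_simp; norm_num
  have hdiag : ∀ j, n ≤ j → j ≤ 2 * n → β ≤ heat (2 * j) (0 : Lattice d) := by
    intro j hj1 hj2
    refine le_trans ?_ (heat_two_mul_zero_ge hd (hn1.trans hj1))
    have hs : Nat.sqrt (2 * j) ≤ 2 * (L ^ 2 * R) := by
      calc Nat.sqrt (2 * j) ≤ Nat.sqrt ((2 * (L ^ 2 * R)) ^ 2) := Nat.sqrt_le_sqrt (by
              rw [show (2 * (L ^ 2 * R)) ^ 2 = 4 * n by rw [hn]; ring]; omega)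
        _ = _ := Nat.sqrt_eq' _
    have hs' : 2 * Nat.sqrt (2 * j) + 1 ≤ 5 * L ^ 2 * R := by
      have : 1 ≤ L ^ 2 * R := Nat.one_le_iff_ne_zero.2 (by positivity)
      nlinarith
    have hs2 : (2 * Nat.sqrt (2 * j) + 1 : ℝ) ≤ 5 * L ^ 2 * R := by exact_mod_cast hs'
    rw [hβ]
    gcongr
  -- The scale `n = L ^ 4 * R ^ 2` exceeds the squared distance by two powers of `L`; one pays for
  -- the logarithmic factor, the other leaves room for `8 * d ^ 2`.
  have heven : ∀ j, n ≤ j → j ≤ 2 * n → ∀ x : Lattice d, norm1 x ≤ L * R + 1 → Even (norm1 x) →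
      β / 2 ≤ heat (2 * j) x := by
    intro j hj1 hj2 x hx hxe
    have h1 := hdiag j hj1 hj2
    have h2 := half_heat_zero_le hd (hn1.trans hj1) (hexp.trans_le h1) hxe ?_
    · linarith
    · have h3 : (d * norm1 x) ^ 2 * L * 2 ≤ j := by
        have hLR : 1 ≤ L * R := Nat.one_le_iff_ne_zero.2 (by positivity)
        have h4 : norm1 x ≤ 2 * (L * R) := by omega
        calc (d * norm1 x) ^ 2 * L * 2 ≤ (d * (2 * (L * R))) ^ 2 * L * 2 := by gcongr
          _ = (8 * d ^ 2) * (L ^ 3 * R ^ 2) := by ring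
          _ ≤ L * (L ^ 3 * R ^ 2) := by gcongr
          _ = n := by rw [hn]; ring
          _ ≤ j := hj1
      have h3' : (d * norm1 x : ℝ) ^ 2 * L * 2 ≤ j := by exact_mod_cast h3
      linarith
  -- At odd distance the even-time kernel vanishes, so one further step is made; all neighbours of
  -- `x` have even norm.
  have hodd : ∀ j, n ≤ j → j ≤ 2 * n → ∀ x : Lattice d, norm1 x ≤ L * R → ¬ Even (norm1 x) →
      β / 2 ≤ heat (2 * j + 1) x := by
    intro j hj1 hj2 x hx hxo
    rw [heat_succ]
    have hpar : ∀ p : Fin d × Bool, Even (norm1 (x + unitVec p)) ∧ norm1 (x + unitVec p) ≤ L * R + 1 := by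
      intro p
      constructor
      · have key : ∀ y : Lattice d, (norm1 y : ZMod 2) = ((∑ i, y i : ℤ) : ZMod 2) := by
          intro y
          unfold norm1
          push_cast
          refine Finset.sum_congr rfl fun i _ => ?_
          rcases Int.natAbs_eq (y i) with h | h
          · conv_rhs => rw [h]
            simp
          · conv_rhs => rw [h]
            simp
        have h1 : ((norm1 (x + unitVec p) : ℕ) : ZMod 2) = norm1 x + norm1 (unitVec p) := by
          rw [key, key, key]; simp [Finset.sum_add_distrib]
        rw [norm1_unitVec, ← Nat.cast_add, ZMod.natCast_eq_natCast_iff'] at h1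
        rw [Nat.not_even_iff] at hxo
        rw [Nat.even_iff]
        omega
      · have := norm1_add_le x (unitVec p)
        rw [norm1_unitVec] at this
        omega
    calc β / 2 = avg (fun _ => β / 2) x := (avg_const hd _ _).symm
      _ ≤ avg (heat (2 * j)) x := by
        rw [avg_eq_sum_unitVec, avg_eq_sum_unitVec]
        refine Finset.sum_le_sum fun p _ => mul_le_mul_of_nonneg_right ?_ (by positivity)
        exact heven j hj1 hj2 _ (hpar p).2 (hpar p).1
  have hpair : ∀ l ∈ Finset.range (2 * h ^ 2),
      β / 2 ≤ heat (2 * n + 2 * l) u + heat (2 * n + (2 * l + 1)) u := by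
    intro l hl
    rw [Finset.mem_range] at hl
    have h0 := heat_nonneg (2 * n + 2 * l) u
    have h1 := heat_nonneg (2 * n + (2 * l + 1)) u
    by_cases hev : Even (norm1 u)
    · have := heven (n + l) (by omega) (by omega) u (by omega) hev
      rw [mul_add] at this
      linarith
    · have := hodd (n + l) (by omega) (by omega) u hu hev
      rw [show 2 * (n + l) + 1 = 2 * n + (2 * l + 1) by ring] at this
      linarith
  have hsum : ∀ m, ∑ k ∈ Finset.range (2 * m), heat (2 * n + k) u
      = ∑ l ∈ Finset.range m, (heat (2 * n + 2 * l) u + heat (2 * n + (2 * l + 1)) u) := by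
    intro m
    induction m with
    | zero => simp
    | succ m ih =>
      rw [show 2 * (m + 1) = 2 * m + 1 + 1 by ring, Finset.sum_range_succ, Finset.sum_range_succ,
        Finset.sum_range_succ, ih]
      ring
  rw [show 4 * h ^ 2 = 2 * (2 * h ^ 2) by ring, hsum, hβ8]
  have := Finset.card_nsmul_le_sum _ _ _ hpair
  rwa [Finset.card_range, nsmul_eq_mul] at this

/-- Lower bound for the probability of visiting a point during a time window. -/
theorem IsSimpleRandomWalk.measureReal_window_ge {Ω : Type*} [MeasurableSpace Ω] {μ : Measure Ω}
    [IsProbabilityMeasure μ] {a : Lattice d} {X : ℕ → Ω → Lattice d} (hd : d ≠ 0)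
    (hX : IsSimpleRandomWalk μ a X) {L R : ℕ} (hL : 8 * d ^ 2 ≤ L) (hL' : 8 * d * 5 ^ d ≤ L)
    (hR : 1 ≤ R) (hexp : Real.exp (-(L : ℝ)) < 1 / (4 * (5 * L ^ 2 * R : ℝ) ^ d))
    (hh : 2 * (L ^ (2 * d + 4)) ^ 2 ≤ L ^ 4 * R ^ 2) {z : Lattice d} (hz : norm1 (z - a) ≤ L * R) :
    (L : ℝ) ^ 3 / R ^ d
      ≤ μ.real {ω | ∃ j < 4 * (L ^ (2 * d + 4)) ^ 2, X (2 * (L ^ 4 * R ^ 2) + j) ω = z} := by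
  set h := L ^ (2 * d + 4) with hhdef
  have hd1 : 1 ≤ d := Nat.one_le_iff_ne_zero.2 hd
  have hL1 : 1 ≤ L := by nlinarith [Nat.one_le_pow 2 d hd1]
  have hh1 : 1 ≤ h := Nat.one_le_pow _ _ hL1
  have h1 := sum_heat_window_ge hd hL hR hexp hh hz
  have h2 := hX.sum_heat_le hd (2 * (L ^ 4 * R ^ 2)) (4 * h ^ 2) z
  have h3 := sum_heat_zero_le hd (4 * h ^ 2)
  have hsq : Real.sqrt ((4 * h ^ 2 : ℕ) : ℝ) = 2 * h := by
    rw [show ((4 * h ^ 2 : ℕ) : ℝ) = (2 * h : ℝ) ^ 2 by push_cast; ring]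
    exact Real.sqrt_sq (by positivity)
  rw [hsq] at h3
  set P := μ.real {ω | ∃ j < 4 * h ^ 2, X (2 * (L ^ 4 * R ^ 2) + j) ω = z}
  have hP : 0 ≤ P := measureReal_nonneg
  -- Expected visits are at most hitting probability times expected returns, and the latter are at
  -- most `d * 2h`. Since the visits grow like `h ^ 2`, a factor `h` survives; `h = L ^ (2d + 4)`
  -- beats the loss `L ^ (2d)` and the constants, leaving `L ^ 3`.
  have h4 : ((2 * h ^ 2 : ℕ) : ℝ) * (1 / (8 * (5 * L ^ 2 * R : ℝ) ^ d)) ≤ P * (d * (2 * h)) :=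
    (h1.trans h2).trans (mul_le_mul_of_nonneg_left h3 hP)
  have hhr : (0 : ℝ) < h := by exact_mod_cast hh1
  have hRr : (0 : ℝ) < (R : ℝ) ^ d := by positivity
  have hLr : (0 : ℝ) < L := by exact_mod_cast hL1
  have h5 : (h : ℝ) / (8 * (5 * L ^ 2 * R : ℝ) ^ d) ≤ P * d := by
    have : ((2 * h ^ 2 : ℕ) : ℝ) * (1 / (8 * (5 * L ^ 2 * R : ℝ) ^ d))
        = (h : ℝ) / (8 * (5 * L ^ 2 * R : ℝ) ^ d) * (2 * h) := by push_cast; ring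
    rw [this, show P * (d * (2 * h : ℝ)) = P * d * (2 * h) by ring] at h4
    exact le_of_mul_le_mul_right h4 (by positivity)
  rw [div_le_iff₀ (by positivity)] at h5
  rw [div_le_iff₀ hRr]
  have h6 : (h : ℝ) = L ^ (2 * d) * L ^ 3 * L := by rw [hhdef]; push_cast; ring
  have h7 : (5 * L ^ 2 * R : ℝ) ^ d = 5 ^ d * L ^ (2 * d) * R ^ d := by
    rw [mul_pow, mul_pow, ← pow_mul]
  rw [h6, h7] at h5
  have h8 : (8 * d * 5 ^ d : ℝ) ≤ L := by exact_mod_cast hL'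
  have h9 : (L : ℝ) ^ (2 * d) * L ^ 3 * L ≤ (L : ℝ) ^ (2 * d) * (P * R ^ d) * L := by
    calc (L : ℝ) ^ (2 * d) * L ^ 3 * L ≤ P * d * (8 * (5 ^ d * L ^ (2 * d) * R ^ d)) := h5
      _ = (L : ℝ) ^ (2 * d) * (P * R ^ d) * (8 * d * 5 ^ d) := by ring
      _ ≤ (L : ℝ) ^ (2 * d) * (P * R ^ d) * L := by gcongr
  exact le_of_mul_le_mul_left (le_of_mul_le_mul_right h9 hLr) (by positivity)

/-! ### Stretched exponential tail of the passage time -/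

/-- The regions which host the successive generations: a punctured ball, `K` disjoint boxes of
side `R`, and the target. -/
noncomputable def regions (i₀ : Fin d) (R K : ℕ) (y : Lattice d) (k : ℕ) : Finset (Lattice d) :=
  if k = 0 then (ball 0 R).erase 0
  else if k ≤ K then
    Fintype.piFinset fun i => if i = i₀ then Finset.Ioc ((k * R : ℕ) : ℤ) ((k * R + R : ℕ) : ℤ)
      else Finset.Ico 0 (R : ℤ)
  else {y}

theorem card_regions (i₀ : Fin d) {R K : ℕ} {y : Lattice d} {k : ℕ} (hk : k + 1 ≤ K) :
    (regions i₀ R K y (k + 1)).card = R ^ d := by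
  rw [regions, if_neg (by omega), if_pos hk, Fintype.card_piFinset]
  have : ∀ i : Fin d, (if i = i₀ then Finset.Ioc (((k + 1) * R : ℕ) : ℤ) (((k + 1) * R + R : ℕ) : ℤ)
      else Finset.Ico 0 (R : ℤ)).card = R := by
    intro i
    split_ifs
    · rw [Int.card_Ioc]; omega
    · simp
  rw [Finset.prod_congr rfl fun i _ => this i]
  simp

theorem norm1_le_of_mem_regions (i₀ : Fin d) {R K : ℕ} {y : Lattice d} (hy : norm1 y ≤ R) (k : ℕ)
    {z : Lattice d} (hz : z ∈ regions i₀ R K y k) : norm1 z ≤ (K + 1 + d) * R := by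
  have hR : R ≤ (K + 1 + d) * R := Nat.le_mul_of_pos_left _ (by omega)
  unfold regions at hz
  split_ifs at hz with h0 h1
  · have := mem_ball.1 (Finset.mem_of_mem_erase hz)
    rw [sub_zero] at this
    omega
  · rw [Fintype.mem_piFinset] at hz
    have hkK : k * R ≤ K * R := Nat.mul_le_mul_right _ h1
    have : ∀ i ∈ Finset.univ, (z i).natAbs ≤ R + if i = i₀ then (K + 1) * R else 0 := by
      intro i _
      have := hz i
      split_ifs at this ⊢ with hi
      · rw [Finset.mem_Ioc] at this
        push_cast at this
        have h2 : ((k * R : ℕ) : ℤ) ≤ (K * R : ℕ) := by exact_mod_cast hkK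
        push_cast at h2
        zify
        rw [abs_of_nonneg (by nlinarith [this.1, Int.natCast_nonneg k, Int.natCast_nonneg R])]
        nlinarith [this.2]
      · rw [Finset.mem_Ico] at this
        omega
    have h3 := Finset.sum_le_sum this
    rw [Finset.sum_add_distrib, Finset.sum_ite_eq', if_pos (Finset.mem_univ _)] at h3
    simp only [Finset.sum_const, Finset.card_univ, Fintype.card_fin, smul_eq_mul] at h3
    unfold norm1
    nlinarith
  · rw [Finset.mem_singleton.1 hz]
    omega

/-- The boxes are separated by the coordinate `i₀`; they are open on the left, so that the first one
misses the ball, where this coordinate is at most `R`. Disjointness supplies each generation with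
fresh walks. -/
theorem disjoint_genSupport_regions (i₀ : Fin d) {R K : ℕ} {y : Lattice d} {k : ℕ} (hk : k ≤ K) :
    Disjoint (genSupport (regions i₀ R K y) k) (regions i₀ R K y k) := by
  rw [Finset.disjoint_left]
  intro z hz hzk
  rcases Nat.eq_zero_or_pos k with rfl | hk0
  · simp only [genSupport, Finset.range_zero, Finset.biUnion_empty, Finset.union_empty,
      Finset.mem_singleton] at hz
    simp [regions, hz] at hzk
  · have h1 : ((k * R : ℕ) : ℤ) < z i₀ := by
      rw [regions, if_neg (by omega), if_pos hk, Fintype.mem_piFinset] at hzk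
      have := hzk i₀
      rw [if_pos rfl, Finset.mem_Ioc] at this
      exact this.1
    have hRk : R ≤ k * R := Nat.le_mul_of_pos_left _ hk0
    simp only [genSupport, Finset.mem_union, Finset.mem_singleton, Finset.mem_biUnion,
      Finset.mem_range] at hz
    rcases hz with rfl | ⟨j, hj, hzj⟩
    · simp at h1; omega
    · rcases Nat.eq_zero_or_pos j with rfl | hj0
      · rw [regions, if_pos rfl] at hzj
        have h2 := mem_ball.1 (Finset.mem_of_mem_erase hzj)
        rw [sub_zero] at h2
        have := natAbs_le_norm1 z i₀
        omega
      · rw [regions, if_neg (by omega), if_pos (by omega), Fintype.mem_piFinset] at hzj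
        have := hzj i₀
        rw [if_pos rfl, Finset.mem_Ioc] at this
        have h2 : j * R + R ≤ k * R := by
          rw [← Nat.succ_mul]; exact Nat.mul_le_mul_right _ hj
        have h3 : ((j * R + R : ℕ) : ℤ) ≤ (k * R : ℕ) := by exact_mod_cast h2
        omega

theorem eventually_pow_lt_exp (p : ℕ) : ∀ᶠ L : ℕ in Filter.atTop, (L : ℝ) ^ p < Real.exp L := by
  have h := (Real.tendsto_pow_mul_exp_neg_atTop_nhds_zero p).comp tendsto_natCast_atTop_atTop
  filter_upwards [h.eventually (gt_mem_nhds (zero_lt_one' ℝ))] with L hL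
  rw [Function.comp_apply, Real.exp_neg, ← div_eq_mul_inv, div_lt_one (Real.exp_pos _)] at hL
  exact hL

/-- The numerical heart of the estimate for the first generation. -/
theorem first_generation_bound (hd : d ≠ 0) {L N : ℕ} (h1 : 4 * d ≤ L) (h2 : 8 * d + 21 ≤ L)
    (hN : N = L ^ (4 * d + 9)) :
    (N + 1 : ℝ) ^ 2 * (1 - 1 / (d * (N + 1 : ℝ) ^ 2)) ^ (L ^ (8 * d + 22)) ≤ Real.exp (-(2 * L)) := by
  have hL1 : 1 ≤ L := by omega
  have hN1 : 1 ≤ N := hN ▸ Nat.one_le_pow _ _ hL1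
  have hNr : (1 : ℝ) ≤ N := by exact_mod_cast hN1
  have hLr : (1 : ℝ) ≤ L := by exact_mod_cast hL1
  have hdr : (1 : ℝ) ≤ d := by exact_mod_cast Nat.one_le_iff_ne_zero.2 hd
  have hbase : (N + 1 : ℝ) ^ 2 ≤ 4 * (N : ℝ) ^ 2 := by nlinarith
  set t : ℝ := 1 / (d * (N + 1 : ℝ) ^ 2) with ht
  have hB1 : (1 : ℝ) ≤ d * (N + 1 : ℝ) ^ 2 := by nlinarith
  have ht1 : t ≤ 1 := by rw [ht, div_le_one (by positivity)]; exact hB1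
  have hpow : (1 - t) ^ (L ^ (8 * d + 22)) ≤ Real.exp (-((L ^ (8 * d + 22) : ℕ) * t)) := by
    have := Real.one_sub_le_exp_neg t
    calc (1 - t) ^ (L ^ (8 * d + 22)) ≤ Real.exp (-t) ^ (L ^ (8 * d + 22)) :=
          pow_le_pow_left₀ (by linarith) this _
      _ = _ := by rw [← Real.exp_nat_mul]; congr 1; ring
  -- `N ^ 2` uses `8d + 18` of the `8d + 22` powers of `L`; one of the four that remain absorbs `4 *
  -- d`.
  have hexp : (L : ℝ) ^ 3 ≤ (L ^ (8 * d + 22) : ℕ) * t := by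
    rw [ht, mul_one_div, le_div_iff₀ (by positivity)]
    have h4 : (4 * d : ℝ) ≤ L := by exact_mod_cast h1
    calc (L : ℝ) ^ 3 * (d * (N + 1 : ℝ) ^ 2) ≤ (L : ℝ) ^ 3 * (d * (4 * (N : ℝ) ^ 2)) := by gcongr
      _ = (L : ℝ) ^ 3 * (4 * d) * (N : ℝ) ^ 2 := by ring
      _ ≤ (L : ℝ) ^ 3 * L * (N : ℝ) ^ 2 := by gcongr
      _ = (L ^ (8 * d + 22) : ℕ) := by rw [hN]; push_cast; ring
  have hpoly : (N + 1 : ℝ) ^ 2 ≤ Real.exp ((8 * d + 19 : ℕ) * L) := by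
    have h4 : (4 : ℝ) ≤ L := by exact_mod_cast (by omega : 4 ≤ L)
    calc (N + 1 : ℝ) ^ 2 ≤ 4 * (N : ℝ) ^ 2 := hbase
      _ ≤ L * (N : ℝ) ^ 2 := by gcongr
      _ = (L : ℝ) ^ (8 * d + 19) := by rw [hN]; push_cast; ring
      _ ≤ Real.exp L ^ (8 * d + 19) := by
        gcongr; linarith [Real.add_one_le_exp (L : ℝ)]
      _ = _ := by rw [← Real.exp_nat_mul]
  calc (N + 1 : ℝ) ^ 2 * (1 - t) ^ (L ^ (8 * d + 22))
      ≤ Real.exp ((8 * d + 19 : ℕ) * L) * Real.exp (-((L ^ (8 * d + 22) : ℕ) * t)) := by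
        refine mul_le_mul hpoly hpow (pow_nonneg (by linarith) _) (Real.exp_nonneg _)
    _ ≤ Real.exp ((8 * d + 19 : ℕ) * L) * Real.exp (-(L : ℝ) ^ 3) := by
        gcongr
    _ ≤ Real.exp (-(2 * L)) := by
        rw [← Real.exp_add, Real.exp_le_exp]
        have h5 : ((8 * d + 21 : ℕ) : ℝ) ≤ L := by exact_mod_cast h2
        push_cast at h5 ⊢
        nlinarith [mul_le_mul_of_nonneg_right h5 (by positivity : (0 : ℝ) ≤ L),
          mul_le_mul_of_nonneg_right hLr (by positivity : (0 : ℝ) ≤ (L : ℝ) ^ 2)]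

set_option maxHeartbeats 1000000 in
/-- The passage time from `0` to a point at distance at most `L` has stretched exponential tails,
even if only the walks started in a ball of polynomial radius move. -/
theorem exists_passageTime_tail (hd : d ≠ 0) : ∃ g L₀ : ℕ, ∀ L, L₀ ≤ L →
    ∀ (Ω : Type u) [MeasurableSpace Ω] (μ : Measure Ω) [IsProbabilityMeasure μ]
      (S : Lattice d → ℕ → Ω → Lattice d), IsFrogFamily μ S → ∀ y : Lattice d, norm1 y ≤ L →
      ∀ (B : Set (Lattice d)) [DecidablePred (· ∈ B)], (∀ z, norm1 z ≤ L ^ g → z ∈ B) →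
        μ.real {ω | ¬ passageTime (mask B (config S ω)) 0 y ≤ (L ^ g : ℕ)} ≤ Real.exp (-L) := by
  set a := 8 * d + 22 with ha
  have hd1 : 1 ≤ d := Nat.one_le_iff_ne_zero.2 hd
  -- The number of generations after which sizes growing by a factor `L` from `L ^ (4d + 9)` reach
  -- `R ^ d / L`, where `R = L ^ a`.
  obtain ⟨K, hK⟩ : ∃ K, K + 4 * d + 10 = a * d := by
    refine ⟨a * d - (4 * d + 10), ?_⟩
    have : 4 * d + 10 ≤ a * d := by rw [ha]; nlinarith
    omega
  obtain ⟨L₁, hL₁⟩ := Filter.eventually_atTop.1 (eventually_pow_lt_exp ((a + 3) * d + 1))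
  refine ⟨5 + 2 * a, L₁ + 8 * d ^ 2 + 8 * d * 5 ^ d + 8 * d + 4 * K + 100, ?_⟩
  intro L hL Ω _ μ _ S hS y hy B _ hB
  have hd2 : d ≤ d ^ 2 := by nlinarith
  have hLL₁ : L₁ ≤ L := by omega
  have hL8 : 8 * d ^ 2 ≤ L := by omega
  have hL5 : 8 * d * 5 ^ d ≤ L := by omega
  have hLK : 4 * K + 100 ≤ L := by omega
  have hLd : 8 * d + 100 ≤ L := by omega
  have hLK' : 2 * (K + 1 + d) ≤ L := by omega
  clear hL hd2
  have hL1 : 1 ≤ L := by omega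
  have hLr : (100 : ℝ) ≤ L := by exact_mod_cast (by omega : 100 ≤ L)
  set R := L ^ a with hR
  set h := L ^ (2 * d + 4) with hh
  set n := 2 * (L ^ 4 * R ^ 2) with hn
  set M := 4 * h ^ 2 with hM
  have hR1 : 1 ≤ R := Nat.one_le_pow _ _ hL1
  have hLR : L ≤ R := by rw [hR]; exact Nat.le_self_pow (by omega) L
  have hM1 : 1 ≤ M := by have := Nat.one_le_pow (2 * d + 4) L hL1; rw [hM, hh]; nlinarith [Nat.one_le_pow 2 _ this]
  have hexp : Real.exp (-(L : ℝ)) < 1 / (4 * (5 * L ^ 2 * R : ℝ) ^ d) := by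
    rw [Real.exp_neg, ← one_div]
    refine one_div_lt_one_div_of_lt (by positivity) (lt_of_le_of_lt ?_ (hL₁ L hLL₁))
    have h5 : (5 : ℝ) ≤ L := by linarith
    calc (4 * (5 * L ^ 2 * R : ℝ) ^ d) ≤ L * (L * L ^ 2 * R : ℝ) ^ d := by gcongr; linarith
      _ = (L : ℝ) ^ ((a + 3) * d + 1) := by rw [hR]; push_cast; ring
  have h2h : 2 * h ^ 2 ≤ L ^ 4 * R ^ 2 := by
    calc 2 * h ^ 2 ≤ L * h ^ 2 := by gcongr; omega
      _ = L ^ (4 * d + 9) := by rw [hh]; ring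
      _ ≤ L ^ (4 + a * 2) := Nat.pow_le_pow_right hL1 (by omega)
      _ = L ^ 4 * R ^ 2 := by rw [hR]; ring
  have hMn : M ≤ n := by omega
  set i₀ : Fin d := ⟨0, hd1⟩
  set D := regions i₀ R K y with hD
  set q : ℝ := (L : ℝ) ^ 3 / R ^ d with hq
  have hRr : (0 : ℝ) < R := by exact_mod_cast hR1
  have hq0 : 0 ≤ q := by positivity
  have hnorm : ∀ k, ∀ z ∈ D k, norm1 z ≤ (K + 1 + d) * R := fun k z hz =>
    norm1_le_of_mem_regions i₀ (hy.trans hLR) k hz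
  have hhit : ∀ k, ∀ x ∈ D k, ∀ z ∈ D (k + 1), q ≤ μ.real {ω | ∃ j < M, S x (n + j) ω = z} := by
    intro k x hx z hz
    refine (hS.walk x).measureReal_window_ge hd hL8 hL5 hR1 hexp h2h ?_
    have h1 := norm1_add_le z (-x)
    rw [norm1_neg, ← sub_eq_add_neg] at h1
    have h2 := hnorm _ z hz
    have h3 := hnorm _ x hx
    calc norm1 (z - x) ≤ 2 * (K + 1 + d) * R := by linarith
      _ ≤ L * R := by gcongr
  set G : ℕ → Ω → Finset (Lattice d) := fun k ω => gen (R + 1) n M D (config S ω) k with hG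
  -- The starting exponent makes `N 0` at least `M = 4 * L ^ (4d + 8)`, so that `N k / M ≥ 1` in the
  -- exponents below.
  set N : ℕ → ℕ := fun k => L ^ (4 * d + 9 + k) with hN
  have hNM : ∀ k, M ≤ N k := fun k => by
    calc M = 4 * h ^ 2 := rfl
      _ ≤ L * h ^ 2 := by gcongr; omega
      _ = L ^ (4 * d + 9) := by rw [hh]; ring
      _ ≤ N k := Nat.pow_le_pow_right hL1 (by omega)
  have hNR : N K * L = R ^ d := by
    rw [hN, hR, ← pow_mul, ← hK, ← pow_succ]
    congr 1
    omega
  have hNmono : ∀ k ≤ K, N k ≤ N K := fun k hk => Nat.pow_le_pow_right hL1 (by omega)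
  have hMr : (0 : ℝ) < M := by exact_mod_cast hM1
  have hqR : q * (R : ℝ) ^ d = (L : ℝ) ^ 3 := by rw [hq]; field_simp
  have hE0 : μ.real {ω | (G 0 ω).card < N 0} ≤ Real.exp (-(2 * L)) := by
    refine (hS.measureReal_gen_zero_lt hd (D := D) (r := R) (K := N 0) fun z hz0 hz => ?_).trans
      (first_generation_bound hd (by omega) (by omega) rfl)
    simp only [hD, regions, if_true]
    exact Finset.mem_erase.2 ⟨hz0, mem_ball.2 (by rwa [sub_zero])⟩
  have hEk : ∀ k < K, μ.real {ω | (N k : ℝ) ≤ ((G k ω).card : ℝ) ∧ ((G (k + 1) ω).card : ℝ) < N (k + 1)}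
      ≤ Real.exp (-(2 * L)) := by
    intro k hk
    have hcard : (D (k + 1)).card = R ^ d := card_regions i₀ (by omega)
    refine (hS.measureReal_gen_succ_lt (D := D) hM1 (disjoint_genSupport_regions i₀ hk.le)
      (fun w x => card_visits_le n M _ w x) hq0 (hhit k) ?_).trans ?_
    · rw [hcard]
      have h1 := hNmono (k + 1) hk
      have h2 : 2 * N (k + 1) ≤ R ^ d := by nlinarith
      exact_mod_cast h2
    · rw [hcard, Real.exp_le_exp]
      push_cast
      rw [hqR]
      have h1 : (N (k + 1) : ℝ) = N k * L := by rw [hN]; push_cast; ring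
      have h2 : (1 : ℝ) ≤ N k / M := by rw [one_le_div hMr]; exact_mod_cast hNM k
      have h3 : (N (k + 1) : ℝ) / M - N k * (L ^ 3 / (4 * M)) = (N k / M) * (L - L ^ 3 / 4) := by
        rw [h1]; field_simp
      rw [h3]
      -- Growth by `L` is demanded while the mean supports growth of order `L ^ 3`; the difference
      -- is the whole gain.
      have h4 : (L : ℝ) - L ^ 3 / 4 ≤ -(2 * L) := by nlinarith [mul_le_mul hLr hLr (by norm_num) (by linarith)]
      nlinarith
  -- The last region is the single point `y`: hence `b = 1`, and fewer than `1 / 2` points means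
  -- none.
  have hEK : μ.real {ω | (N K : ℝ) ≤ ((G K ω).card : ℝ) ∧ ((G (K + 1) ω).card : ℝ) < 1 / 2}
      ≤ Real.exp (-(2 * L)) := by
    have hDK : D (K + 1) = {y} := by
      simp [hD, regions]
    refine (hS.measureReal_gen_succ_lt (D := D) le_rfl (disjoint_genSupport_regions i₀ le_rfl)
      (fun w x => ?_) hq0 (hhit K) ?_).trans ?_
    · refine (Finset.card_le_card (visits_subset _ _ _ _ _)).trans ?_
      rw [hDK, Finset.card_singleton]
    · rw [hDK]; norm_num
    · rw [hDK, Finset.card_singleton, Real.exp_le_exp]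
      have h1 : (N K : ℝ) * q = L ^ 2 := by
        have : (N K : ℝ) * L = R ^ d := by exact_mod_cast hNR
        rw [hq, ← this]
        have : (N K : ℝ) ≠ 0 := by
          have := hNM K
          exact_mod_cast (by omega : N K ≠ 0)
        field_simp
      have h2 : (N K : ℝ) * (q * ((1 : ℕ) : ℝ) / (4 * ((1 : ℕ) : ℝ))) = L ^ 2 / 4 := by
        rw [← h1]; push_cast; ring
      rw [h2]
      push_cast
      nlinarith
  have hsub : {ω | ¬ passageTime (mask B (config S ω)) 0 y ≤ (L ^ (5 + 2 * a) : ℕ)}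
      ⊆ {ω | (G 0 ω).card < N 0}
        ∪ ((⋃ k ∈ Finset.range K, {ω | (N k : ℝ) ≤ ((G k ω).card : ℝ) ∧ ((G (k + 1) ω).card : ℝ) < N (k + 1)})
          ∪ {ω | (N K : ℝ) ≤ ((G K ω).card : ℝ) ∧ ((G (K + 1) ω).card : ℝ) < 1 / 2}) := by
    intro ω hω
    by_contra hout
    simp only [Set.mem_union, Set.mem_iUnion, Finset.mem_range, not_or, not_exists] at hout
    obtain ⟨h0, hk, hf⟩ := hout
    have hbig : ∀ k ≤ K, (N k : ℝ) ≤ ((G k ω).card : ℝ) := by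
      intro k hkK
      induction k with
      | zero => exact_mod_cast not_lt.1 h0
      | succ k ih =>
        by_contra hlt
        exact hk k (by omega) ⟨ih (by omega), not_le.1 hlt⟩
    have hne : (G (K + 1) ω).Nonempty := by
      rw [← Finset.card_pos]
      by_contra hz
      refine hf ⟨hbig K le_rfl, ?_⟩
      have : (G (K + 1) ω).card = 0 := by omega
      rw [this]; norm_num
    obtain ⟨z, hz⟩ := hne
    have hzy : z = y := by
      have := gen_subset _ _ _ _ _ _ hz
      simpa [hD, regions] using this
    have hpow : (K + 1 + d) * R ≤ L ^ (5 + 2 * a) := by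
      calc (K + 1 + d) * R ≤ L * R := by gcongr; omega
        _ = L ^ (a + 1) := by rw [hR]; ring
        _ ≤ _ := Nat.pow_le_pow_right hL1 (by omega)
    have hT := passageTime_le_of_mem_gen (B := B) (K := K + 1) (hB 0 (by simp [norm1_zero]))
      (fun k _ z hz => hB z ((hnorm k z hz).trans hpow)) (config S ω) le_rfl hz
    refine hω ?_
    rw [← hzy]
    refine hT.trans ?_
    have hX : R ≤ L ^ 4 * R ^ 2 := by
      calc R = 1 * R := (one_mul R).symm
        _ ≤ (L ^ 4 * R) * R := by
          gcongr; exact Nat.one_le_iff_ne_zero.2 (by positivity)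
        _ = _ := by ring
    -- The `K + 1` windows last at most `4 * (L ^ 4 * R ^ 2)` each; one more factor `L` absorbs the
    -- constants, whence the exponent `5 + 2 * a`.
    have : R + 1 + (K + 1) * (n + M) ≤ L ^ (5 + 2 * a) := by
      calc R + 1 + (K + 1) * (n + M) ≤ 2 * (L ^ 4 * R ^ 2) + (K + 1) * (4 * (L ^ 4 * R ^ 2)) := by
            have : n + M ≤ 4 * (L ^ 4 * R ^ 2) := by omega
            have := Nat.mul_le_mul_left (K + 1) this
            omega
        _ = (4 * K + 6) * (L ^ 4 * R ^ 2) := by ring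
        _ ≤ L * (L ^ 4 * R ^ 2) := by gcongr; omega
        _ = _ := by rw [hR]; ring
    exact_mod_cast this
  have hfin : μ.real {ω | ¬ passageTime (mask B (config S ω)) 0 y ≤ (L ^ (5 + 2 * a) : ℕ)}
      ≤ Real.exp (-(2 * L)) + (∑ k ∈ Finset.range K, Real.exp (-(2 * (L : ℝ))) + Real.exp (-(2 * L))) := by
    refine (measureReal_mono hsub (measure_ne_top _ _)).trans ?_
    refine (measureReal_union_le _ _).trans (add_le_add hE0 ?_)
    refine (measureReal_union_le _ _).trans (add_le_add ?_ hEK)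
    exact (measureReal_biUnion_finset_le _ _).trans
      (Finset.sum_le_sum fun k hk => hEk k (Finset.mem_range.1 hk))
  refine hfin.trans ?_
  rw [Finset.sum_const, Finset.card_range, nsmul_eq_mul]
  have h2 : Real.exp (-(2 * (L : ℝ))) = Real.exp (-L) * Real.exp (-L) := by
    rw [← Real.exp_add]; congr 1; ring
  have h3 : (K + 2 : ℝ) * Real.exp (-L) ≤ 1 := by
    rw [Real.exp_neg, ← div_eq_mul_inv, div_le_one (Real.exp_pos _)]
    have : (K + 2 : ℝ) ≤ L := by exact_mod_cast (by omega : K + 2 ≤ L)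
    linarith [Real.add_one_le_exp (L : ℝ)]
  rw [h2]
  nlinarith [Real.exp_pos (-(L : ℝ))]

/-! ### Local passage times and linear growth -/

section

variable {Ω : Type*} [MeasurableSpace Ω] {μ : Measure Ω} {S : Lattice d → ℕ → Ω → Lattice d}

theorem IsFrogFamily.translate (h : IsFrogFamily μ S) (v : Lattice d) :
    IsFrogFamily μ (fun x n ω => S (x + v) n ω - v) where
  walk x :=
    { measurable := fun n => ((h.walk (x + v)).measurable n).sub_const v
      start := fun ω => by rw [(h.walk (x + v)).start]; simp
      indep_steps := by simpa using (h.walk (x + v)).indep_steps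
      step_law := fun n e he => by simpa using (h.walk (x + v)).step_law n e he }
  indep := by
    have h1 := h.indep.precomp (g := fun x => x + v) (add_left_injective v)
    exact h1.comp (fun _ p n => p n - v) fun _ => measurable_pi_lambda _ fun n =>
      (Measurable.of_discrete (f := fun z : Lattice d => z - v)).comp
        (measurable_pi_apply (X := fun _ : ℕ => Lattice d) n)

theorem mask_translate (A : Set (Lattice d)) [DecidablePred (· ∈ A)] (v : Lattice d)
    (w : Lattice d → ℕ → Lattice d) :
    (fun z j => mask A w (z + v) j - v)
      = @mask d {z | z + v ∈ A} (fun z => inferInstanceAs (Decidable (z + v ∈ A)))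
        (fun z j => w (z + v) j - v) := by
  funext z j
  by_cases hz : z + v ∈ A
  · have : z ∈ {z | z + v ∈ A} := hz
    simp only [mask, if_pos hz, if_pos this]
  · have : z ∉ {z | z + v ∈ A} := hz
    simp only [mask, if_neg hz, if_neg this, add_sub_cancel_right]

/-- The passage time between two points, truncated at level `t`, when only the walks started in
`A` move. -/
noncomputable def localTime (A : Set (Lattice d)) [DecidablePred (· ∈ A)] (t : ℕ) (x y : Lattice d)
    (w : Lattice d → ℕ → Lattice d) : ℕ :=
  (min (passageTime (mask A w) x y) t).toNat

theorem coe_localTime (A : Set (Lattice d)) [DecidablePred (· ∈ A)] (t : ℕ) (x y : Lattice d)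
    (w : Lattice d → ℕ → Lattice d) :
    (localTime A t x y w : ℕ∞) = min (passageTime (mask A w) x y) t :=
  ENat.natCast_toNat (ne_top_of_le_ne_top (ENat.natCast_ne_top t) (min_le_right _ _))

theorem localTime_le (A : Set (Lattice d)) [DecidablePred (· ∈ A)] (t : ℕ) (x y : Lattice d)
    (w : Lattice d → ℕ → Lattice d) : localTime A t x y w ≤ t := by
  have := (coe_localTime A t x y w).le.trans (min_le_right _ _)
  exact_mod_cast this

theorem localTime_le_of_passageTime_le {A : Set (Lattice d)} [DecidablePred (· ∈ A)] {t : ℕ}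
    {x y : Lattice d} {w : Lattice d → ℕ → Lattice d} {s : ℕ}
    (h : passageTime (mask A w) x y ≤ s) : localTime A t x y w ≤ s := by
  have := (coe_localTime A t x y w).le.trans ((min_le_left _ _).trans h)
  exact_mod_cast this

theorem passageTime_le_localTime {A : Set (Lattice d)} [DecidablePred (· ∈ A)] {t : ℕ}
    {x y : Lattice d} {w : Lattice d → ℕ → Lattice d}
    (h : passageTime (mask A w) x y ≤ t) :
    passageTime (mask A w) x y ≤ (localTime A t x y w : ℕ) := by
  rw [coe_localTime, min_eq_left h]

theorem measurable_mask (A : Set (Lattice d)) [DecidablePred (· ∈ A)] :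
    Measurable (mask A : (Lattice d → ℕ → Lattice d) → _) := by
  refine measurable_pi_lambda _ fun x => measurable_pi_lambda _ fun j => ?_
  by_cases hx : x ∈ A
  · simp only [mask, if_pos hx]
    exact (measurable_pi_apply j).comp (measurable_pi_apply x)
  · simp only [mask, if_neg hx]
    exact measurable_const

theorem measurable_localTime (A : Set (Lattice d)) [DecidablePred (· ∈ A)] (t : ℕ)
    (x y : Lattice d) : Measurable (localTime A t x y) := by
  refine measurable_of_Iic fun s => ?_
  have : localTime A t x y ⁻¹' Set.Iic s
      = {w | passageTime (mask A w) x y ≤ s} ∪ {_w | t ≤ s} := by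
    ext w
    have h : localTime A t x y w ≤ s ↔ min (passageTime (mask A w) x y) t ≤ s := by
      rw [← coe_localTime]; norm_cast
    simp only [Set.mem_preimage, Set.mem_Iic, h, min_le_iff, Set.mem_union, Set.mem_ofPred_eq]
    norm_cast
  rw [this]
  exact (measurable_mask A (measurableSet_passageTime_le x y s)).union (MeasurableSet.const _)

theorem dependsOn_localTime (A : Set (Lattice d)) [DecidablePred (· ∈ A)] (t : ℕ)
    (x y : Lattice d) : DependsOn (localTime A t x y) A := by
  intro w w' hw
  have : mask A w = mask A w' := by
    funext z j
    by_cases hz : z ∈ A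
    · simp only [mask, if_pos hz, hw z hz]
    · simp only [mask, if_neg hz]
  simp only [localTime, this]

/-- Functions of disjoint groups of walks factorize. -/
theorem IsFrogFamily.integral_prod_of_dependsOn (h : IsFrogFamily μ S) {ι : Type*}
    (J : Finset ι) (A : ι → Finset (Lattice d))
    (hA : (J : Set ι).PairwiseDisjoint A) (f : ι → (Lattice d → ℕ → Lattice d) → ℝ)
    (hf : ∀ i, Measurable (f i)) (hfA : ∀ i, DependsOn (f i) (A i : Set (Lattice d))) :
    ∫ ω, ∏ i ∈ J, f i (config S ω) ∂μ = ∏ i ∈ J, ∫ ω, f i (config S ω) ∂μ := by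
  classical
  have : IsProbabilityMeasure μ := h.indep.isProbabilityMeasure
  induction J using Finset.induction_on with
  | empty => simp
  | insert j J hj ih =>
    specialize ih (hA.subset (by simp))
    simp only [Finset.prod_insert hj]
    rw [← ih]
    have hdisj : Disjoint (A j) (J.biUnion A) := by
      rw [Finset.disjoint_biUnion_right]
      intro i hi
      exact hA (by simp) (by simp [hi]) fun hij => hj (hij ▸ hi)
    have hm : Measurable fun w : Lattice d → ℕ → Lattice d => ∏ i ∈ J, f i w :=
      Finset.measurable_fun_prod J fun i _ => hf i
    have hind := h.indepFun_of_dependsOn hdisj (hf j) hm (hfA j) (fun w w' hw => by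
      refine Finset.prod_congr rfl fun i hi => hfA i fun x hx => hw x ?_
      rw [Finset.coe_biUnion]
      exact Set.mem_biUnion hi hx)
    exact hind.integral_fun_comp_mul_comp (f := id) (g := id)
      ((hf j).comp h.measurable_config).aemeasurable (hm.comp h.measurable_config).aemeasurable
      measurable_id.aestronglyMeasurable measurable_id.aestronglyMeasurable

/-- A layer-cake bound over the levels `l ^ g`, cut off at `m` so that only the levels on which the
tail is controlled enter. -/
theorem min_localTime_le {A : Set (Lattice d)} [DecidablePred (· ∈ A)] {t g L₀ : ℕ}
    {x y : Lattice d} {w : Lattice d → ℕ → Lattice d} {m : ℕ} (hm : L₀ ≤ m) :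
    (min (localTime A t x y w) (m ^ g) : ℝ) ≤ (L₀ : ℝ) ^ g + ∑ l ∈ Finset.Ico L₀ m,
      ((l + 1 : ℝ) ^ g * Set.indicator {w | ¬ passageTime (mask A w) x y ≤ (l ^ g : ℕ)}
        (fun _ => (1 : ℝ)) w) := by
  induction m, hm using Nat.le_induction with
  | base => simp
  | succ m hm ih =>
    rw [Finset.sum_Ico_succ_top hm, ← add_assoc]
    by_cases hT : passageTime (mask A w) x y ≤ (m ^ g : ℕ)
    · have h1 : localTime A t x y w ≤ m ^ g := localTime_le_of_passageTime_le hT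
      have h2 : (localTime A t x y w : ℝ) ≤ (m : ℝ) ^ g := by exact_mod_cast h1
      rw [min_eq_left h2] at ih
      refine (min_le_left _ _).trans (ih.trans (le_add_of_nonneg_right ?_))
      exact mul_nonneg (by positivity) (Set.indicator_nonneg (fun _ _ => zero_le_one) _)
    · rw [Set.indicator_of_mem (show w ∈ {w | ¬ passageTime (mask A w) x y ≤ (m ^ g : ℕ)} from hT),
        mul_one]
      refine (min_le_right _ _).trans ?_
      push_cast
      refine le_add_of_nonneg_left (add_nonneg (by positivity) (Finset.sum_nonneg fun l _ => ?_))
      exact mul_nonneg (by positivity) (Set.indicator_nonneg (fun _ _ => zero_le_one) _)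

variable [IsProbabilityMeasure μ]

/-- The tail at the levels `l ^ g` is summable against their size, so the mean of the truncated time
is bounded uniformly in `L`. -/
theorem IsFrogFamily.integral_localTime_le (h : IsFrogFamily μ S) {A : Set (Lattice d)}
    [DecidablePred (· ∈ A)] {g L₀ L : ℕ} (hL : L₀ ≤ L) {x y : Lattice d}
    (htail : ∀ l, L₀ ≤ l → l ≤ L →
      μ.real {ω | ¬ passageTime (mask A (config S ω)) x y ≤ (l ^ g : ℕ)} ≤ Real.exp (-l)) :
    ∫ ω, (localTime A (L ^ g) x y (config S ω) : ℝ) ∂μ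
      ≤ (L₀ : ℝ) ^ g + ∑' l : ℕ, (l + 1 : ℝ) ^ g * Real.exp (-l) := by
  have hsum : Summable fun l : ℕ => (l + 1 : ℝ) ^ g * Real.exp (-l) := by
    have h1 := (summable_nat_add_iff 1).2 (Real.summable_pow_mul_exp_neg_nat_mul g zero_lt_one)
    refine (h1.mul_left (Real.exp 1)).congr fun l => ?_
    rw [mul_left_comm, ← Real.exp_add]
    push_cast
    congr 2; ring
  have hmeas : ∀ l : ℕ, MeasurableSet {ω | ¬ passageTime (mask A (config S ω)) x y ≤ (l ^ g : ℕ)} :=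
    fun l => (((measurable_mask A).comp h.measurable_config)
      (measurableSet_passageTime_le x y (l ^ g))).compl
  have hint : ∀ l : ℕ, Integrable (fun ω => (l + 1 : ℝ) ^ g
      * Set.indicator {ω | ¬ passageTime (mask A (config S ω)) x y ≤ (l ^ g : ℕ)}
        (fun _ => (1 : ℝ)) ω) μ := fun l =>
    ((integrable_const (1 : ℝ)).indicator (hmeas l)).const_mul _
  calc ∫ ω, (localTime A (L ^ g) x y (config S ω) : ℝ) ∂μ
      ≤ ∫ ω, ((L₀ : ℝ) ^ g + ∑ l ∈ Finset.Ico L₀ L, ((l + 1 : ℝ) ^ g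
          * Set.indicator {ω | ¬ passageTime (mask A (config S ω)) x y ≤ (l ^ g : ℕ)}
            (fun _ => (1 : ℝ)) ω)) ∂μ := by
        refine integral_mono (integrable_of_bounded (C := (L ^ g : ℕ)) ?_ fun ω => ?_)
          ((integrable_const _).add (integrable_finsetSum _ fun l _ => hint l)) fun ω => ?_
        · exact (Measurable.of_discrete (f := fun k : ℕ => (k : ℝ))).comp
            ((measurable_localTime A (L ^ g) x y).comp h.measurable_config)
        · rw [abs_of_nonneg (by positivity)]
          exact_mod_cast localTime_le _ _ _ _ _
        · have h1 := min_localTime_le (A := A) (t := L ^ g) (g := g) (x := x) (y := y)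
            (w := config S ω) hL
          have h2 : (localTime A (L ^ g) x y (config S ω) : ℝ) ≤ (L : ℝ) ^ g := by
            exact_mod_cast localTime_le A (L ^ g) x y (config S ω)
          rw [min_eq_left h2] at h1
          exact h1
    _ = (L₀ : ℝ) ^ g + ∑ l ∈ Finset.Ico L₀ L, ((l + 1 : ℝ) ^ g
          * μ.real {ω | ¬ passageTime (mask A (config S ω)) x y ≤ (l ^ g : ℕ)}) := by
        rw [integral_add (integrable_const _) (integrable_finsetSum _ fun l _ => hint l),
          integral_finsetSum _ fun l _ => hint l]
        simp only [integral_const_mul]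
        congr 1
        · simp
        · refine Finset.sum_congr rfl fun l _ => ?_
          congr 1
          exact integral_indicator_one (hmeas l)
    _ ≤ (L₀ : ℝ) ^ g + ∑ l ∈ Finset.Ico L₀ L, (l + 1 : ℝ) ^ g * Real.exp (-l) := by
        gcongr with l hl
        rw [Finset.mem_Ico] at hl
        exact htail l hl.1 hl.2.le
    _ ≤ _ := by
        gcongr
        exact hsum.sum_le_tsum _ fun l _ => by positivity

/-- Chernoff's bound for a sum of truncated passage times in disjoint regions. -/
theorem IsFrogFamily.measureReal_sum_localTime_ge (h : IsFrogFamily μ S) {ι : Type*}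
    (J : Finset ι) (A : ι → Finset (Lattice d)) [∀ i, DecidablePred (· ∈ (A i : Set (Lattice d)))]
    (hA : (J : Set ι).PairwiseDisjoint A) {t : ℕ} (ht : 1 ≤ t) (x y : ι → Lattice d) {m L : ℝ}
    (hm : ∀ i ∈ J, ∫ ω, (localTime (A i : Set (Lattice d)) t (x i) (y i) (config S ω) : ℝ) ∂μ ≤ m) :
    μ.real {ω | 2 * m * J.card + t * L
        ≤ ∑ i ∈ J, (localTime (A i : Set (Lattice d)) t (x i) (y i) (config S ω) : ℝ)}
      ≤ Real.exp (-L) := by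
  have htr : (0 : ℝ) < t := by exact_mod_cast ht
  set W : ι → (Lattice d → ℕ → Lattice d) → ℝ := fun i w =>
    (localTime (A i : Set (Lattice d)) t (x i) (y i) w : ℝ) with hW
  have hWm : ∀ i, Measurable (W i) := fun i =>
    (Measurable.of_discrete (f := fun k : ℕ => (k : ℝ))).comp (measurable_localTime _ _ _ _)
  have hW0 : ∀ i w, 0 ≤ W i w := fun i w => Nat.cast_nonneg _
  have hWt : ∀ i w, W i w ≤ t := fun i w => by
    simp only [hW]; exact_mod_cast localTime_le _ _ _ _ _
  have hsm : Measurable fun ω => ∑ i ∈ J, W i (config S ω) :=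
    Finset.measurable_fun_sum J fun i _ => (hWm i).comp h.measurable_config
  have hint : Integrable (fun ω => Real.exp ((t : ℝ)⁻¹ * ∑ i ∈ J, W i (config S ω))) μ := by
    refine integrable_of_bounded (C := Real.exp ((t : ℝ)⁻¹ * ∑ i ∈ J, (t : ℝ)))
      (hsm.const_mul _).exp fun ω => ?_
    rw [abs_of_nonneg (Real.exp_nonneg _), Real.exp_le_exp]
    gcongr
    exact hWt _ _
  -- With parameter `1 / t` the scaled variables lie in `[0, 1]`, where `exp u ≤ 1 + 2 * u`. The
  -- product of the moment generating functions then cancels the term `2 * m * J.card` and leaves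
  -- `exp (-L)`.
  have h1 := measure_ge_le_exp_mul_mgf (μ := μ) (X := fun ω => ∑ i ∈ J, W i (config S ω))
    (2 * m * J.card + t * L) (inv_nonneg.2 htr.le) hint
  refine h1.trans ?_
  have hmgf : mgf (fun ω => ∑ i ∈ J, W i (config S ω)) μ (t : ℝ)⁻¹ ≤ Real.exp (2 * m / t) ^ J.card := by
    unfold mgf
    simp only [Finset.mul_sum, Real.exp_sum]
    rw [h.integral_prod_of_dependsOn J A hA (fun i w => Real.exp ((t : ℝ)⁻¹ * W i w))
      (fun i => ((hWm i).const_mul _).exp) fun i w w' hw => by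
        simp only [hW, dependsOn_localTime (A i : Set (Lattice d)) t (x i) (y i) hw]]
    refine (Finset.prod_le_prod (g := fun _ => Real.exp (2 * m / t))
      (fun i _ => integral_nonneg fun ω => Real.exp_nonneg _) fun i hi => ?_).trans (by simp)
    have hWint : Integrable (fun ω => W i (config S ω)) μ :=
      integrable_of_bounded (C := t) ((hWm i).comp h.measurable_config) fun ω => by
        rw [abs_of_nonneg (hW0 _ _)]; exact hWt _ _
    calc ∫ ω, Real.exp ((t : ℝ)⁻¹ * W i (config S ω)) ∂μ
        ≤ ∫ ω, (1 + 2 * ((t : ℝ)⁻¹ * W i (config S ω))) ∂μ := by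
          refine integral_mono (integrable_of_bounded (C := Real.exp ((t : ℝ)⁻¹ * t))
            (((hWm i).comp h.measurable_config).const_mul _).exp fun ω => ?_)
            ((integrable_const _).add ((hWint.const_mul _).const_mul _)) fun ω => ?_
          · rw [abs_of_nonneg (Real.exp_nonneg _), Real.exp_le_exp]
            gcongr
            exact hWt _ _
          · have hu0 : 0 ≤ (t : ℝ)⁻¹ * W i (config S ω) := mul_nonneg (inv_nonneg.2 htr.le) (hW0 _ _)
            have hu1 : (t : ℝ)⁻¹ * W i (config S ω) ≤ 1 := by
              rw [inv_mul_le_iff₀ htr, mul_one]; exact hWt _ _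
            have := (abs_le.1 (Real.abs_exp_sub_one_sub_id_le
              (x := (t : ℝ)⁻¹ * W i (config S ω)) (by rwa [abs_of_nonneg hu0]))).2
            simp only
            nlinarith
      _ = 1 + 2 * ((t : ℝ)⁻¹ * ∫ ω, W i (config S ω) ∂μ) := by
          rw [integral_add (integrable_const _) ((hWint.const_mul _).const_mul _),
            integral_const_mul, integral_const_mul]
          simp
      _ ≤ 1 + 2 * ((t : ℝ)⁻¹ * m) := by
          gcongr
          exact hm i hi
      _ ≤ Real.exp (2 * m / t) := by
          have := Real.add_one_le_exp (2 * m / t)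
          rw [show 2 * ((t : ℝ)⁻¹ * m) = 2 * m / t by ring]
          linarith
  calc _ ≤ Real.exp (-(t : ℝ)⁻¹ * (2 * m * J.card + t * L)) * Real.exp (2 * m / t) ^ J.card := by
        gcongr
    _ = Real.exp (-L) := by
        rw [← Real.exp_nat_mul, ← Real.exp_add]
        congr 1
        field_simp
        ring

end

/-- The passage time grows at most linearly, up to a small probability. -/
theorem exists_passageTime_linear (hd : d ≠ 0) : ∃ g L₀ C : ℕ, ∀ L, L₀ ≤ L →
    ∀ (Ω : Type u) [MeasurableSpace Ω] (μ : Measure Ω) [IsProbabilityMeasure μ]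
      (S : Lattice d → ℕ → Ω → Lattice d), IsFrogFamily μ S → ∀ x : Lattice d,
      (2 * L ^ g + 1) * L ^ g * L ≤ norm1 x →
        μ.real {ω | ¬ passageTime (config S ω) 0 x ≤ (C * norm1 x : ℕ)}
          ≤ 2 * norm1 x * Real.exp (-L) := by
  classical
  obtain ⟨g, L₀, htail⟩ := exists_passageTime_tail.{u} hd
  set m : ℝ := ((L₀ + 1 : ℕ) : ℝ) ^ g + ∑' l : ℕ, (l + 1 : ℝ) ^ g * Real.exp (-l) with hm
  have hm0 : 0 ≤ m := add_nonneg (by positivity) (tsum_nonneg fun l => by positivity)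
  obtain ⟨C, hC⟩ := exists_nat_ge (2 * m + 1)
  refine ⟨g, L₀ + 1, C, ?_⟩
  intro L hL Ω _ μ _ S hS x hx
  set n := norm1 x with hn
  set t := L ^ g with ht
  have hL1 : 1 ≤ L := by omega
  have ht1 : 1 ≤ t := Nat.one_le_pow _ _ hL1
  obtain ⟨y, hy0, hyn, hstep⟩ := exists_unit_path x hn.symm
  -- Radius `t = L ^ g` contains the walks needed for the tail at every level `l ≤ L`, and confines
  -- the `i`-th local time to walks started near `y i`.
  set A : ℕ → Finset (Lattice d) := fun i => ball (y i) t with hA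
  set T : ℕ → Ω → ℕ∞ := fun i ω =>
    passageTime (mask (A i : Set (Lattice d)) (config S ω)) (y i) (y (i + 1)) with hT
  have hTtail : ∀ i < n, ∀ l, L₀ + 1 ≤ l → l ≤ L →
      μ.real {ω | ¬ T i ω ≤ (l ^ g : ℕ)} ≤ Real.exp (-l) := by
    intro i hi l hl hlL
    have h1 := htail l (by omega) Ω μ (fun z n ω => S (z + y i) n ω - y i) (hS.translate (y i))
      (y (i + 1) - y i) (by rw [hstep i hi]; omega) {z | z + y i ∈ (A i : Set (Lattice d))}
      (fun z hz => by
        show z + y i ∈ (A i : Set (Lattice d))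
        rw [Finset.mem_coe, mem_ball, add_sub_cancel_right]
        exact hz.trans (Nat.pow_le_pow_left hlL g))
    refine (measureReal_mono (fun ω hω => ?_) (measure_ne_top _ _)).trans h1
    intro hle
    refine hω ?_
    have h2 := passageTime_translate (w := mask (A i : Set (Lattice d)) (config S ω)) (y i)
      (x := 0) (y := y (i + 1) - y i) (s := l ^ g) (by
        rw [mask_translate]
        convert hle
        rfl)
    simpa using h2
  have hmean : ∀ i < n, ∫ ω, (localTime (A i : Set (Lattice d)) t (y i) (y (i + 1)) (config S ω) : ℝ) ∂μ
      ≤ m := fun i hi => hS.integral_localTime_le hL (hTtail i hi)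
  -- Indices in one class differ by at least `2t + 1`, so along a geodesic their balls of radius `t`
  -- are disjoint.
  set J : ℕ → Finset ℕ := fun r => (Finset.range n).filter fun i => i % (2 * t + 1) = r with hJ
  have hJdisj : ∀ r, (J r : Set ℕ).PairwiseDisjoint A := by
    have key : ∀ i j, i < j → j < n → i % (2 * t + 1) = j % (2 * t + 1) → Disjoint (A i) (A j) := by
      intro i j hij hj hmod
      rw [Finset.disjoint_left]
      intro z hzi hzj
      rw [mem_ball] at hzi hzj
      have h1 := le_norm1_sub_of_unit_path hy0 (by rw [hyn]) hstep hij.le hj.le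
      have h2 := norm1_sub_le (y j) z (y i)
      rw [norm1_sub_comm (y j) z] at h2
      have h3 : (2 * t + 1) ∣ j - i := (Nat.modEq_iff_dvd' hij.le).1 hmod
      have h4 := Nat.le_of_dvd (by omega) h3
      omega
    intro r i hi j hj hij
    simp only [hJ, Finset.coe_filter, Finset.mem_range, Set.mem_ofPred_eq] at hi hj
    rcases lt_or_gt_of_ne hij with hlt | hlt
    · exact key i j hlt hj.1 (hi.2.trans hj.2.symm)
    · exact (key j i hlt hi.1 (hj.2.trans hi.2.symm)).symm
  have hclass : ∀ r, μ.real {ω | 2 * m * (J r).card + t * L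
      ≤ ∑ i ∈ J r, (localTime (A i : Set (Lattice d)) t (y i) (y (i + 1)) (config S ω) : ℝ)}
      ≤ Real.exp (-L) := fun r =>
    hS.measureReal_sum_localTime_ge (J r) A (hJdisj r) ht1 y (fun i => y (i + 1)) fun i hi =>
      hmean i (Finset.mem_range.1 (Finset.mem_filter.1 hi).1)
  -- The first union contains the cases in which some truncation is active; off it, the local times
  -- add up to a bound for the passage time.
  have hsub : {ω | ¬ passageTime (config S ω) 0 x ≤ (C * n : ℕ)}
      ⊆ (⋃ i ∈ Finset.range n, {ω | ¬ T i ω ≤ (t : ℕ)})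
        ∪ ⋃ r ∈ Finset.range (2 * t + 1), {ω | 2 * m * (J r).card + t * L
          ≤ ∑ i ∈ J r, (localTime (A i : Set (Lattice d)) t (y i) (y (i + 1)) (config S ω) : ℝ)} := by
    intro ω hω
    by_contra hout
    simp only [Set.mem_union, Set.mem_iUnion, Finset.mem_range, not_or, not_exists] at hout
    obtain ⟨h1, h2⟩ := hout
    refine hω ?_
    set W : ℕ → ℕ := fun i => localTime (A i : Set (Lattice d)) t (y i) (y (i + 1)) (config S ω) with hW
    have hpath : ∀ k ≤ n, passageTime (config S ω) 0 (y k) ≤ (∑ i ∈ Finset.range k, W i : ℕ) := by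
      intro k hk
      induction k with
      | zero => rw [hy0]; exact passageTime_self _ _
      | succ k ih =>
        rw [Finset.sum_range_succ]
        refine passageTime_le_add (ih (by omega)) (passageTime_le_mask (A k : Set (Lattice d)) ?_)
        exact passageTime_le_localTime (not_not.1 (h1 k (by omega)))
    have hfin := hpath n le_rfl
    rw [hyn] at hfin
    refine hfin.trans ?_
    have hsum : (∑ i ∈ Finset.range n, W i : ℕ) = ∑ r ∈ Finset.range (2 * t + 1), ∑ i ∈ J r, W i := by
      rw [Finset.sum_fiberwise_of_maps_to fun i _ => Finset.mem_range.2 (Nat.mod_lt i (Nat.succ_pos (2 * t)))]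
    have hcardsum : n = ∑ r ∈ Finset.range (2 * t + 1), (J r).card := by
      have h3 := Finset.card_eq_sum_card_fiberwise (s := Finset.range n)
        (t := Finset.range (2 * t + 1)) (f := fun i => i % (2 * t + 1))
        fun i _ => by simpa using Nat.mod_lt i (Nat.succ_pos (2 * t))
      rwa [Finset.card_range] at h3
    have hreal : ((∑ i ∈ Finset.range n, W i : ℕ) : ℝ) ≤ (C * n : ℕ) := by
      rw [hsum]
      push_cast
      calc ∑ r ∈ Finset.range (2 * t + 1), ∑ i ∈ J r, (W i : ℝ)
          ≤ ∑ r ∈ Finset.range (2 * t + 1), (2 * m * (J r).card + t * L) := by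
            refine Finset.sum_le_sum fun r hr => ?_
            exact (not_le.1 (h2 r (Finset.mem_range.1 hr))).le
        _ = 2 * m * n + ((2 * t + 1) * t * L : ℕ) := by
            rw [Finset.sum_add_distrib, ← Finset.mul_sum, ← Nat.cast_sum, ← hcardsum,
              Finset.sum_const, Finset.card_range, nsmul_eq_mul]
            push_cast
            ring
        -- The hypothesis on `norm1 x` absorbs the fluctuation terms `t * L` of all `2t + 1` classes
        -- into one further `n`.
        _ ≤ 2 * m * n + n := by gcongr
        _ = (2 * m + 1) * n := by ring
        _ ≤ C * n := by gcongr
    exact_mod_cast hreal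
  have h2t : 2 * t + 1 ≤ n := by
    refine le_trans ?_ hx
    calc 2 * t + 1 = (2 * t + 1) * 1 * 1 := by ring
      _ ≤ (2 * t + 1) * t * L := by gcongr
  calc μ.real {ω | ¬ passageTime (config S ω) 0 x ≤ (C * n : ℕ)}
      ≤ ∑ i ∈ Finset.range n, Real.exp (-(L : ℝ)) + ∑ r ∈ Finset.range (2 * t + 1), Real.exp (-(L : ℝ)) := by
        refine (measureReal_mono hsub (measure_ne_top _ _)).trans ?_
        refine (measureReal_union_le _ _).trans (add_le_add ?_ ?_)
        · exact (measureReal_biUnion_finset_le _ _).trans (Finset.sum_le_sum fun i hi =>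
            hTtail i (Finset.mem_range.1 hi) L hL le_rfl)
        · exact (measureReal_biUnion_finset_le _ _).trans (Finset.sum_le_sum fun r _ => hclass r)
    _ = (n + (2 * t + 1 : ℕ)) * Real.exp (-L) := by
        rw [Finset.sum_const, Finset.sum_const, Finset.card_range, Finset.card_range, nsmul_eq_mul,
          nsmul_eq_mul]
        ring
    _ ≤ (n + n) * Real.exp (-L) := by gcongr
    _ = _ := by ring

/-! ### First moment bound for short fast paths -/

/-- The exponential is an eigenfunction of `avg` with eigenvalue `1 + (cosh s - 1) / d`, which is at
most `cosh s ≤ exp (s ^ 2 / 2)`. -/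
theorem tsum_heat_exp_le (hd : d ≠ 0) (c : Fin d) (s : ℝ) (n : ℕ) :
    ∑' y : Lattice d, heat n y * Real.exp (s * y c) ≤ Real.exp (s ^ 2 / 2) ^ n := by
  have hd1 : (1 : ℝ) ≤ d := by exact_mod_cast Nat.one_le_iff_ne_zero.2 hd
  induction n with
  | zero =>
    rw [tsum_eq_single 0]
    · simp [heat]
    · intro y hy; simp [heat, hy]
  | succ n ih =>
    have havg : ∀ y : Lattice d, avg (fun y => Real.exp (s * y c)) y
        = (1 + (Real.cosh s - 1) / d) * Real.exp (s * y c) := fun y => by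
      have := avg_coord hd c (fun m : ℤ => Real.exp (s * m)) y
      simp only [Int.cast_add, Int.cast_sub, Int.cast_one, mul_add, mul_sub, mul_one, Real.exp_add,
        Real.exp_sub] at this
      rw [this, Real.cosh_eq, Real.exp_neg]
      field_simp
    have h0 : 1 + (Real.cosh s - 1) / d ≤ Real.exp (s ^ 2 / 2) := by
      have h1 := Real.one_le_cosh s
      have h2 : (Real.cosh s - 1) / d ≤ Real.cosh s - 1 := div_le_self (by linarith) hd1
      linarith [Real.cosh_le_exp_half_sq s]
    rw [tsum_heat_succ]
    simp only [havg, mul_left_comm _ (1 + (Real.cosh s - 1) / d : ℝ)]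
    rw [tsum_mul_left, pow_succ']
    refine mul_le_mul h0 ih (tsum_nonneg fun y => ?_) (Real.exp_nonneg _)
    exact mul_nonneg (heat_nonneg _ _) (Real.exp_nonneg _)

/-- The discounted number of visits to `y` of the trajectory `w` at positive times. -/
noncomputable def discountedVisits (b : ℝ≥0∞) (y : Lattice d) (w : ℕ → Lattice d) : ℝ≥0∞ :=
  ∑' j : ℕ, if w (j + 1) = y then b ^ (j + 1) else 0

/-- The expected discounted number of visits to `z` at positive times of simple random walk
started at the origin. -/
noncomputable def green (b : ℝ≥0∞) (z : Lattice d) : ℝ≥0∞ :=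
  ∑' j : ℕ, b ^ (j + 1) * ENNReal.ofReal (heat (j + 1) z)

theorem measurable_discountedVisits (b : ℝ≥0∞) (y : Lattice d) :
    Measurable (discountedVisits b y) := by
  unfold discountedVisits
  refine Measurable.tsum fun j => Measurable.ite ?_ measurable_const measurable_const
  exact (measurable_pi_apply (X := fun _ : ℕ => Lattice d) (j + 1)) (measurableSet_singleton y)

theorem pow_le_discountedVisits (b : ℝ≥0∞) {w : Lattice d → ℕ → Lattice d} {x y : Lattice d} {t : ℕ}
    (hw : w x 0 = x) (hxy : x ≠ y) (ht : hitTime w x y = t) : b ^ t ≤ discountedVisits b y (w x) := by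
  obtain ⟨j, hj, hjt⟩ := exists_of_hitTime_ne_top (w := w) (x := x) (y := y) (by
    rw [ht]; exact ENat.natCast_ne_top t)
  have h1 := one_le_hitTime hw hxy
  rw [hjt] at h1 ht
  obtain rfl : j = t := by exact_mod_cast ht
  have h2 : 1 ≤ j := by exact_mod_cast h1
  obtain ⟨i, rfl⟩ := Nat.exists_eq_add_of_le' h2
  refine le_trans ?_ (ENNReal.le_tsum i)
  rw [if_pos hj]

/-- The first visit alone contributes `b` to the power of the hitting time; consecutive vertices are
distinct, so this time is positive and is counted. -/
theorem pow_le_prod_discountedVisits {b : ℝ≥0∞} (hb : b ≤ 1) {w : Lattice d → ℕ → Lattice d}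
    (hw : ∀ x, w x 0 = x) {k : ℕ} {γ : Fin (k + 1) → Lattice d} (hγ : Function.Injective γ) {q : ℕ}
    (hq : pathTime w γ ≤ q) :
    b ^ q ≤ ∏ i : Fin k, discountedVisits b (γ i.succ) (w (γ i.castSucc)) := by
  have hfin : ∀ i : Fin k, ∃ t : ℕ, hitTime w (γ i.castSucc) (γ i.succ) = t := fun i => by
    have h1 : hitTime w (γ i.castSucc) (γ i.succ) ≤ q := le_trans
      (Finset.single_le_sum (f := fun i : Fin k => hitTime w (γ i.castSucc) (γ i.succ))
        (fun _ _ => zero_le) (Finset.mem_univ i)) hq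
    obtain ⟨t, ht⟩ := ENat.ne_top_iff_exists.1 (ne_top_of_le_ne_top (ENat.natCast_ne_top q) h1)
    exact ⟨t, ht.symm⟩
  choose t ht using hfin
  have hsum : ∑ i, t i ≤ q := by
    have : ((∑ i, t i : ℕ) : ℕ∞) ≤ q := by
      refine le_trans (le_of_eq ?_) hq
      simp only [pathTime, ht, Nat.cast_sum]
    exact_mod_cast this
  calc b ^ q ≤ b ^ ∑ i, t i := pow_le_pow_right_of_le_one' hb hsum
    _ = ∏ i, b ^ t i := (Finset.prod_pow_eq_pow_sum _ _ _).symm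
    _ ≤ _ := Finset.prod_le_prod' fun i _ => pow_le_discountedVisits b (hw _)
        (fun h => (Fin.castSucc_lt_succ (i := i)).ne (hγ h)) (ht i)

theorem tsum_pi_prod (f : Lattice d → ℝ≥0∞) (k : ℕ) :
    ∑' u : Fin k → Lattice d, ∏ i, f (u i) = (∑' z, f z) ^ k := by
  induction k with
  | zero => simp [tsum_fintype]
  | succ k ih =>
    rw [← (Fin.consEquiv fun _ : Fin (k + 1) => Lattice d).tsum_eq, ENNReal.tsum_prod', pow_succ',
      ← ih, ← ENNReal.tsum_mul_right]
    refine tsum_congr fun z => ?_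
    rw [← ENNReal.tsum_mul_left]
    refine tsum_congr fun v => ?_
    simp [Fin.consEquiv, Fin.prod_univ_succ]

theorem tsum_green_mul_exp_le (hd : d ≠ 0) (b : ℝ≥0∞) (c : Fin d) (s : ℝ) :
    ∑' z : Lattice d, green b z * ENNReal.ofReal (Real.exp (s * z c))
      ≤ ∑' j : ℕ, (b * ENNReal.ofReal (Real.exp (s ^ 2 / 2))) ^ (j + 1) := by
  simp only [green, ← ENNReal.tsum_mul_right]
  rw [ENNReal.tsum_comm]
  refine ENNReal.tsum_le_tsum fun j => ?_
  simp only [mul_assoc, ← ENNReal.ofReal_mul (heat_nonneg _ _)]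
  rw [ENNReal.tsum_mul_left, mul_pow, ← ENNReal.ofReal_pow (Real.exp_nonneg _),
    ← ENNReal.ofReal_tsum_of_nonneg
      (fun y => mul_nonneg (heat_nonneg _ _) (Real.exp_nonneg _)) (summable_heat_mul _ _)]
  gcongr
  exact tsum_heat_exp_le hd c s (j + 1)

section

variable {Ω : Type*} [MeasurableSpace Ω] {μ : Measure Ω} {S : Lattice d → ℕ → Ω → Lattice d}

theorem IsSimpleRandomWalk.lintegral_discountedVisits [IsProbabilityMeasure μ] (hd : d ≠ 0)
    {x : Lattice d} {X : ℕ → Ω → Lattice d} (h : IsSimpleRandomWalk μ x X) (b : ℝ≥0∞)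
    (y : Lattice d) : ∫⁻ ω, discountedVisits b y (fun n => X n ω) ∂μ = green b (y - x) := by
  have hm : ∀ j, MeasurableSet {ω | X (j + 1) ω = y} := fun j =>
    h.measurable (j + 1) (measurableSet_singleton y)
  unfold discountedVisits green
  rw [lintegral_tsum fun j => (Measurable.ite (hm j) measurable_const measurable_const).aemeasurable]
  refine tsum_congr fun j => ?_
  rw [← h.measureReal_eq hd, ofReal_measureReal, ← lintegral_indicator_const (hm j)]
  refine lintegral_congr fun ω => ?_
  simp [Set.indicator_apply]

/-- Distinct vertices mean distinct, hence independent, walks. This is where self-avoidance of the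
path is used. -/
theorem IsFrogFamily.lintegral_prod_discountedVisits [IsProbabilityMeasure μ] (hd : d ≠ 0)
    (h : IsFrogFamily μ S) (b : ℝ≥0∞) {k : ℕ} {γ : Fin (k + 1) → Lattice d}
    (hγ : Function.Injective γ) :
    ∫⁻ ω, ∏ i : Fin k, discountedVisits b (γ i.succ) (config S ω (γ i.castSucc)) ∂μ
      = ∏ i : Fin k, green b (γ i.succ - γ i.castSucc) := by
  have h1 : iIndepFun (fun (i : Fin k) ω => config S ω (γ i.castSucc)) μ :=
    h.indep.precomp (g := fun i : Fin k => γ i.castSucc) (hγ.comp (Fin.castSucc_injective k))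
  have h2 : iIndepFun (fun (i : Fin k) ω => discountedVisits b (γ i.succ)
      (config S ω (γ i.castSucc))) μ :=
    h1.comp (fun i => discountedVisits b (γ i.succ)) fun i => measurable_discountedVisits b _
  have hm : ∀ i : Fin k, Measurable fun ω => discountedVisits b (γ i.succ)
      (config S ω (γ i.castSucc)) := fun i =>
    (measurable_discountedVisits b _).comp
      (measurable_pi_lambda _ fun n => (h.walk (γ i.castSucc)).measurable n)
  rw [lintegral_prod_eq_prod_lintegral_of_indepFun Finset.univ _ h2 hm]
  exact Finset.prod_congr rfl fun i _ => (h.walk _).lintegral_discountedVisits hd b _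

/-- Markov's inequality for the product of discounted visits, which is at least `b ^ q` on the
event. -/
theorem IsFrogFamily.measure_pathTime_le_mul_pow_le [IsProbabilityMeasure μ] (hd : d ≠ 0)
    (h : IsFrogFamily μ S) {b : ℝ≥0∞} (hb : b ≤ 1) {k : ℕ} {γ : Fin (k + 1) → Lattice d}
    (hγ : Function.Injective γ) (q : ℕ) :
    μ {ω | pathTime (config S ω) γ ≤ q} * b ^ q
      ≤ ∏ i : Fin k, green b (γ i.succ - γ i.castSucc) := by
  rw [← h.lintegral_prod_discountedVisits hd b hγ, mul_comm]
  refine le_trans ?_ (mul_meas_ge_le_lintegral₀ ?_ (b ^ q))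
  · exact mul_le_mul' le_rfl (measure_mono fun ω hω =>
      pow_le_prod_discountedVisits hb (fun x => (h.walk x).start ω) hγ hω)
  · refine (Finset.measurable_prod _ fun i _ => ?_).aemeasurable
    exact (measurable_discountedVisits b _).comp
      (measurable_pi_lambda _ fun n => (h.walk (γ (Fin.castSucc i))).measurable n)

theorem sum_increments {k : ℕ} (γ : Fin (k + 1) → Lattice d) :
    ∑ i : Fin k, (γ i.succ - γ i.castSucc) = γ (Fin.last k) - γ 0 := by
  rw [Finset.sum_sub_distrib, sub_eq_sub_iff_add_eq_add, add_comm, ← Fin.sum_univ_succ,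
    Fin.sum_univ_castSucc, add_comm]

/-- First moment bound on the number of self-avoiding sequences with `k` steps from `0` to `x`
that are traversed within time `q`. -/
theorem IsFrogFamily.measure_exists_pathTime_le [IsProbabilityMeasure μ] (hd : d ≠ 0)
    (h : IsFrogFamily μ S) {b : ℝ≥0∞} (hb : b ≤ 1) (k q : ℕ) (x : Lattice d) (c : Fin d) (s : ℝ) :
    μ {ω | ∃ γ : Fin (k + 1) → Lattice d, Function.Injective γ ∧ γ 0 = 0 ∧ γ (Fin.last k) = x ∧
        pathTime (config S ω) γ ≤ q} * b ^ q * ENNReal.ofReal (Real.exp (s * x c))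
      ≤ (∑' j : ℕ, (b * ENNReal.ofReal (Real.exp (s ^ 2 / 2))) ^ (j + 1)) ^ k := by
  set P := {γ : Fin (k + 1) → Lattice d // Function.Injective γ ∧ γ 0 = 0 ∧ γ (Fin.last k) = x}
  set f : Lattice d → ℝ≥0∞ := fun z => green b z * ENNReal.ofReal (Real.exp (s * z c))
  have hunion : {ω | ∃ γ : Fin (k + 1) → Lattice d, Function.Injective γ ∧ γ 0 = 0 ∧
      γ (Fin.last k) = x ∧ pathTime (config S ω) γ ≤ q}
      ⊆ ⋃ γ : P, {ω | pathTime (config S ω) γ.1 ≤ q} := by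
    rintro ω ⟨γ, h1, h2, h3, h4⟩
    exact Set.mem_iUnion.2 ⟨⟨γ, h1, h2, h3⟩, h4⟩
  have hterm : ∀ γ : P, μ {ω | pathTime (config S ω) γ.1 ≤ q} * b ^ q *
      ENNReal.ofReal (Real.exp (s * x c)) ≤ ∏ i : Fin k, f (γ.1 i.succ - γ.1 i.castSucc) := by
    rintro ⟨γ, h1, h2, h3⟩
    rw [Finset.prod_mul_distrib, ← ENNReal.ofReal_prod_of_nonneg fun _ _ => Real.exp_nonneg _,
      ← Real.exp_sum, ← Finset.mul_sum]
    -- The tilt splits over the steps because the increments sum to `x`.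
    have hx : ∑ i : Fin k, (((γ i.succ - γ i.castSucc : Lattice d) c : ℤ) : ℝ) = x c := by
      rw [← Int.cast_sum, ← Finset.sum_apply, sum_increments, h2, h3, sub_zero]
    rw [hx]
    gcongr
    exact h.measure_pathTime_le_mul_pow_le hd hb h1 q
  -- A path from `0` is recovered from its increments, so the sum over paths is at most the sum over
  -- all increment vectors, a `k`-th power.
  have hinj : Function.Injective fun (γ : P) (i : Fin k) => γ.1 i.succ - γ.1 i.castSucc := by
    rintro ⟨γ, _, h2, _⟩ ⟨γ', _, h2', _⟩ hγ
    refine Subtype.ext (funext fun i => ?_)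
    induction i using Fin.induction with
    | zero => exact h2.trans h2'.symm
    | succ i ih =>
      have := congrFun hγ i
      simp only at this ih
      rw [ih] at this
      exact sub_left_injective this
  calc _ ≤ (∑' γ : P, μ {ω | pathTime (config S ω) γ.1 ≤ q}) * b ^ q *
        ENNReal.ofReal (Real.exp (s * x c)) := by
        gcongr
        exact (measure_mono hunion).trans (measure_iUnion_le _)
    _ = ∑' γ : P, μ {ω | pathTime (config S ω) γ.1 ≤ q} * b ^ q *
        ENNReal.ofReal (Real.exp (s * x c)) := by
        rw [ENNReal.tsum_mul_right, ENNReal.tsum_mul_right]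
    _ ≤ ∑' γ : P, ∏ i : Fin k, f (γ.1 i.succ - γ.1 i.castSucc) := ENNReal.tsum_le_tsum hterm
    _ ≤ ∑' v : Fin k → Lattice d, ∏ i, f (v i) :=
        ENNReal.tsum_comp_le_tsum_of_injective hinj fun v : Fin k → Lattice d => ∏ i, f (v i)
    _ = (∑' z, f z) ^ k := tsum_pi_prod f k
    _ ≤ _ := by gcongr; exact tsum_green_mul_exp_le hd b c s

end

theorem exists_norm1_le_mul_natAbs (hd : d ≠ 0) (x : Lattice d) :
    ∃ c, norm1 x ≤ d * (x c).natAbs := by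
  have : Nonempty (Fin d) := ⟨⟨0, Nat.pos_of_ne_zero hd⟩⟩
  by_contra! hlt
  have h1 : ∑ c, d * (x c).natAbs < ∑ _c : Fin d, norm1 x :=
    Finset.sum_lt_sum_of_nonempty Finset.univ_nonempty fun c _ => hlt c
  rw [← Finset.mul_sum, Finset.sum_const, Finset.card_univ, Fintype.card_fin, smul_eq_mul] at h1
  exact lt_irrefl _ h1

/-- Within a time linear in the distance, the point `x` is unlikely to be reached along a
self-avoiding sequence with few vertices. -/
theorem exists_measureReal_short_path_le (hd : d ≠ 0) {C : ℕ} (hC : 1 ≤ C) :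
    ∃ c c' : ℝ, 0 < c ∧ 0 < c' ∧ ∀ (Ω : Type u) [MeasurableSpace Ω] (μ : Measure Ω)
      [IsProbabilityMeasure μ] (S : Lattice d → ℕ → Ω → Lattice d), IsFrogFamily μ S →
      ∀ x : Lattice d, μ.real {ω | ∃ (k : ℕ) (γ : Fin (k + 1) → Lattice d), (k : ℝ) ≤ c * norm1 x ∧
        Function.Injective γ ∧ γ 0 = 0 ∧ γ (Fin.last k) = x ∧
        pathTime (config S ω) γ ≤ (C * norm1 x : ℕ)}
        ≤ (c * norm1 x + 1) * Real.exp (-(c' * norm1 x)) := by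
  have hd0 : (0 : ℝ) < d := by exact_mod_cast Nat.pos_of_ne_zero hd
  have hC0 : (0 : ℝ) < C := by exact_mod_cast hC
  -- With discount `exp (-η ^ 2)` per unit of time, the time `C * n` costs `η ^ 2 * C * n`; this `η`
  -- makes the cost half of the guaranteed tilt gain `η * n / d`.
  set η : ℝ := 1 / (2 * d * C) with hη
  have hη0 : 0 < η := by positivity
  have hηC : η ^ 2 * C = η / (2 * d) := by rw [hη]; field_simp
  set r : ℝ := Real.exp (-(η ^ 2 / 2)) with hr
  have hr0 : 0 < r := Real.exp_pos _
  have hr1 : r < 1 := by rw [hr, Real.exp_lt_one_iff]; have := pow_pos hη0 2; linarith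
  -- `exp l` bounds the sum over one increment, so `k ≤ η / (4 * d * l) * n` steps cost at most a
  -- quarter of the tilt gain, and a quarter is left over.
  set l : ℝ := -Real.log (1 - r) with hl
  have hl0 : 0 < l := neg_pos.2 (Real.log_neg (by linarith) (by linarith))
  have hexpl : Real.exp l = (1 - r)⁻¹ := by rw [hl, Real.exp_neg, Real.exp_log (by linarith)]
  set b : ℝ≥0∞ := ENNReal.ofReal (Real.exp (-η ^ 2)) with hb
  have hb1 : b ≤ 1 := by
    rw [hb, ← ENNReal.ofReal_one]
    refine ENNReal.ofReal_le_ofReal (Real.exp_le_one_iff.2 ?_)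
    have := pow_pos hη0 2
    linarith
  have hgeom : ∀ s : ℝ, s ^ 2 = η ^ 2 →
      ∑' j : ℕ, (b * ENNReal.ofReal (Real.exp (s ^ 2 / 2))) ^ (j + 1)
        ≤ ENNReal.ofReal (Real.exp l) := fun s hs => by
    have h1 : b * ENNReal.ofReal (Real.exp (s ^ 2 / 2)) = ENNReal.ofReal r := by
      rw [hb, ← ENNReal.ofReal_mul (Real.exp_nonneg _), ← Real.exp_add, hs, hr]
      congr 2
      ring
    rw [h1, hexpl, ENNReal.ofReal_inv_of_pos (by linarith), ENNReal.ofReal_sub _ hr0.le,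
      ENNReal.ofReal_one, ← ENNReal.tsum_geometric]
    refine ENNReal.tsum_le_tsum fun j => pow_le_pow_right_of_le_one' ?_ (Nat.le_succ j)
    rw [← ENNReal.ofReal_one]
    exact ENNReal.ofReal_le_ofReal hr1.le
  refine ⟨η / (4 * d * l), η / (4 * d), by positivity, by positivity, ?_⟩
  intro Ω _ μ _ S hS x
  set n : ℕ := norm1 x with hn
  set E : ℕ → Set Ω := fun k => {ω | ∃ γ : Fin (k + 1) → Lattice d, Function.Injective γ ∧ γ 0 = 0 ∧
    γ (Fin.last k) = x ∧ pathTime (config S ω) γ ≤ (C * n : ℕ)} with hE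
  have hEk : ∀ k : ℕ, (k : ℝ) ≤ η / (4 * d * l) * n →
      μ.real (E k) ≤ Real.exp (-(η / (4 * d) * n)) := by
    intro k hk
    -- Some coordinate carries at least the share `1 / d` of the norm; the sign of `s` follows its
    -- sign.
    obtain ⟨i, hi⟩ := exists_norm1_le_mul_natAbs hd x
    obtain ⟨s, hs, hsx⟩ : ∃ s : ℝ, s ^ 2 = η ^ 2 ∧ s * x i = η * (x i).natAbs := by
      rcases le_total 0 (x i) with h0 | h0
      · exact ⟨η, rfl, by rw [Nat.cast_natAbs, abs_of_nonneg h0]⟩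
      · exact ⟨-η, neg_sq η, by rw [Nat.cast_natAbs, abs_of_nonpos h0]; push_cast; ring⟩
    have h1 := (hS.measure_exists_pathTime_le hd hb1 k (C * n) x i s).trans
      (pow_le_pow_left' (hgeom s hs) k)
    have h2 := ENNReal.toReal_mono (by simp) h1
    rw [ENNReal.toReal_mul, ENNReal.toReal_mul, ENNReal.toReal_pow, ENNReal.toReal_pow,
      ENNReal.toReal_ofReal (Real.exp_nonneg _), ENNReal.toReal_ofReal (Real.exp_nonneg _),
      ENNReal.toReal_ofReal (Real.exp_nonneg _), ← Real.exp_nat_mul, ← Real.exp_nat_mul, mul_assoc,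
      ← Real.exp_add] at h2
    have h3 : μ.real (E k) ≤ Real.exp (k * l) * Real.exp (-((C * n : ℕ) * -η ^ 2 + s * x i)) := by
      rw [Real.exp_neg, ← div_eq_mul_inv, le_div_iff₀ (Real.exp_pos _)]
      exact h2
    rw [← Real.exp_add] at h3
    refine h3.trans (Real.exp_le_exp.2 ?_)
    have h4 : (n : ℝ) ≤ d * (x i).natAbs := by exact_mod_cast hi
    have h5 : k * l ≤ η / (4 * d) * n := by
      calc k * l ≤ η / (4 * d * l) * n * l := by gcongr
        _ = η / (4 * d) * n := by field_simp
    have h6 : η / d * n ≤ s * x i := by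
      rw [hsx, div_mul_eq_mul_div, div_le_iff₀ hd0]
      calc η * n ≤ η * (d * (x i).natAbs) := by gcongr
        _ = _ := by ring
    have h7 : (C * n : ℕ) * -η ^ 2 = -(η / (2 * d) * n) := by
      rw [← hηC]; push_cast; ring
    rw [h7]
    have h8 : η / (4 * d) * n + η / (2 * d) * n - η / d * n = -(η / (4 * d) * n) := by
      field_simp; ring
    linarith
  have hsub : {ω | ∃ (k : ℕ) (γ : Fin (k + 1) → Lattice d), (k : ℝ) ≤ η / (4 * d * l) * n ∧
      Function.Injective γ ∧ γ 0 = 0 ∧ γ (Fin.last k) = x ∧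
      pathTime (config S ω) γ ≤ (C * n : ℕ)}
      ⊆ ⋃ k ∈ Finset.range (⌊η / (4 * d * l) * n⌋₊ + 1), E k := by
    rintro ω ⟨k, γ, hk, h⟩
    simp only [Set.mem_iUnion, Finset.mem_range]
    exact ⟨k, Nat.lt_succ_of_le (Nat.le_floor hk), γ, h⟩
  have hc0 : 0 ≤ η / (4 * d * l) * n := by positivity
  calc _ ≤ ∑ k ∈ Finset.range (⌊η / (4 * d * l) * n⌋₊ + 1), μ.real (E k) :=
        (measureReal_mono hsub (measure_ne_top _ _)).trans (measureReal_biUnion_finset_le _ _)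
    _ ≤ ∑ k ∈ Finset.range (⌊η / (4 * d * l) * n⌋₊ + 1), Real.exp (-(η / (4 * d) * n)) :=
        Finset.sum_le_sum fun k hk => hEk k
          ((Nat.le_floor_iff hc0).1 (Nat.lt_succ_iff.1 (Finset.mem_range.1 hk)))
    _ = (⌊η / (4 * d * l) * n⌋₊ + 1) * Real.exp (-(η / (4 * d) * n)) := by
        rw [Finset.sum_const, Finset.card_range, nsmul_eq_mul]; push_cast; ring
    _ ≤ _ := by
        gcongr
        exact Nat.floor_le hc0

/-! ### From passage times to lengths, and the choice of scales -/

theorem optimalLengths_nonempty {w : Lattice d → ℕ → Lattice d} {x y : Lattice d} {q : ℕ}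
    (h : passageTime w x y ≤ q) : (optimalLengths w x y).Nonempty := by
  obtain ⟨k, γ, hγ⟩ := exists_isOptimalPath h
  exact ⟨k + 1, k, γ, hγ, rfl⟩

theorem le_of_mem_optimalLengths {w : Lattice d → ℕ → Lattice d} (hw : ∀ x, w x 0 = x)
    {x y : Lattice d} {q l : ℕ} (h : passageTime w x y ≤ q) (hl : l ∈ optimalLengths w x y) :
    l ≤ q + 1 := by
  obtain ⟨k, γ, hγ, rfl⟩ := hl
  have h1 := (le_pathTime_of_injective hw hγ.distinct).trans (hγ.optimal.le.trans h)
  have h2 : k ≤ q := by exact_mod_cast h1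
  omega

theorem mask_univ (w : Lattice d → ℕ → Lattice d) [DecidablePred (· ∈ (Set.univ : Set (Lattice d)))] :
    mask Set.univ w = w := by
  funext z j
  simp [mask]

/-- The error terms of the union bound are eventually absorbed by a stretched exponential. -/
theorem eventually_error_le (c : ℝ) {c' : ℝ} (hc : 0 ≤ c) (hc' : 0 < c') {p : ℕ} (hp : 1 ≤ p) :
    ∀ᶠ y : ℝ in Filter.atTop,
      2 * y ^ (2 * p) * Real.exp (1 - y ^ 2) + (c * y ^ (2 * p) + 1) * Real.exp (-(c' * y ^ (2 * p)))
        ≤ Real.exp (-y) := by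
  have h1 : Filter.Tendsto (fun y : ℝ => (2 * Real.exp 1 + c) * (y ^ (2 * p) * Real.exp (-y))
      + y ^ 0 * Real.exp (-y)) Filter.atTop (nhds ((2 * Real.exp 1 + c) * 0 + 0)) :=
    ((Real.tendsto_pow_mul_exp_neg_atTop_nhds_zero (2 * p)).const_mul _).add
      (Real.tendsto_pow_mul_exp_neg_atTop_nhds_zero 0)
  have h2 := h1.eventually (Iic_mem_nhds (by norm_num : (2 * Real.exp 1 + c) * 0 + 0 < (1 : ℝ)))
  filter_upwards [h2, Filter.eventually_ge_atTop (2 : ℝ), Filter.eventually_ge_atTop (2 / c')]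
    with y hy hy2 hyc
  have hy1 : 1 ≤ y := by linarith
  have e1 : Real.exp (1 - y ^ 2) ≤ Real.exp 1 * Real.exp (-y) * Real.exp (-y) := by
    rw [← Real.exp_add, ← Real.exp_add, Real.exp_le_exp]
    nlinarith
  have e2 : Real.exp (-(c' * y ^ (2 * p))) ≤ Real.exp (-y) * Real.exp (-y) := by
    rw [← Real.exp_add, Real.exp_le_exp]
    have h3 : y ^ 2 ≤ y ^ (2 * p) := pow_le_pow_right₀ hy1 (by omega)
    have h4 : 2 ≤ c' * y := by rwa [div_le_iff₀' hc'] at hyc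
    have h5 : 2 * y ≤ c' * y ^ 2 := by nlinarith
    have h6 : c' * y ^ 2 ≤ c' * y ^ (2 * p) := by gcongr
    linarith
  calc _ ≤ 2 * y ^ (2 * p) * (Real.exp 1 * Real.exp (-y) * Real.exp (-y))
        + (c * y ^ (2 * p) + 1) * (Real.exp (-y) * Real.exp (-y)) := by gcongr
    _ = ((2 * Real.exp 1 + c) * (y ^ (2 * p) * Real.exp (-y)) + y ^ 0 * Real.exp (-y))
        * Real.exp (-y) := by ring
    _ ≤ 1 * Real.exp (-y) := by gcongr
    _ = _ := one_mul _

section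

variable {Ω : Type*} [MeasurableSpace Ω] {μ : Measure Ω} [IsProbabilityMeasure μ]
  {S : Lattice d → ℕ → Ω → Lattice d}

/-- For bounded distance the lower bound is only that a length is at least one, and a bounded
passage time gives the upper bound. -/
theorem IsFrogFamily.measureReal_lengths_ge_of_small (hS : IsFrogFamily μ S) {x : Lattice d}
    (hx : 1 ≤ norm1 x) {q n₁ : ℕ} (hn : norm1 x ≤ n₁) {c C p : ℝ} (hc : c * n₁ ≤ 1)
    (hc0 : 0 ≤ c) (hC : (q : ℝ) + 1 ≤ C)
    (h : μ.real {ω | ¬ passageTime (config S ω) 0 x ≤ q} ≤ p) :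
    1 - p ≤ μ.real {ω | (optimalLengths (config S ω) 0 x).Nonempty ∧
      ∀ l ∈ optimalLengths (config S ω) 0 x, c * (norm1 x : ℝ) ≤ l ∧ l ≤ C * norm1 x} := by
  have hsub : (Set.univ : Set Ω) ⊆ {ω | (optimalLengths (config S ω) 0 x).Nonempty ∧
      ∀ l ∈ optimalLengths (config S ω) 0 x, c * (norm1 x : ℝ) ≤ l ∧ (l : ℝ) ≤ C * norm1 x}
      ∪ {ω | ¬ passageTime (config S ω) 0 x ≤ q} := by
    intro ω _
    by_cases hT : passageTime (config S ω) 0 x ≤ q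
    · refine Or.inl ⟨optimalLengths_nonempty hT, fun l hl => ⟨?_, ?_⟩⟩
      · have h1 : 1 ≤ l := by obtain ⟨k, γ, -, rfl⟩ := hl; omega
        calc c * (norm1 x : ℝ) ≤ c * n₁ := by gcongr
          _ ≤ 1 := hc
          _ ≤ l := by exact_mod_cast h1
      · have h1 := le_of_mem_optimalLengths (fun x => (hS.walk x).start ω) hT hl
        have h2 : (l : ℝ) ≤ q + 1 := by exact_mod_cast h1
        have h3 : (1 : ℝ) ≤ norm1 x := by exact_mod_cast hx
        have h4 : 0 ≤ C := by linarith [(Nat.cast_nonneg q : (0 : ℝ) ≤ q)]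
        calc (l : ℝ) ≤ C * 1 := by linarith
          _ ≤ C * norm1 x := by gcongr
    · exact Or.inr hT
  have h1 := (measureReal_mono hsub (measure_ne_top μ _)).trans (measureReal_union_le _ _)
  rw [probReal_univ] at h1
  linarith

/-- If the passage time is at most `q * norm1 x`, an optimal path that is too short belongs to the
second exceptional event. -/
theorem IsFrogFamily.measureReal_lengths_ge_of_large (hS : IsFrogFamily μ S) {x : Lattice d}
    (hx : 1 ≤ norm1 x) {q : ℕ} {c c₁ C p p' : ℝ} (hc : c ≤ c₁) (hC : (q : ℝ) + 1 ≤ C)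
    (h : μ.real {ω | ¬ passageTime (config S ω) 0 x ≤ (q * norm1 x : ℕ)} ≤ p)
    (h' : μ.real {ω | ∃ (k : ℕ) (γ : Fin (k + 1) → Lattice d), (k : ℝ) ≤ c₁ * norm1 x ∧
        Function.Injective γ ∧ γ 0 = 0 ∧ γ (Fin.last k) = x ∧
        pathTime (config S ω) γ ≤ (q * norm1 x : ℕ)} ≤ p') :
    1 - (p + p') ≤ μ.real {ω | (optimalLengths (config S ω) 0 x).Nonempty ∧
      ∀ l ∈ optimalLengths (config S ω) 0 x, c * (norm1 x : ℝ) ≤ l ∧ l ≤ C * norm1 x} := by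
  have hsub : (Set.univ : Set Ω) ⊆ {ω | (optimalLengths (config S ω) 0 x).Nonempty ∧
      ∀ l ∈ optimalLengths (config S ω) 0 x, c * (norm1 x : ℝ) ≤ l ∧ (l : ℝ) ≤ C * norm1 x}
      ∪ ({ω | ¬ passageTime (config S ω) 0 x ≤ (q * norm1 x : ℕ)} ∪
        {ω | ∃ (k : ℕ) (γ : Fin (k + 1) → Lattice d), (k : ℝ) ≤ c₁ * norm1 x ∧
        Function.Injective γ ∧ γ 0 = 0 ∧ γ (Fin.last k) = x ∧
        pathTime (config S ω) γ ≤ (q * norm1 x : ℕ)}) := by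
    intro ω _
    by_contra hout
    simp only [Set.mem_union, not_or] at hout
    obtain ⟨h1, h2, h3⟩ := hout
    have hT : passageTime (config S ω) 0 x ≤ (q * norm1 x : ℕ) := not_not.1 h2
    refine h1 ⟨optimalLengths_nonempty hT, fun l hl => ⟨?_, ?_⟩⟩
    · obtain ⟨k, γ, hγ, rfl⟩ := hl
      by_contra! hlt
      refine h3 ⟨k, γ, ?_, hγ.distinct, hγ.first, hγ.last, hγ.optimal.le.trans hT⟩
      push_cast at hlt
      have : c * (norm1 x : ℝ) ≤ c₁ * norm1 x := by gcongr
      linarith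
    · have h4 := le_of_mem_optimalLengths (fun x => (hS.walk x).start ω) hT hl
      have h5 : (l : ℝ) ≤ q * norm1 x + 1 := by exact_mod_cast h4
      have h6 : (1 : ℝ) ≤ norm1 x := by exact_mod_cast hx
      calc (l : ℝ) ≤ (q + 1) * norm1 x := by linarith
        _ ≤ C * norm1 x := by gcongr
  have h1 := (measureReal_mono hsub (measure_ne_top μ _)).trans ((measureReal_union_le _ _).trans
    (add_le_add le_rfl (measureReal_union_le _ _)))
  rw [probReal_univ] at h1
  linarith

end

/-- For distant points, the passage time is at most linear and no short path is that fast, up to an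
error that is stretched exponential in the distance. -/
theorem exists_large_distance_bounds (hd : d ≠ 0) : ∃ (ε c : ℝ) (q n₁ : ℕ), 0 < ε ∧ ε ≤ 1 ∧ 0 < c ∧
    ∀ (Ω : Type u) [MeasurableSpace Ω] (μ : Measure Ω) [IsProbabilityMeasure μ]
      (S : Lattice d → ℕ → Ω → Lattice d), IsFrogFamily μ S → ∀ x : Lattice d, n₁ ≤ norm1 x →
      ∃ p p' : ℝ, p + p' ≤ Real.exp (-((norm1 x : ℝ) ^ ε)) ∧
        μ.real {ω | ¬ passageTime (config S ω) 0 x ≤ (q * norm1 x : ℕ)} ≤ p ∧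
        μ.real {ω | ∃ (k : ℕ) (γ : Fin (k + 1) → Lattice d), (k : ℝ) ≤ c * norm1 x ∧
          Function.Injective γ ∧ γ 0 = 0 ∧ γ (Fin.last k) = x ∧
          pathTime (config S ω) γ ≤ (q * norm1 x : ℕ)} ≤ p' := by
  obtain ⟨g, L₀, q, hlin⟩ := exists_passageTime_linear.{u} hd
  obtain ⟨c, c', hc, hc', hshort⟩ := exists_measureReal_short_path_le.{u} hd (Nat.succ_pos q)
  -- `L ^ p ≤ n` implies the size condition of the linear bound as soon as `3 ≤ L`.
  set p : ℕ := 2 * g + 2 with hp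
  have hp0 : (0 : ℝ) < p := by positivity
  have hp1 : (1 : ℝ) ≤ p := by exact_mod_cast (by omega : 1 ≤ p)
  -- With `y = n ^ ε` and `L = ⌊y ^ 2⌋` one has `L ^ p ≤ y ^ (2 * p) = n`, while `exp (-L)` is about
  -- `exp (-y ^ 2)` and leaves room to absorb powers of `n` into `exp (-y)`.
  set ε : ℝ := 1 / (2 * p) with hε
  have hε0 : 0 < ε := by positivity
  have hev : ∀ᶠ n : ℕ in Filter.atTop, max (L₀ : ℝ) 3 + 1 ≤ ((n : ℝ) ^ ε) ^ 2 ∧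
      2 * ((n : ℝ) ^ ε) ^ (2 * p) * Real.exp (1 - ((n : ℝ) ^ ε) ^ 2)
        + (c * ((n : ℝ) ^ ε) ^ (2 * p) + 1) * Real.exp (-(c' * ((n : ℝ) ^ ε) ^ (2 * p)))
        ≤ Real.exp (-((n : ℝ) ^ ε)) :=
    ((tendsto_rpow_atTop hε0).comp tendsto_natCast_atTop_atTop).eventually
      (((Filter.tendsto_pow_atTop two_ne_zero).eventually_ge_atTop _).and
        (eventually_error_le c hc.le hc' (by omega : 1 ≤ p)))
  obtain ⟨n₁, hn₁⟩ := Filter.eventually_atTop.1 hev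
  -- The successor of `q` is used because the bound on short paths requires a positive time
  -- constant.
  refine ⟨ε, c, q + 1, n₁, hε0, ?_, hc, ?_⟩
  · rw [hε, div_le_one (by positivity)]; linarith
  intro Ω _ μ _ S hS x hx
  set n : ℕ := norm1 x with hn
  obtain ⟨hL, herr⟩ := hn₁ n hx
  set y : ℝ := (n : ℝ) ^ ε with hy
  have hy0 : 0 ≤ y := by positivity
  have hyn : y ^ (2 * p) = n := by
    rw [hy, ← Real.rpow_natCast, ← Real.rpow_mul (Nat.cast_nonneg n), hε]
    push_cast
    rw [one_div_mul_cancel (by positivity), Real.rpow_one]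
  rw [hyn] at herr
  set L : ℕ := ⌊y ^ 2⌋₊ with hLdef
  have hLle : (L : ℝ) ≤ y ^ 2 := Nat.floor_le (by positivity)
  have hLlt : y ^ 2 - 1 < L := Nat.sub_one_lt_floor _
  have hL₀ : L₀ ≤ L := by
    have := le_max_left (L₀ : ℝ) 3
    have : (L₀ : ℝ) ≤ L := by linarith
    exact_mod_cast this
  have hL3 : 3 ≤ L := by
    have := le_max_right (L₀ : ℝ) 3
    have : (3 : ℝ) ≤ L := by linarith
    exact_mod_cast this
  have hLn : L ^ p ≤ n := by
    have : (L : ℝ) ^ p ≤ n := by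
      calc (L : ℝ) ^ p ≤ (y ^ 2) ^ p := by gcongr
        _ = n := by rw [← pow_mul, hyn]
    exact_mod_cast this
  have hcond : (2 * L ^ g + 1) * L ^ g * L ≤ n := by
    refine le_trans ?_ hLn
    have h1 : 1 ≤ L ^ g := Nat.one_le_pow _ _ (by omega)
    calc (2 * L ^ g + 1) * L ^ g * L ≤ (L * L ^ g) * L ^ g * L := by gcongr; nlinarith
      _ = L ^ p := by rw [hp]; ring
  have hmono : μ.real {ω | ¬ passageTime (config S ω) 0 x ≤ ((q + 1) * n : ℕ)}
      ≤ μ.real {ω | ¬ passageTime (config S ω) 0 x ≤ (q * n : ℕ)} := by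
    refine measureReal_mono (fun ω hω hle => hω (hle.trans ?_)) (measure_ne_top _ _)
    have : q * n ≤ (q + 1) * n := by gcongr; omega
    exact_mod_cast this
  refine ⟨_, _, le_trans ?_ herr, hmono.trans (hlin L hL₀ Ω μ S hS x hcond), hshort Ω μ S hS x⟩
  gcongr
  linarith

end Frog

open Frog in
theorem proposition1p2 (d : ℕ) (hd : 2 ≤ d) :
    ∃ ε c C : ℝ, 0 < ε ∧ 0 < c ∧ 0 < C ∧
      ∀ (Ω : Type*) [MeasurableSpace Ω] (μ : Measure Ω) [IsProbabilityMeasure μ]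
        (S : Frog.Lattice d → ℕ → Ω → Frog.Lattice d), Frog.IsFrogFamily μ S →
      ∀ x : Frog.Lattice d,
        1 - Real.exp (-((Frog.norm1 x : ℝ) ^ ε)) ≤
          μ.real {ω | (Frog.optimalLengths (fun y n => S y n ω) 0 x).Nonempty ∧
            ∀ l ∈ Frog.optimalLengths (fun y n => S y n ω) 0 x,
              c * (Frog.norm1 x : ℝ) ≤ (l : ℝ) ∧ (l : ℝ) ≤ C * (Frog.norm1 x : ℝ)} := by
  classical
  have hd0 : d ≠ 0 := by omega
  obtain ⟨g, L₀, htail⟩ := exists_passageTime_tail hd0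
  obtain ⟨ε, c, q, n₁, hε0, hε1, hc, hlarge⟩ := exists_large_distance_bounds hd0
  set L : ℕ := max L₀ n₁ with hL
  -- For norms up to `n₁` the first minimum makes the lower bound at most one, and the second
  -- maximum covers passage times up to `L ^ g`.
  refine ⟨ε, min c (1 / (n₁ + 1)), max ((q : ℝ) + 1) ((L ^ g : ℕ) + 1), hε0, by positivity,
    by positivity, ?_⟩
  intro Ω _ μ _ S hS x
  rcases Nat.eq_zero_or_pos (norm1 x) with h0 | h0
  -- At the origin the required probability is `1 - exp 0 = 0`, because `0 ^ ε = 0`.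
  · rw [h0, Nat.cast_zero, Real.zero_rpow hε0.ne', neg_zero, Real.exp_zero, sub_self]
    exact measureReal_nonneg
  rcases le_total n₁ (norm1 x) with hn | hn
  · obtain ⟨p, p', hpp, h1, h2⟩ := hlarge Ω μ S hS x hn
    refine le_trans (by linarith) (hS.measureReal_lengths_ge_of_large h0 (min_le_left _ _)
      (le_max_left _ _) h1 h2)
  -- The tail is applied with all walks moving. Its error suffices since `ε ≤ 1` gives `norm1 x ^ ε
  -- ≤ norm1 x ≤ L`.
  · have h1 := htail L (le_max_left _ _) Ω μ S hS x (hn.trans (le_max_right _ _)) Set.univ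
      fun z _ => Set.mem_univ z
    simp only [mask_univ] at h1
    have hx1 : (1 : ℝ) ≤ norm1 x := by exact_mod_cast h0
    refine hS.measureReal_lengths_ge_of_small h0 hn ?_ (by positivity) (le_max_right _ _)
      (h1.trans (Real.exp_le_exp.2 (neg_le_neg ?_)))
    · calc min c (1 / (n₁ + 1)) * (n₁ : ℝ) ≤ 1 / (n₁ + 1) * (n₁ + 1) := by
            gcongr
            · exact min_le_right _ _
            · linarith
        _ = 1 := by field_simp
    · calc (norm1 x : ℝ) ^ ε ≤ (norm1 x : ℝ) ^ (1 : ℝ) := Real.rpow_le_rpow_of_exponent_le hx1 hε1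
        _ = norm1 x := Real.rpow_one _
        _ ≤ L := by exact_mod_cast hn.trans (le_max_right _ _)
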